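/- **Setting.** Let $U\subset\mathbb R^n$ be an open coordinate domain with smooth real tensor fields: a symmetric non-degenerate $g_{MN}$ (the metric), a $(1,1)$-tensor $I_N{}^M$, and a 3-form $C=\frac1{3!}C_{SPM}\,dx^S\wedge dx^P\wedge dx^M$ (the torsion). An $\mathcal N=1$ superfield is $\mathcal X^M(t,\theta)=x^M(t)+i\theta\psi^M(t)$, where $x^M$ and $\psi^M$ are smooth functions of $t$ with even, respectively odd, values in a finitely generated complex Grassmann algebra, and the numerical part of $x$ is real and lies in $U$; functions on $U$ are extended to $\mathcal X$ by Taylor expansion in the nilpotent part. Put $D=\frac{\partial}{\partial\theta}-i\theta\frac{\partial}{\partial t}$, and consider the action $$S=\frac i2\int dt\,d\theta\; g_{MN}(\mathcal X)\,\dot{\mathcal X}^M D\mathcal X^N-\frac1{12}\int dt\,d\theta\; C_{SPM}(\mathcal X)\,D\mathcal X^S D\mathcal X^P D\mathcal X^M .$$ **Theorem.** Suppose that on $U$: 1. $I_M{}^N I_N{}^K=-\delta_M^K$; 2. $I$ is integrable: $\partial_{[M}I_{N]}{}^P=I_M{}^Q I_N{}^S\,\partial_{[Q}I_{S]}{}^P$;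 3. $I_{MN}:=g_{NK}I_M{}^K$ is skew-symmetric; 4. $\hat\nabla_L I_N{}^M+\hat\nabla_N I_L{}^M=0$, where $\hat\nabla_P I_M{}^N=\partial_P I_M{}^N-\hat\Gamma^Q_{PM}I_Q{}^N+\hat\Gamma^N_{PQ}I_M{}^Q$ and $\hat\Gamma^Q_{PM}=\Gamma^Q_{PM}+\frac12 g^{QS}C_{SPM}$, with $\Gamma$ the Levi-Civita connection of $g$; 5. $\iota\, dC=\frac23\, d(\iota C)$, where $(\iota\omega)(v_1,\dots,v_k)=\sum_j\omega(v_1,\dots,Iv_j,\dots,v_k)$ for a $k$-form $\omega$, with $(Iv)^M=v^N I_N{}^M$. Then: (a) $S$ is invariant under $\delta\mathcal X^M=\epsilon\, I_N{}^M(\mathcal X)\,D\mathcal X^N$ for every constant odd $\epsilon$: on every time interval $[a,b]$ one has $S[\mathcal X+\delta\mathcal X]=S[\mathcal X]$ for all superfields for which surface terms are absent, that is, such that either $\delta x^M$ vanishes at $a$ and $b$, or $\mathcal X$ and $\dot{\mathcal X}$ take the same values at $a$ and $b$. (b) The generators $Q_1$ of the manifest supersymmetry $\delta\mathcal X^M=\epsilon_0\big(\frac{\partial}{\partial\theta}+i\theta\frac{\partial}{\partial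 t}\big)\mathcal X^M$ and $Q_2$ of the extra supersymmetry in (a) satisfy off shell the $\mathcal N=2$ algebra $(Q_1)^2=(Q_2)^2=H$, $\{Q_1,Q_2\}=0$, where $H$ generates time translations. That is, for all constant odd $\epsilon_1,\epsilon_2$ and all superfields, $(\delta_2\delta_1-\delta_1\delta_2)\mathcal X^M=-2i\epsilon_1\epsilon_2\,\dot{\mathcal X}^M$ if $\delta_1,\delta_2$ (with parameters $\epsilon_1,\epsilon_2$) are both manifest or both extra supersymmetry transformations, and $(\delta_2\delta_1-\delta_1\delta_2)\mathcal X^M=0$ if $\delta_1$ is a manifest one and $\delta_2$ an extra one. Here $\delta_2\delta_1\mathcal X$ is the result of varying the fields in $\delta_1\mathcal X$ by $\delta_2$. -/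

import Mathlib

noncomputable section

namespace SuperSigma

/-! ### Grassmann numbers and functions on superspace -/

/-- The complex Grassmann algebra with `N + 1` anticommuting generators. Generator number `0` is the
odd coordinate `θ` of superspace; the other `N` generators are odd constants, from which
the Grassmann-valued component fields and the odd parameters are built. -/
abbrev Grass (N : ℕ) : Type := ExteriorAlgebra ℂ (Fin (N + 1) → ℂ)

/-- A (not necessarily smooth) function on superspace `(t, θ)`, as the function
`t ↦ F₀(t) + θ F₁(t)`. -/
abbrev SFun (N : ℕ) : Type := ℝ → Grass N

variable {N n : ℕ}

/-- The basis of monomials in the generators. -/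
def grassBasis (N : ℕ) : Module.Basis (Finset (Fin (N + 1))) ℂ (Grass N) :=
  (Pi.basisFun ℂ (Fin (N + 1))).ExteriorAlgebra

/-- The odd coordinate `θ`. -/
def theta (N : ℕ) : Grass N := ExteriorAlgebra.ι ℂ (Pi.single 0 1)

/-- The left derivative `∂/∂θ`, which is also the Berezin integral `∫ dθ`. -/
def dTheta : Grass N →ₗ[ℂ] Grass N :=
  CliffordAlgebra.contractLeft (LinearMap.proj 0 : (Fin (N + 1) → ℂ) →ₗ[ℂ] ℂ)

/-- Even (commuting) elements. -/
def IsEven (z : Grass N) : Prop :=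
  z ∈ CliffordAlgebra.evenOdd (0 : QuadraticForm ℂ (Fin (N + 1) → ℂ)) 0

/-- Odd (anticommuting) elements. -/
def IsOdd (z : Grass N) : Prop :=
  z ∈ CliffordAlgebra.evenOdd (0 : QuadraticForm ℂ (Fin (N + 1) → ℂ)) 1

/-- An odd parameter: an odd element that does not contain `θ`. -/
def IsOddParameter (ε : Grass N) : Prop := IsOdd ε ∧ dTheta ε = 0

/-- Smoothness in `t`, coefficient by coefficient. -/
def SmoothInTime (F : SFun N) : Prop :=
  ∀ s, ContDiff ℝ (⊤ : ℕ∞) (fun t => (grassBasis N).repr (F t) s)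

/-- The time derivative, taken coefficient by coefficient. -/
def timeDeriv (F : SFun N) : SFun N := fun t =>
  ∑ s, deriv (fun u => (grassBasis N).repr (F u) s) t • grassBasis N s

/-- The integral over `a ≤ t ≤ b`, taken coefficient by coefficient. -/
def timeIntegral (a b : ℝ) (F : SFun N) : Grass N :=
  ∑ s, (∫ t in a..b, (grassBasis N).repr (F t) s) • grassBasis N s

/-- The supersymmetric covariant derivative `D = ∂/∂θ - i θ ∂/∂t`. -/
def covD (F : SFun N) : SFun N := fun t =>
  dTheta (F t) - Complex.I • (theta N * timeDeriv F t)

/-- The generator `∂/∂θ + i θ ∂/∂t` of the manifest supersymmetry. -/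
def genQ (F : SFun N) : SFun N := fun t =>
  dTheta (F t) + Complex.I • (theta N * timeDeriv F t)

/-- The integral `∫ dt dθ F` over superspace, with `a ≤ t ≤ b`. -/
def superIntegral (a b : ℝ) (F : SFun N) : Grass N :=
  timeIntegral a b (fun t => dTheta (F t))

/-- The value of `F` at `θ = 0`. -/
def atThetaZero (z : Grass N) : Grass N := dTheta (theta N * z)

/-! ### Superfields -/

/-- The real numerical parts of an `n`-tuple of superspace functions. -/
def body (X : Fin n → SFun N) (t : ℝ) : Fin n → ℝ := fun M =>
  (ExteriorAlgebra.algebraMapInv (X M t)).re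

/-- The nilpotent part `X - body X`. -/
def soul (X : Fin n → SFun N) (M : Fin n) (t : ℝ) : Grass N :=
  X M t - algebraMap ℂ (Grass N) (body X t M : ℂ)

/-- `X^M(t,θ) = x^M(t) + i θ ψ^M(t)` is an even superfield, smooth in time, with values in the
coordinate domain `U`: its numerical part is real and lies in `U`. -/
structure IsSuperfield (U : Set (Fin n → ℝ)) (X : Fin n → SFun N) : Prop where
  smooth : ∀ M, SmoothInTime (X M)
  even : ∀ M t, IsEven (X M t)
  body_real : ∀ M t, (ExteriorAlgebra.algebraMapInv (X M t)).im = 0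
  body_mem : ∀ t, body X t ∈ U

/-- The standard extension `f(X)` of a smooth function `f` of `n` real variables to even
Grassmann arguments, by its Taylor expansion around the numerical part of `X`. Products of more than
`N + 1` nilpotent parts vanish, so the finite sum is the complete series. -/
def superEval (f : (Fin n → ℝ) → ℝ) (X : Fin n → SFun N) : SFun N := fun t =>
  ∑ k ∈ Finset.range (N + 2), ((k.factorial : ℂ)⁻¹) •
    ∑ i : Fin k → Fin n,
      ((iteratedFDeriv ℝ k f (body X t) (fun j => Pi.single (i j) 1) : ℝ) : ℂ) •
        (List.ofFn (fun j => soul X (i j) t)).prod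

/-! ### Tensors on the target space -/

/-- The partial derivative `∂_L f`. -/
def pd (L : Fin n) (f : (Fin n → ℝ) → ℝ) (x : Fin n → ℝ) : ℝ :=
  fderiv ℝ f x (Pi.single L 1)

/-- The component `C_{SPM}` of a 3-form `C = (1/3!) C_{SPM} dx^S ∧ dx^P ∧ dx^M`. -/
def comp3 (C : (Fin n → ℝ) → (Fin n → ℝ) [⋀^Fin 3]→L[ℝ] ℝ) (S P M : Fin n)
    (x : Fin n → ℝ) : ℝ :=
  C x ![Pi.single S 1, Pi.single P 1, Pi.single M 1]

/-- The Christoffel symbols `Γ^Q_{PM}` of the Levi-Civita connection of `g`. -/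
def christoffel (g : (Fin n → ℝ) → Matrix (Fin n) (Fin n) ℝ) (Q P M : Fin n)
    (x : Fin n → ℝ) : ℝ :=
  (1 / 2) * ∑ S, (g x)⁻¹ Q S *
    (pd P (fun y => g y S M) x + pd M (fun y => g y S P) x - pd S (fun y => g y P M) x)

/-- The torsionful connection `Γ̂^Q_{PM} = Γ^Q_{PM} + (1/2) g^{QS} C_{SPM}`. -/
def gammaHat (g : (Fin n → ℝ) → Matrix (Fin n) (Fin n) ℝ)
    (C : (Fin n → ℝ) → (Fin n → ℝ) [⋀^Fin 3]→L[ℝ] ℝ) (Q P M : Fin n)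
    (x : Fin n → ℝ) : ℝ :=
  christoffel g Q P M x + (1 / 2) * ∑ S, (g x)⁻¹ Q S * comp3 C S P M x

/-- The covariant derivative
`∇̂_P I_M^N = ∂_P I_M^N - Γ̂^Q_{PM} I_Q^N + Γ̂^N_{PQ} I_M^Q`. Here and below `I_M^N` is the
entry `I x M N`. -/
def nablaHat (g : (Fin n → ℝ) → Matrix (Fin n) (Fin n) ℝ)
    (C : (Fin n → ℝ) → (Fin n → ℝ) [⋀^Fin 3]→L[ℝ] ℝ)
    (I : (Fin n → ℝ) → Matrix (Fin n) (Fin n) ℝ) (P M K : Fin n) (x : Fin n → ℝ) : ℝ :=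
  pd P (fun y => I y M K) x - ∑ Q, gammaHat g C Q P M x * I x Q K
    + ∑ Q, gammaHat g C K P Q x * I x M Q

/-- Integrability:
`∂_{[M} I_{K]}^P = I_M^Q I_K^S ∂_{[Q} I_{S]}^P`, that is, the Nijenhuis tensor vanishes. -/
def IsIntegrableOn (I : (Fin n → ℝ) → Matrix (Fin n) (Fin n) ℝ) (U : Set (Fin n → ℝ)) : Prop :=
  ∀ x ∈ U, ∀ M K P,
    pd M (fun y => I y K P) x - pd K (fun y => I y M P) x =
      ∑ Q, ∑ S, I x M Q * I x K S *
        (pd Q (fun y => I y S P) x - pd S (fun y => I y Q P) x)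

/-- The lowered tensor `I_{MK} = g_{KL} I_M^L`. -/
def lowered (g I : (Fin n → ℝ) → Matrix (Fin n) (Fin n) ℝ) (M K : Fin n) (x : Fin n → ℝ) : ℝ :=
  ∑ L, g x K L * I x M L

/-- The endomorphism `v ↦ v^M I_M^N` of the tangent space. -/
def endo (A : Matrix (Fin n) (Fin n) ℝ) : (Fin n → ℝ) →L[ℝ] (Fin n → ℝ) :=
  LinearMap.toContinuousLinearMap (Matrix.vecMulLinear A)

/-- The derivation-like action of an endomorphism `A` on alternating forms:
`(ι η)(v₁, …, v_k) = ∑ⱼ η(v₁, …, A vⱼ, …, v_k)`. -/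
def iota {k : ℕ} (A : (Fin n → ℝ) →L[ℝ] (Fin n → ℝ)) (η : (Fin n → ℝ) [⋀^Fin k]→L[ℝ] ℝ) :
    (Fin n → ℝ) [⋀^Fin k]→L[ℝ] ℝ where
  toContinuousMultilinearMap :=
    ∑ j, η.toContinuousMultilinearMap.compContinuousLinearMap
      (fun i => if i = j then A else ContinuousLinearMap.id ℝ (Fin n → ℝ))
  map_eq_zero_of_eq' := by
    intro v a b hv hab
    have key : ∀ j, (η.toContinuousMultilinearMap.compContinuousLinearMap
        (fun i => if i = j then A else ContinuousLinearMap.id ℝ (Fin n → ℝ))) v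
        = η (Function.update v j (A (v j))) := by
      intro j
      change η (fun i => (if i = j then A else ContinuousLinearMap.id ℝ (Fin n → ℝ)) (v i)) = _
      congr 1
      funext i
      by_cases h : i = j
      · subst h; simp
      · simp [h]
    have h0 : ∀ j, j ≠ a ∧ j ≠ b → η (Function.update v j (A (v j))) = 0 := by
      rintro j ⟨hja, hjb⟩
      refine η.map_eq_zero_of_eq _ ?_ hab
      rw [Function.update_of_ne hja.symm, Function.update_of_ne hjb.symm, hv]
    change (∑ j, η.toContinuousMultilinearMap.compContinuousLinearMap
      (fun i => if i = j then A else ContinuousLinearMap.id ℝ (Fin n → ℝ))) v = 0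
    rw [_root_.sum_apply]
    simp only [key]
    rw [Fintype.sum_eq_add a b hab h0]
    have hs : Function.update v b (A (v b)) = (Function.update v a (A (v a))) ∘ Equiv.swap a b := by
      funext i
      by_cases hia : i = a
      · subst hia
        simp [Function.update_of_ne hab, Function.update_of_ne hab.symm, hv]
      · by_cases hib : i = b
        · subst hib
          simp [hv]
        · simp [Equiv.swap_apply_of_ne_of_ne hia hib, Function.update_of_ne hia,
            Function.update_of_ne hib]
    have hw := η.toAlternatingMap.map_swap (Function.update v a (A (v a))) hab
    have hw' : η (Function.update v b (A (v b))) = - η (Function.update v a (A (v a))) := by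
      rw [hs]; exact hw
    rw [hw']; ring

/-! ### The action and the transformations -/

/-- The superspace Lagrangian
`(i/2) g_{MK}(X) Ẋ^M DX^K - (1/12) C_{SPM}(X) DX^S DX^P DX^M`. -/
def superLagrangian (g : (Fin n → ℝ) → Matrix (Fin n) (Fin n) ℝ)
    (C : (Fin n → ℝ) → (Fin n → ℝ) [⋀^Fin 3]→L[ℝ] ℝ) (X : Fin n → SFun N) : SFun N :=
  (Complex.I / 2) • (∑ M, ∑ K,
      superEval (fun y => g y M K) X * timeDeriv (X M) * covD (X K))
    - (1 / 12 : ℂ) • (∑ S, ∑ P, ∑ M,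
      superEval (comp3 C S P M) X * covD (X S) * covD (X P) * covD (X M))

/-- The action on the time interval `a ≤ t ≤ b`. -/
def action (g : (Fin n → ℝ) → Matrix (Fin n) (Fin n) ℝ)
    (C : (Fin n → ℝ) → (Fin n → ℝ) [⋀^Fin 3]→L[ℝ] ℝ) (a b : ℝ) (X : Fin n → SFun N) : Grass N :=
  superIntegral a b (superLagrangian g C X)

/-- The extra supersymmetry variation `δX^M = ε I_K^M(X) DX^K`. -/
def extraVar (I : (Fin n → ℝ) → Matrix (Fin n) (Fin n) ℝ) (ε : Grass N) (X : Fin n → SFun N) :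
    Fin n → SFun N := fun M t =>
  ε * ∑ K, superEval (fun y => I y K M) X t * covD (X K) t

/-- The extra supersymmetry transformation `X ↦ X + δX`. Since `ε * ε = 0`, it is the exponential of
the variation `δ`. -/
def extraSusy (I : (Fin n → ℝ) → Matrix (Fin n) (Fin n) ℝ) (ε : Grass N) (X : Fin n → SFun N) :
    Fin n → SFun N := fun M t =>
  X M t + extraVar I ε X M t

/-- The manifest supersymmetry transformation `X ↦ X + ε (∂/∂θ + i θ ∂/∂t) X`; for
`X = x + i θ ψ` it reads `δx = i ε ψ`, `δψ = - ε ẋ`. -/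
def manifestSusy (ε : Grass N) (X : Fin n → SFun N) : Fin n → SFun N := fun M t =>
  X M t + ε * genQ (X M) t

/-- For transformations `T₁ : X ↦ X + δ₁X` and `T₂ : X ↦ X + δ₂X` with nilpotent parameters that
enter linearly, `T₁ (T₂ X) - T₂ (T₁ X)` is the commutator `(δ₂ δ₁ - δ₁ δ₂) X`, where `δ₂ δ₁ X` is
the result of varying the fields in the expression `δ₁X` by `δ₂`. -/
def commutator (T₁ T₂ : (Fin n → SFun N) → (Fin n → SFun N)) (X : Fin n → SFun N) :
    Fin n → SFun N := fun M t =>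
  T₁ (T₂ X) M t - T₂ (T₁ X) M t

/-- The boundary conditions under which surface terms are dropped on `a ≤ t ≤ b`: either the variation
of the bosonic fields `x^M = X^M|_{θ=0}` vanishes at both ends, or the fields (with their
velocities) are periodic. -/
def NoSurfaceTerms (I : (Fin n → ℝ) → Matrix (Fin n) (Fin n) ℝ) (a b : ℝ) (ε : Grass N)
    (X : Fin n → SFun N) : Prop :=
  (∀ M, atThetaZero (extraVar I ε X M a) = 0 ∧ atThetaZero (extraVar I ε X M b) = 0) ∨
  (∀ M, X M a = X M b ∧ timeDeriv (X M) a = timeDeriv (X M) b)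

end SuperSigma

end

/-! An odd parameter satisfies `ε² = 0`, so a variation `X ↦ X + ε W` acts exactly to first order:
on products (`first_order_mul`), on target functions (`IsSuperfield.eval_vary`) and on the
Lagrangian (`IsSuperfield.lagrangian_vary`). Everything thus reduces to finite identities in the
velocities `p = Ẋ`, the odd derivatives `ξ = DX` and `τ = ∂_t DX`, with tensor components evaluated
on `X` as coefficients.

To work with these coefficients one needs `f ↦ f(X)` to be a ring homomorphism obeying the chain
rule for `∂_t` and `D`. The Taylor terms satisfy a recursion in the order, each operation of
interest satisfies the differentiated recursion (`taylorTerm_chain`), and the series stops because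
nilpotent parts lie in an ideal whose power `N + 2` vanishes (`degreeGE_eq_bot`). Even functions are
central, so tensor identities on `U` become identities between scalars of a commutative ring
(`IsSuperfield.eval`).

Part (a). With `Y = I DX` the Lagrangian changes by `ε D B` for an explicit `B`
(`IsSuperfield.lagrangian_extra`). The difference of the two sides has four kinds of terms
(`variation_eq_superDeriv`). Those in `p p` and `τ ξ` cancel because the lowered `I` is skew. The
coefficient of `p ξ ξ` is symmetric in the two odd slots, a linear consequence of condition 4 and of
the derivative of condition 3 (`cubic_identity`). The coefficient of `ξ ξ ξ ξ` is condition 5 in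
components (`torsion_identity`, `quartic_relation`). The superspace integral of `D(ε B)` is a
difference of values at `θ = 0`. Since `B` is built from `X` and `Ẋ`, it agrees at the two ends in
the periodic case. Since every term of `B` contains `Y` or `DX = -I Y`, the product `ε B` vanishes
at `θ = 0` wherever `δx` does.

Part (b). The operators `D` and `Q` square to `∓i ∂_t` and anticommute (`superDeriv_superDeriv`),
which settles the commutators involving a manifest transformation. For two extra ones the change of
`I DX` along `Y` has a part quadratic in `DX`, removed by integrability combined with the derivative
of `I² = -1`, and a part linear in `Ẋ`, which `I² = -1` reduces to `-i Ẋ`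
(`IsSuperfield.extraChange_extra`). -/

noncomputable section

namespace SuperSigma

variable {N n : ℕ}

/-! ### The Grassmann algebra -/

/-- The grading automorphism. -/
def parity : Grass N →ₐ[ℂ] Grass N := CliffordAlgebra.involute

theorem parity_ι (v : Fin (N + 1) → ℂ) : parity (ExteriorAlgebra.ι ℂ v) = -ExteriorAlgebra.ι ℂ v :=
  CliffordAlgebra.involute_ι v

theorem parity_parity (z : Grass N) : parity (parity z) = z :=
  CliffordAlgebra.involute_involute z

theorem IsEven.parity_eq {z : Grass N} (h : IsEven z) : parity z = z :=
  CliffordAlgebra.involute_eq_of_mem_even h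

theorem IsOdd.parity_eq {z : Grass N} (h : IsOdd z) : parity z = -z :=
  CliffordAlgebra.involute_eq_of_mem_odd h

theorem ι_mul_eq_parity_mul (v : Fin (N + 1) → ℂ) (z : Grass N) :
    ExteriorAlgebra.ι ℂ v * z = parity z * ExteriorAlgebra.ι ℂ v := by
  induction z using ExteriorAlgebra.induction with
  | algebraMap r => rw [AlgHom.commutes, Algebra.commutes]
  | ι w =>
    rw [parity_ι, neg_mul, ← eq_neg_iff_add_eq_zero.2 (ExteriorAlgebra.ι_add_mul_swap (R := ℂ) v w)]
  | mul a b ha hb => rw [map_mul, ← mul_assoc, ha, mul_assoc, hb, mul_assoc]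
  | add a b ha hb => rw [map_add, mul_add, add_mul, ha, hb]

/-- A generator passes any element at the price of `parity`, which acts trivially on `z`; induction
on the other factor does the rest. Centrality of even elements is what later allows them to serve as
scalars. -/
theorem mul_comm_of_parity_eq {z : Grass N} (hz : parity z = z) (w : Grass N) :
    w * z = z * w := by
  induction w using ExteriorAlgebra.induction with
  | algebraMap r => rw [Algebra.commutes]
  | ι v => rw [ι_mul_eq_parity_mul, hz]
  | mul a b ha hb => rw [mul_assoc, hb, ← mul_assoc, ha, mul_assoc]
  | add a b ha hb => rw [mul_add, add_mul, ha, hb]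

theorem mul_eq_mul_parity {z : Grass N} (hz : parity z = -z) (w : Grass N) :
    w * z = z * parity w := by
  induction w using ExteriorAlgebra.induction with
  | algebraMap r => rw [AlgHom.commutes, Algebra.commutes]
  | ι v => rw [ι_mul_eq_parity_mul, hz, parity_ι, mul_neg, neg_mul]
  | mul a b ha hb => rw [map_mul, mul_assoc, hb, ← mul_assoc, ha, mul_assoc]
  | add a b ha hb => rw [map_add, mul_add, add_mul, ha, hb]

theorem mul_anticomm_of_parity_eq_neg {z w : Grass N} (hz : parity z = -z) (hw : parity w = -w) :
    w * z = -(z * w) := by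
  rw [mul_eq_mul_parity hz, hw, mul_neg]

theorem eq_zero_of_eq_neg {z : Grass N} (h : z = -z) : z = 0 := by
  have h2 : (2 : ℂ) • z = 0 := by rw [two_smul]; nth_rewrite 1 [h]; exact neg_add_cancel z
  exact (smul_eq_zero.1 h2).resolve_left two_ne_zero

theorem mul_self_of_parity_eq_neg {z : Grass N} (hz : parity z = -z) : z * z = 0 := by
  exact eq_zero_of_eq_neg (mul_anticomm_of_parity_eq_neg hz hz)

theorem dTheta_ι_mul (v : Fin (N + 1) → ℂ) (z : Grass N) :
    dTheta (ExteriorAlgebra.ι ℂ v * z) = v 0 • z - ExteriorAlgebra.ι ℂ v * dTheta z :=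
  CliffordAlgebra.contractLeft_ι_mul _ _ _

theorem dTheta_algebraMap (r : ℂ) : dTheta (algebraMap ℂ (Grass N) r) = 0 :=
  CliffordAlgebra.contractLeft_algebraMap _ _ _

theorem dTheta_one : dTheta (1 : Grass N) = 0 :=
  CliffordAlgebra.contractLeft_one _ _

theorem dTheta_dTheta (z : Grass N) : dTheta (dTheta z) = 0 :=
  CliffordAlgebra.contractLeft_contractLeft _ _

theorem dTheta_mul (a b : Grass N) :
    dTheta (a * b) = dTheta a * b + parity a * dTheta b := by
  induction a using ExteriorAlgebra.induction generalizing b with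
  | algebraMap r =>
    rw [dTheta_algebraMap, AlgHom.commutes, ← Algebra.smul_def, ← Algebra.smul_def, map_smul]
    simp
  | ι v =>
    have h := dTheta_ι_mul v (1 : Grass N)
    rw [mul_one, dTheta_one, mul_zero, sub_zero] at h
    rw [dTheta_ι_mul, h, parity_ι, smul_mul_assoc, one_mul, neg_mul, sub_eq_add_neg]
  | mul x y hx hy => rw [mul_assoc, hx, hy, hx y, map_mul]; noncomm_ring
  | add x y hx hy => rw [add_mul, map_add, hx, hy, map_add, map_add]; noncomm_ring

theorem parity_dTheta (z : Grass N) : parity (dTheta z) = -dTheta (parity z) := by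
  induction z using ExteriorAlgebra.induction with
  | algebraMap r => rw [AlgHom.commutes, dTheta_algebraMap, map_zero, neg_zero]
  | ι v =>
    have h := dTheta_ι_mul v (1 : Grass N)
    rw [mul_one, dTheta_one, mul_zero, sub_zero] at h
    rw [parity_ι, map_neg, h, map_smul, map_one, neg_neg]
  | mul x y hx hy =>
    rw [dTheta_mul, map_add, map_mul, map_mul, hx, hy, map_mul, dTheta_mul, parity_parity]
    noncomm_ring
  | add x y hx hy => rw [map_add, map_add, hx, hy, map_add, map_add, neg_add]

theorem parity_theta : parity (theta N) = -theta N := parity_ι _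

theorem theta_mul_theta : theta N * theta N = 0 := ExteriorAlgebra.ι_sq_zero _

theorem dTheta_theta_mul (z : Grass N) : dTheta (theta N * z) = z - theta N * dTheta z := by
  rw [theta, dTheta_ι_mul]; simp

/-- Since `atThetaZero z = z - θ ∂_θ z`, the relation `θ² = 0` removes the cross term, and the
parity from moving `θ` to the front is the one in the graded Leibniz rule. -/
theorem atThetaZero_mul (a b : Grass N) : atThetaZero (a * b) = atThetaZero a * atThetaZero b := by
  simp only [atThetaZero, dTheta_theta_mul]
  rw [dTheta_mul]
  have h2 : dTheta a * theta N = theta N * parity (dTheta a) := mul_eq_mul_parity parity_theta _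
  have h3 : a * theta N = theta N * parity a := mul_eq_mul_parity parity_theta _
  have h4 : theta N * dTheta a * (theta N * dTheta b) = 0 := by
    rw [mul_assoc, ← mul_assoc (dTheta a), h2, ← mul_assoc, ← mul_assoc, theta_mul_theta,
      zero_mul, zero_mul]
  rw [sub_mul, mul_sub, mul_sub, ← mul_assoc a, h3, h4]
  noncomm_ring

theorem parity_algebraMap (c : ℂ) :
    parity (algebraMap ℂ (Grass N) c) = algebraMap ℂ (Grass N) c := AlgHom.commutes _ _

theorem algebraMapInv_parity (z : Grass N) :
    ExteriorAlgebra.algebraMapInv (parity z) = ExteriorAlgebra.algebraMapInv z := by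
  have h : ((ExteriorAlgebra.algebraMapInv (R := ℂ) (M := Fin (N + 1) → ℂ)).comp parity) =
      ExteriorAlgebra.algebraMapInv := by
    apply ExteriorAlgebra.hom_ext
    ext v
    simp [parity_ι, ExteriorAlgebra.algebraMapInv]
  exact DFunLike.congr_fun h z

theorem algebraMapInv_eq_zero_of_parity_eq_neg {z : Grass N} (hz : parity z = -z) :
    ExteriorAlgebra.algebraMapInv z = 0 := by
  have h := algebraMapInv_parity z
  rw [hz, map_neg] at h
  exact self_eq_neg.1 h.symm

/-! ### Nilpotency -/

/-- The elements all of whose monomials have degree at least `k`. -/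
def degreeGE (N k : ℕ) : Submodule ℂ (Grass N) :=
  LinearMap.range (ExteriorAlgebra.ι ℂ : (Fin (N + 1) → ℂ) →ₗ[ℂ] Grass N) ^ k * ⊤

/-- Generators cross any element up to a parity, so the right ideal they generate is two-sided; this
makes the filtration by degree multiplicative. -/
theorem top_mul_range_ι_le :
    (⊤ : Submodule ℂ (Grass N)) *
      LinearMap.range (ExteriorAlgebra.ι ℂ : (Fin (N + 1) → ℂ) →ₗ[ℂ] Grass N) ≤
    LinearMap.range (ExteriorAlgebra.ι ℂ : (Fin (N + 1) → ℂ) →ₗ[ℂ] Grass N) * ⊤ := by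
  rw [Submodule.mul_le]
  rintro z - _ ⟨v, rfl⟩
  have h : z * ExteriorAlgebra.ι ℂ v = ExteriorAlgebra.ι ℂ v * parity z := by
    rw [ι_mul_eq_parity_mul, parity_parity]
  rw [h]
  exact Submodule.mul_mem_mul ⟨v, rfl⟩ trivial

theorem top_mul_range_ι_pow_le (k : ℕ) :
    (⊤ : Submodule ℂ (Grass N)) *
      LinearMap.range (ExteriorAlgebra.ι ℂ : (Fin (N + 1) → ℂ) →ₗ[ℂ] Grass N) ^ k ≤
    degreeGE N k := by
  unfold degreeGE
  induction k with
  | zero => simp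
  | succ k ih =>
    rw [pow_succ, ← mul_assoc]
    refine (mul_le_mul' ih le_rfl).trans ?_
    rw [mul_assoc, mul_assoc]
    exact mul_le_mul' le_rfl top_mul_range_ι_le

theorem mul_mem_degreeGE {j k : ℕ} {a b : Grass N} (ha : a ∈ degreeGE N j)
    (hb : b ∈ degreeGE N k) : a * b ∈ degreeGE N (j + k) := by
  have h := Submodule.mul_mem_mul ha hb
  unfold degreeGE at h ⊢
  rw [mul_assoc, ← mul_assoc ⊤] at h
  have h2 := mul_le_mul' (le_refl (LinearMap.range
    (ExteriorAlgebra.ι ℂ : (Fin (N + 1) → ℂ) →ₗ[ℂ] Grass N) ^ j))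
    (mul_le_mul' (top_mul_range_ι_pow_le (N := N) k) (le_refl ⊤)) h
  unfold degreeGE at h2
  rw [mul_assoc _ ⊤ ⊤, ← mul_assoc, ← pow_add] at h2
  have h3 : LinearMap.range (ExteriorAlgebra.ι ℂ : (Fin (N + 1) → ℂ) →ₗ[ℂ] Grass N) ^ (j + k) *
      ((⊤ : Submodule ℂ (Grass N)) * ⊤) ≤ LinearMap.range
        (ExteriorAlgebra.ι ℂ : (Fin (N + 1) → ℂ) →ₗ[ℂ] Grass N) ^ (j + k) * ⊤ :=
    mul_le_mul' le_rfl le_top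
  exact h3 h2

theorem degreeGE_zero : degreeGE N 0 = ⊤ := by
  unfold degreeGE
  rw [pow_zero, one_mul]

/-- Any `N + 2` vectors in a space of dimension `N + 1` are linearly dependent, and their exterior
product vanishes. -/
theorem degreeGE_eq_bot : degreeGE N (N + 2) = ⊥ := by
  unfold degreeGE
  have h : LinearMap.range (ExteriorAlgebra.ι ℂ : (Fin (N + 1) → ℂ) →ₗ[ℂ] Grass N) ^ (N + 2)
      = ⊥ := by
    have h2 := ExteriorAlgebra.ιMulti_span_fixedDegree ℂ (M := Fin (N + 1) → ℂ) (N + 2)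
    refine h2.symm.trans ?_
    rw [Submodule.span_eq_bot]
    rintro _ ⟨v, rfl⟩
    apply AlternatingMap.map_linearDependent
    intro hv
    have := hv.fintype_card_le_finrank
    simp at this
  rw [h, Submodule.bot_mul]

/-- Every element minus its scalar part lies in the ideal of the generators; for a product, `ab -
a₀b₀ = (a - a₀)b + a₀(b - b₀)`. -/
theorem mem_degreeGE_one {z : Grass N} (hz : ExteriorAlgebra.algebraMapInv z = 0) :
    z ∈ degreeGE N 1 := by
  have h : z - algebraMap ℂ (Grass N) (ExteriorAlgebra.algebraMapInv z) ∈ degreeGE N 1 := by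
    clear hz
    induction z using ExteriorAlgebra.induction with
    | algebraMap r =>
      rw [AlgHom.commutes]; simp
    | ι v =>
      have : ExteriorAlgebra.algebraMapInv (ExteriorAlgebra.ι ℂ v) = 0 :=
        algebraMapInv_eq_zero_of_parity_eq_neg (parity_ι v)
      rw [this, map_zero, sub_zero]
      unfold degreeGE
      rw [pow_one, ← mul_one (ExteriorAlgebra.ι ℂ v)]
      exact Submodule.mul_mem_mul ⟨v, rfl⟩ trivial
    | mul a b ha hb =>
      have h1 := mul_mem_degreeGE ha (degreeGE_zero (N := N) ▸ Submodule.mem_top (x := b))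
      have h2 := mul_mem_degreeGE (degreeGE_zero (N := N) ▸ Submodule.mem_top
        (x := algebraMap ℂ (Grass N) (ExteriorAlgebra.algebraMapInv a))) hb
      rw [zero_add] at h2
      have h3 := Submodule.add_mem _ h1 h2
      convert h3 using 1
      rw [map_mul, map_mul]; noncomm_ring
    | add a b ha hb =>
      convert Submodule.add_mem _ ha hb using 1
      rw [map_add, map_add]; noncomm_ring
  rwa [hz, map_zero, sub_zero] at h

end SuperSigma

namespace SuperSigma

variable {N n : ℕ}

/-! ### Smooth functions on superspace -/

theorem repr_linearMap (φ : Grass N →ₗ[ℂ] Grass N) (a : Grass N) (s : Finset (Fin (N + 1))) :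
    (grassBasis N).repr (φ a) s =
      ∑ u, (grassBasis N).repr a u * (grassBasis N).repr (φ (grassBasis N u)) s := by
  conv_lhs => rw [← (grassBasis N).sum_repr a]
  simp only [map_sum, map_smul, Finsupp.coe_finsetSum, Finset.sum_apply, Finsupp.coe_smul,
    Pi.smul_apply, smul_eq_mul]

/-- Structure constants turn a product into finite sums of products of coefficient functions, which
reduces smoothness and the product rule in time to complex-valued functions. -/
theorem repr_mul (a b : Grass N) (s : Finset (Fin (N + 1))) :
    (grassBasis N).repr (a * b) s =
      ∑ u, ∑ v, (grassBasis N).repr a u * ((grassBasis N).repr b v *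
        (grassBasis N).repr (grassBasis N u * grassBasis N v) s) := by
  have h := repr_linearMap (LinearMap.mulRight ℂ b) a s
  rw [LinearMap.mulRight_apply] at h
  rw [h]
  refine Finset.sum_congr rfl fun u _ => ?_
  have h2 := repr_linearMap (LinearMap.mulLeft ℂ (grassBasis N u)) b s
  rw [LinearMap.mulLeft_apply] at h2
  rw [LinearMap.mulRight_apply, h2, Finset.mul_sum]
  rfl

theorem repr_timeDeriv (F : SFun N) (t : ℝ) (s : Finset (Fin (N + 1))) :
    (grassBasis N).repr (timeDeriv F t) s = deriv (fun u => (grassBasis N).repr (F u) s) t := by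
  rw [timeDeriv, Module.Basis.repr_sum_self]

theorem SmoothInTime.hasDerivAt {F : SFun N} (hF : SmoothInTime F) (t : ℝ)
    (s : Finset (Fin (N + 1))) :
    HasDerivAt (fun u => (grassBasis N).repr (F u) s) ((grassBasis N).repr (timeDeriv F t) s) t := by
  rw [repr_timeDeriv]
  exact ((hF s).differentiable (by simp) t).hasDerivAt

theorem timeDeriv_eq_of_hasDerivAt {F : SFun N} {t : ℝ} {z : Grass N}
    (h : ∀ s, HasDerivAt (fun u => (grassBasis N).repr (F u) s) ((grassBasis N).repr z s) t) :
    timeDeriv F t = z := by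
  apply (grassBasis N).repr.injective
  ext s
  rw [repr_timeDeriv]
  exact (h s).deriv

theorem SmoothInTime.mul {F G : SFun N} (hF : SmoothInTime F) (hG : SmoothInTime G) :
    SmoothInTime (F * G) := fun s => by
  have h : (fun t => (grassBasis N).repr ((F * G) t) s) = fun t => _ :=
    funext fun t => repr_mul (F t) (G t) s
  rw [h]
  exact ContDiff.sum fun u _ => ContDiff.sum fun v _ => (hF u).mul ((hG v).mul contDiff_const)

theorem SmoothInTime.add {F G : SFun N} (hF : SmoothInTime F) (hG : SmoothInTime G) :
    SmoothInTime (F + G) := fun s => by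
  simp only [Pi.add_apply, map_add, Finsupp.coe_add]
  exact (hF s).add (hG s)

theorem smoothInTime_const (z : Grass N) : SmoothInTime (fun _ => z) := fun _ => contDiff_const

theorem SmoothInTime.linearMap {F : SFun N} (hF : SmoothInTime F) (φ : Grass N →ₗ[ℂ] Grass N) :
    SmoothInTime (fun t => φ (F t)) := fun s => by
  have h : (fun t => (grassBasis N).repr (φ (F t)) s) = fun t => _ :=
    funext fun t => repr_linearMap φ (F t) s
  rw [h]
  exact ContDiff.sum fun u _ => (hF u).mul contDiff_const

theorem SmoothInTime.timeDeriv {F : SFun N} (hF : SmoothInTime F) :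
    SmoothInTime (timeDeriv F) := fun s => by
  simp only [repr_timeDeriv]
  exact (contDiff_infty_iff_deriv.1 (hF s)).2

theorem SmoothInTime.timeDeriv_mul {F G : SFun N} (hF : SmoothInTime F) (hG : SmoothInTime G)
    (t : ℝ) : SuperSigma.timeDeriv (F * G) t =
      SuperSigma.timeDeriv F t * G t + F t * SuperSigma.timeDeriv G t := by
  apply timeDeriv_eq_of_hasDerivAt
  intro s
  have h : (fun t => (grassBasis N).repr ((F * G) t) s) = fun t => _ :=
    funext fun t => repr_mul (F t) (G t) s
  rw [h, map_add, Finsupp.coe_add, Pi.add_apply, repr_mul, repr_mul, ← Finset.sum_add_distrib]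
  simp only [← Finset.sum_add_distrib]
  refine HasDerivAt.fun_sum fun u _ => HasDerivAt.fun_sum fun v _ => ?_
  exact (hF.hasDerivAt t u).mul ((hG.hasDerivAt t v).mul_const _)

theorem SmoothInTime.timeDeriv_linearMap {F : SFun N} (hF : SmoothInTime F)
    (φ : Grass N →ₗ[ℂ] Grass N) (t : ℝ) :
    SuperSigma.timeDeriv (fun t => φ (F t)) t = φ (SuperSigma.timeDeriv F t) := by
  apply timeDeriv_eq_of_hasDerivAt
  intro s
  have h : (fun t => (grassBasis N).repr (φ (F t)) s) = fun t => _ :=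
    funext fun t => repr_linearMap φ (F t) s
  rw [h, repr_linearMap]
  exact HasDerivAt.fun_sum fun u _ => (hF.hasDerivAt t u).mul_const _

/-- The algebra of functions on superspace that are smooth in time. -/
def smoothAlg (N : ℕ) : Subalgebra ℂ (SFun N) where
  carrier := {F | SmoothInTime F}
  mul_mem' := SmoothInTime.mul
  add_mem' := SmoothInTime.add
  algebraMap_mem' c := smoothInTime_const (algebraMap ℂ (Grass N) c)

/-- Functions on superspace that are smooth in time. -/
def SmoothFun (N : ℕ) : Type := smoothAlg N

instance : Ring (SmoothFun N) := inferInstanceAs (Ring (smoothAlg N))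

instance : Algebra ℂ (SmoothFun N) := inferInstanceAs (Algebra ℂ (smoothAlg N))

/-- The underlying function. -/
def SmoothFun.val (F : SmoothFun N) : SFun N := Subtype.val F

theorem SmoothFun.prop (F : SmoothFun N) : SmoothInTime F.val := Subtype.property F

/-- A smooth function as an element of the algebra of smooth functions. -/
def SmoothFun.mk (F : SFun N) (hF : SmoothInTime F) : SmoothFun N := ⟨F, hF⟩

theorem SmoothFun.ext {F G : SmoothFun N} (h : ∀ t, F.val t = G.val t) : F = G :=
  Subtype.ext (funext h)

/-- A linear map acting on the values. -/
def mapValues (φ : Grass N →ₗ[ℂ] Grass N) : SmoothFun N →ₗ[ℂ] SmoothFun N where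
  toFun F := .mk (fun t => φ (F.val t)) (F.prop.linearMap φ)
  map_add' F G := by exact SmoothFun.ext fun t => map_add φ _ _
  map_smul' c F := by exact SmoothFun.ext fun t => map_smul φ _ _

/-- Constant functions. -/
def constFun : Grass N →ₐ[ℂ] SmoothFun N where
  toFun z := .mk (fun _ => z) (smoothInTime_const z)
  map_one' := rfl
  map_mul' _ _ := rfl
  map_zero' := rfl
  map_add' _ _ := rfl
  commutes' _ := rfl

/-- The time derivative. -/
def ddt : SmoothFun N →ₗ[ℂ] SmoothFun N where
  toFun F := .mk (timeDeriv F.val) F.prop.timeDeriv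
  map_add' F G := by
    refine SmoothFun.ext fun t => timeDeriv_eq_of_hasDerivAt (F := fun u => F.val u + G.val u)
      (z := timeDeriv F.val t + timeDeriv G.val t) fun s => ?_
    simp only [map_add, Finsupp.coe_add]
    exact (F.prop.hasDerivAt t s).add (G.prop.hasDerivAt t s)
  map_smul' c F := by
    refine SmoothFun.ext fun t => timeDeriv_eq_of_hasDerivAt (F := fun u => c • F.val u)
      (z := c • timeDeriv F.val t) fun s => ?_
    simp only [map_smul, Finsupp.coe_smul]
    exact (F.prop.hasDerivAt t s).const_smul c

theorem ddt_mul (F G : SmoothFun N) : ddt (F * G) = ddt F * G + F * ddt G := by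
  exact SmoothFun.ext fun t => F.prop.timeDeriv_mul G.prop t

theorem ddt_constFun (z : Grass N) : ddt (constFun z) = 0 := by
  refine SmoothFun.ext fun t => timeDeriv_eq_of_hasDerivAt (F := fun _ => z)
    (z := 0) fun s => ?_
  change HasDerivAt (fun _ => (grassBasis N).repr z s) ((grassBasis N).repr 0 s) t
  simpa using hasDerivAt_const t ((grassBasis N).repr z s)

theorem ddt_mapValues (φ : Grass N →ₗ[ℂ] Grass N) (F : SmoothFun N) :
    ddt (mapValues φ F) = mapValues φ (ddt F) := by
  exact SmoothFun.ext fun t => F.prop.timeDeriv_linearMap φ t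

/-- The grading automorphism. -/
def parityFun : SmoothFun N →ₐ[ℂ] SmoothFun N where
  toFun := mapValues parity.toLinearMap
  map_one' := by exact SmoothFun.ext fun t => map_one parity
  map_mul' F G := by exact SmoothFun.ext fun t => map_mul parity _ _
  map_zero' := map_zero _
  map_add' := map_add _
  commutes' c := by exact SmoothFun.ext fun t => parity.commutes c

theorem parityFun_ddt (F : SmoothFun N) : parityFun (ddt F) = ddt (parityFun F) :=
  (ddt_mapValues _ _).symm

/-- The operators `∂/∂θ + c θ ∂/∂t`. -/
def superDeriv (c : ℂ) : SmoothFun N →ₗ[ℂ] SmoothFun N :=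
  mapValues dTheta + c • (LinearMap.mulLeft ℂ (constFun (theta N))).comp ddt

theorem superDeriv_eq (c : ℂ) (F : SmoothFun N) :
    superDeriv c F = mapValues dTheta F + c • (constFun (theta N) * ddt F) := rfl

theorem coe_superDeriv_neg_I (F : SmoothFun N) :
    (superDeriv (-Complex.I) F).val = covD F.val := by
  funext t
  change dTheta _ + (-Complex.I) • _ = dTheta _ - _
  rw [neg_smul, sub_eq_add_neg]
  rfl

theorem theta_mul_eq (F : SmoothFun N) :
    constFun (theta N) * F = parityFun F * constFun (theta N) := by
  refine SmoothFun.ext fun t => ?_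
  have := mul_eq_mul_parity parity_theta (parity (F.val t))
  rw [parity_parity] at this
  exact this.symm

theorem mapValues_dTheta_mul (F G : SmoothFun N) : mapValues dTheta (F * G) =
    mapValues dTheta F * G + parityFun F * mapValues dTheta G := by
  exact SmoothFun.ext fun t => dTheta_mul _ _

theorem superDeriv_mul (c : ℂ) (F G : SmoothFun N) :
    superDeriv c (F * G) = superDeriv c F * G + parityFun F * superDeriv c G := by
  have h : constFun (theta N) * (F * ddt G) = parityFun F * (constFun (theta N) * ddt G) := by
    rw [← mul_assoc, theta_mul_eq, mul_assoc]
  simp only [superDeriv_eq, mapValues_dTheta_mul, ddt_mul, mul_add, add_mul, smul_add, h,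
    smul_mul_assoc, mul_smul_comm, mul_assoc]
  abel

/-- One formula serves two purposes: `c' = c` leaves the square `c ∂_t`, and comparing `(-c, c)`
with `(c, -c)` shows that `D` and `Q` anticommute. -/
theorem superDeriv_superDeriv (c c' : ℂ) (F : SmoothFun N) :
    superDeriv c (superDeriv c' F) = c' • ddt F +
      (c - c') • (constFun (theta N) * mapValues dTheta (ddt F)) := by
  have h1 : mapValues dTheta (mapValues dTheta F) = 0 := by exact SmoothFun.ext fun t => dTheta_dTheta _
  have h2 : mapValues dTheta (constFun (theta N) * ddt F) =
      ddt F - constFun (theta N) * mapValues dTheta (ddt F) := by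
    exact SmoothFun.ext fun t => dTheta_theta_mul _
  have h3 : constFun (theta N) * constFun (theta N) = 0 := by
    rw [← map_mul, theta_mul_theta, map_zero]
  simp only [superDeriv_eq, map_add, map_smul, h1, h2, ddt_mul, ddt_constFun, ddt_mapValues,
    zero_mul, zero_add, ← mul_assoc, h3, smul_zero, add_zero]
  module

theorem ddt_superDeriv (c : ℂ) (F : SmoothFun N) :
    ddt (superDeriv c F) = superDeriv c (ddt F) := by
  simp only [superDeriv_eq, map_add, map_smul, ddt_mul, ddt_constFun, ddt_mapValues, zero_mul,
    zero_add]

theorem superDeriv_constFun {z : Grass N} (hz : dTheta z = 0) (c : ℂ) :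
    superDeriv c (constFun z) = 0 := by
  rw [superDeriv_eq, ddt_constFun, mul_zero, smul_zero, add_zero]
  exact SmoothFun.ext fun t => hz

theorem parityFun_superDeriv (c : ℂ) (F : SmoothFun N) :
    parityFun (superDeriv c F) = -superDeriv c (parityFun F) := by
  have h1 : parityFun (mapValues dTheta F) = -mapValues dTheta (parityFun F) := by
    exact SmoothFun.ext fun t => parity_dTheta _
  have h2 : parityFun (constFun (theta N)) = -constFun (theta N) := by
    exact SmoothFun.ext fun t => parity_theta
  simp only [superDeriv_eq, map_add, map_smul, map_mul, h1, h2, parityFun_ddt, neg_mul, smul_neg,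
    neg_add]

/-! ### The commutative algebra of even functions -/

/-- The algebra of even functions on superspace. -/
def evenAlg (N : ℕ) : Subalgebra ℂ (SmoothFun N) := AlgHom.equalizer parityFun (AlgHom.id ℂ _)

theorem mem_evenAlg {F : SmoothFun N} : F ∈ evenAlg N ↔ parityFun F = F := Iff.rfl

theorem commute_of_mem_evenAlg {F : SmoothFun N} (hF : F ∈ evenAlg N) (G : SmoothFun N) :
    F * G = G * F := by
  refine SmoothFun.ext fun t => ?_
  exact (mul_comm_of_parity_eq (congrFun (congrArg Subtype.val hF) t) (G.val t)).symm

/-- Even functions on superspace. -/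
def EvenFun (N : ℕ) : Type := evenAlg N

/-- The underlying smooth function. -/
def EvenFun.val (F : EvenFun N) : SmoothFun N := Subtype.val F

theorem EvenFun.prop (F : EvenFun N) : F.val ∈ evenAlg N := Subtype.property F

/-- An even function as an element of the algebra of even functions. -/
def EvenFun.mk (F : SmoothFun N) (hF : F ∈ evenAlg N) : EvenFun N := ⟨F, hF⟩

instance : Ring (EvenFun N) := inferInstanceAs (Ring (evenAlg N))

instance : CommRing (EvenFun N) :=
  { (inferInstance : Ring (EvenFun N)) with
    mul_comm := fun F G => Subtype.ext (commute_of_mem_evenAlg (EvenFun.prop F) (EvenFun.val G)) }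

instance : Algebra ℂ (EvenFun N) := inferInstanceAs (Algebra ℂ (evenAlg N))

/-- Tensor components and velocities are even, hence central. Treating them as scalars of a
commutative ring separates the algebra of coefficients from the signs of the odd factors. -/
instance : Algebra (EvenFun N) (SmoothFun N) :=
  RingHom.toAlgebra' (evenAlg N).val.toRingHom fun F G => commute_of_mem_evenAlg (EvenFun.prop F) G

theorem even_smul_def (F : EvenFun N) (G : SmoothFun N) : F • G = F.val * G := rfl

instance : IsScalarTower ℂ (EvenFun N) (SmoothFun N) :=
  ⟨fun c F G => by rw [even_smul_def, even_smul_def]; exact smul_mul_assoc c F.val G⟩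

/-- Odd functions. -/
def OddFun (F : SmoothFun N) : Prop := parityFun F = -F

theorem OddFun.mul_comm {F G : SmoothFun N} (hF : OddFun F) (hG : OddFun G) : F * G = -(G * F) := by
  refine SmoothFun.ext fun t => ?_
  exact mul_anticomm_of_parity_eq_neg (congrFun (congrArg Subtype.val hG) t)
    (congrFun (congrArg Subtype.val hF) t)

theorem OddFun.superDeriv {F : SmoothFun N} (hF : F ∈ evenAlg N) (c : ℂ) :
    OddFun (superDeriv c F) := by
  rw [OddFun, parityFun_superDeriv, mem_evenAlg.1 hF]

theorem OddFun.superDeriv_mem {F : SmoothFun N} (hF : OddFun F) (c : ℂ) :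
    SuperSigma.superDeriv c F ∈ evenAlg N := by
  rw [mem_evenAlg, parityFun_superDeriv, hF, map_neg, neg_neg]

theorem OddFun.ddt {F : SmoothFun N} (hF : OddFun F) : OddFun (ddt F) := by
  rw [OddFun, parityFun_ddt, hF, map_neg]

theorem ddt_mem_evenAlg {F : SmoothFun N} (hF : F ∈ evenAlg N) : ddt F ∈ evenAlg N := by
  rw [mem_evenAlg, parityFun_ddt, mem_evenAlg.1 hF]

theorem OddFun.smul {G : SmoothFun N} (F : EvenFun N) (hG : OddFun G) : OddFun (F • G) := by
  rw [OddFun, even_smul_def, map_mul, hG, mem_evenAlg.1 F.prop, mul_neg]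

theorem OddFun.sum {ι : Type*} {s : Finset ι} {F : ι → SmoothFun N} (h : ∀ i ∈ s, OddFun (F i)) :
    OddFun (∑ i ∈ s, F i) := by
  rw [OddFun, map_sum, ← Finset.sum_neg_distrib]
  exact Finset.sum_congr rfl h

theorem superDeriv_smul (c : ℂ) (F : EvenFun N) (G : SmoothFun N) :
    superDeriv c (F • G) = superDeriv c F.val * G + F • superDeriv c G := by
  rw [even_smul_def, superDeriv_mul, mem_evenAlg.1 F.prop, even_smul_def]

theorem superDeriv_odd_mul (c : ℂ) {F : SmoothFun N} (hF : OddFun F) (G : SmoothFun N) :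
    superDeriv c (F * G) = superDeriv c F * G - F * superDeriv c G := by
  rw [superDeriv_mul, hF, neg_mul, sub_eq_add_neg]

/-! ### Integration over superspace -/

theorem intervalIntegrable_repr (F : SmoothFun N) (a b : ℝ) (s : Finset (Fin (N + 1))) :
    IntervalIntegrable (fun t => (grassBasis N).repr (F.val t) s) MeasureTheory.volume a b :=
  ((F.prop s).continuous).intervalIntegrable a b

theorem superIntegral_sub (a b : ℝ) (F G : SmoothFun N) :
    superIntegral a b (F - G).val = superIntegral a b F.val - superIntegral a b G.val := by
  simp only [superIntegral, timeIntegral, ← Finset.sum_sub_distrib, ← sub_smul]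
  refine Finset.sum_congr rfl fun s _ => ?_
  congr 1
  refine Eq.trans ?_ (intervalIntegral.integral_sub
    (intervalIntegrable_repr (mapValues dTheta F) a b s)
    (intervalIntegrable_repr (mapValues dTheta G) a b s))
  refine intervalIntegral.integral_congr fun t _ => ?_
  change (grassBasis N).repr (dTheta (F.val t - G.val t)) s = _
  rw [map_sub, map_sub]
  rfl

theorem timeIntegral_ddt (a b : ℝ) (F : SmoothFun N) :
    timeIntegral a b (ddt F).val = F.val b - F.val a := by
  apply (grassBasis N).repr.injective
  ext s
  rw [timeIntegral, Module.Basis.repr_sum_self, map_sub, Finsupp.coe_sub, Pi.sub_apply]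
  exact intervalIntegral.integral_eq_sub_of_hasDerivAt (fun t _ => F.prop.hasDerivAt t s)
    (intervalIntegrable_repr (ddt F) a b s)

/-- The Berezin integral kills `∂_θ F` because `∂_θ² = 0`, and from `c θ ∂_t F` it leaves `c` times
the time derivative of `∂_θ(θ F)`, the value at `θ = 0`. -/
theorem superIntegral_superDeriv (a b : ℝ) (c : ℂ) (F : SmoothFun N) :
    superIntegral a b (superDeriv c F).val =
      c • (atThetaZero (F.val b) - atThetaZero (F.val a)) := by
  have h : mapValues dTheta (superDeriv c F) =
      ddt (c • mapValues dTheta (constFun (theta N) * F)) := by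
    have h1 : mapValues dTheta (mapValues dTheta F) = 0 := by exact SmoothFun.ext fun t => dTheta_dTheta _
    rw [superDeriv_eq, map_add, h1, zero_add, map_smul, map_smul, ddt_mapValues, ddt_mul,
      ddt_constFun, zero_mul, zero_add]
  have h2 : superIntegral a b (superDeriv c F).val =
      timeIntegral a b (mapValues dTheta (superDeriv c F)).val := rfl
  rw [h2, h, timeIntegral_ddt, smul_sub]
  rfl

end SuperSigma

namespace SuperSigma

variable {N n : ℕ}

/-! ### Smooth functions on the target -/

theorem pd_contDiffOn {U : Set (Fin n → ℝ)} (hU : IsOpen U) {f : (Fin n → ℝ) → ℝ}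
    (hf : ContDiffOn ℝ (⊤ : ℕ∞) f U) (L : Fin n) : ContDiffOn ℝ (⊤ : ℕ∞) (pd L f) U :=
  (hf.fderiv_of_isOpen hU (by simp)).clm_apply contDiffOn_const

theorem differentiableAt_of_contDiffOn {U : Set (Fin n → ℝ)} (hU : IsOpen U)
    {f : (Fin n → ℝ) → ℝ} (hf : ContDiffOn ℝ (⊤ : ℕ∞) f U) {x : Fin n → ℝ} (hx : x ∈ U) :
    DifferentiableAt ℝ f x :=
  (hf.contDiffAt (hU.mem_nhds hx)).differentiableAt (by simp)

theorem pd_congr {U : Set (Fin n → ℝ)} (hU : IsOpen U) {f h : (Fin n → ℝ) → ℝ}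
    (hfh : Set.EqOn f h U) (L : Fin n) : Set.EqOn (pd L f) (pd L h) U := fun x hx => by
  rw [pd, pd, (hfh.eventuallyEq_of_mem (hU.mem_nhds hx)).fderiv_eq]

theorem pd_add {U : Set (Fin n → ℝ)} (hU : IsOpen U) {f h : (Fin n → ℝ) → ℝ}
    (hf : ContDiffOn ℝ (⊤ : ℕ∞) f U) (hh : ContDiffOn ℝ (⊤ : ℕ∞) h U) (L : Fin n) :
    Set.EqOn (pd L (f + h)) (pd L f + pd L h) U := fun x hx => by
  rw [pd, fderiv_add (differentiableAt_of_contDiffOn hU hf hx)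
    (differentiableAt_of_contDiffOn hU hh hx)]
  rfl

theorem pd_mul {U : Set (Fin n → ℝ)} (hU : IsOpen U) {f h : (Fin n → ℝ) → ℝ}
    (hf : ContDiffOn ℝ (⊤ : ℕ∞) f U) (hh : ContDiffOn ℝ (⊤ : ℕ∞) h U) (L : Fin n) :
    Set.EqOn (pd L (f * h)) (pd L f * h + f * pd L h) U := fun x hx => by
  rw [pd, fderiv_mul (differentiableAt_of_contDiffOn hU hf hx)
    (differentiableAt_of_contDiffOn hU hh hx)]
  simp [pd]
  ring

theorem pd_comm {U : Set (Fin n → ℝ)} (hU : IsOpen U) {f : (Fin n → ℝ) → ℝ}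
    (hf : ContDiffOn ℝ (⊤ : ℕ∞) f U) (L M : Fin n) :
    Set.EqOn (pd L (pd M f)) (pd M (pd L f)) U := fun x hx => by
  have h1 : ContDiffAt ℝ (⊤ : ℕ∞) f x := hf.contDiffAt (hU.mem_nhds hx)
  have h2 : IsSymmSndFDerivAt ℝ f x := h1.isSymmSndFDerivAt (by
    rw [minSmoothness_of_isRCLikeNormedField]; exact WithTop.coe_le_coe.2 le_top)
  have h3 : DifferentiableAt ℝ (fderiv ℝ f) x :=
    (h1.fderiv_right (m := 1) (by norm_cast)).differentiableAt (by simp)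
  have h4 (v w : Fin n → ℝ) : fderiv ℝ (fun y => fderiv ℝ f y v) x w =
      fderiv ℝ (fderiv ℝ f) x w v := by
    rw [fderiv_clm_apply h3 (differentiableAt_const v)]
    simp
  change fderiv ℝ (fun y => fderiv ℝ f y _) x _ = fderiv ℝ (fun y => fderiv ℝ f y _) x _
  rw [h4, h4]
  exact h2 _ _

/-! ### Taylor terms -/

/-- The term of order `k`, without the factor `1 / k!`, of the Taylor expansion of `f` around `b`
in the nilpotent increments `s`. -/
def taylorTerm (s : Fin n → Grass N) (b : Fin n → ℝ) : ℕ → ((Fin n → ℝ) → ℝ) → Grass N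
  | 0, f => algebraMap ℂ (Grass N) (f b : ℂ)
  | k + 1, f => ∑ L, s L * taylorTerm s b k (pd L f)

/-- The Taylor expansion of `f` around `b` in the nilpotent increments `s`. -/
def taylorSum (s : Fin n → Grass N) (b : Fin n → ℝ) (f : (Fin n → ℝ) → ℝ) : Grass N :=
  ∑ k ∈ Finset.range (N + 2), ((k.factorial : ℂ)⁻¹) • taylorTerm s b k f

section

variable {U : Set (Fin n → ℝ)} {b : Fin n → ℝ} {s : Fin n → Grass N}

theorem taylorTerm_congr (hU : IsOpen U) (hb : b ∈ U) (k : ℕ) {f h : (Fin n → ℝ) → ℝ}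
    (hfh : Set.EqOn f h U) : taylorTerm s b k f = taylorTerm s b k h := by
  induction k generalizing f h with
  | zero => rw [taylorTerm, taylorTerm, hfh hb]
  | succ k ih =>
    exact Finset.sum_congr rfl fun L _ => by rw [ih (pd_congr hU hfh L)]

theorem taylorTerm_add (hU : IsOpen U) (hb : b ∈ U) (k : ℕ) {f h : (Fin n → ℝ) → ℝ}
    (hf : ContDiffOn ℝ (⊤ : ℕ∞) f U) (hh : ContDiffOn ℝ (⊤ : ℕ∞) h U) :
    taylorTerm s b k (f + h) = taylorTerm s b k f + taylorTerm s b k h := by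
  induction k generalizing f h with
  | zero => simp only [taylorTerm, Pi.add_apply, Complex.ofReal_add, map_add]
  | succ k ih =>
    simp only [taylorTerm, ← Finset.sum_add_distrib, ← mul_add]
    refine Finset.sum_congr rfl fun L _ => ?_
    rw [taylorTerm_congr hU hb k (pd_add hU hf hh L),
      ih (pd_contDiffOn hU hf L) (pd_contDiffOn hU hh L)]

theorem parity_taylorTerm (hs : ∀ L, parity (s L) = s L) (k : ℕ) (f : (Fin n → ℝ) → ℝ) :
    parity (taylorTerm s b k f) = taylorTerm s b k f := by
  induction k generalizing f with
  | zero => exact parity_algebraMap _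
  | succ k ih => simp only [taylorTerm, map_sum, map_mul, hs, ih]

theorem taylorTerm_mem_degreeGE (hs : ∀ L, ExteriorAlgebra.algebraMapInv (s L) = 0) (k : ℕ)
    (f : (Fin n → ℝ) → ℝ) : taylorTerm s b k f ∈ degreeGE N k := by
  induction k generalizing f with
  | zero => rw [degreeGE_zero]; trivial
  | succ k ih =>
    have h : taylorTerm s b (k + 1) f ∈ degreeGE N (1 + k) :=
      Submodule.sum_mem _ fun L _ => mul_mem_degreeGE (mem_degreeGE_one (hs L)) (ih _)
    rwa [Nat.add_comm 1 k] at h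

theorem degreeGE_anti {j k : ℕ} (h : j ≤ k) : degreeGE N k ≤ degreeGE N j := by
  obtain ⟨m, rfl⟩ := Nat.exists_eq_add_of_le h
  unfold degreeGE
  rw [pow_add, mul_assoc]
  exact mul_le_mul' le_rfl le_top

theorem eq_zero_of_mem_degreeGE {k : ℕ} (h : N + 2 ≤ k) {z : Grass N} (hz : z ∈ degreeGE N k) :
    z = 0 := by
  have := degreeGE_anti h hz
  rwa [degreeGE_eq_bot, Submodule.mem_bot] at this

theorem taylorSum_eq (hs : ∀ L, ExteriorAlgebra.algebraMapInv (s L) = 0) {K : ℕ} (hK : N + 2 ≤ K)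
    (f : (Fin n → ℝ) → ℝ) :
    taylorSum s b f = ∑ k ∈ Finset.range K, ((k.factorial : ℂ)⁻¹) • taylorTerm s b k f := by
  refine Finset.sum_subset (Finset.range_mono hK) fun k _ hk => ?_
  rw [Finset.mem_range, not_lt] at hk
  rw [eq_zero_of_mem_degreeGE hk (taylorTerm_mem_degreeGE hs k f), smul_zero]

/-- The chain rule for the terms of a Taylor expansion. -/
theorem taylorTerm_chain (hU : IsOpen U) (hb : b ∈ U) (hs : ∀ L, parity (s L) = s L)
    (β σ : Fin n → Grass N) (u : ℕ → ((Fin n → ℝ) → ℝ) → Grass N)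
    (h0 : ∀ f, ContDiffOn ℝ (⊤ : ℕ∞) f U → u 0 f = ∑ L, β L * taylorTerm s b 0 (pd L f))
    (h1 : ∀ k f, ContDiffOn ℝ (⊤ : ℕ∞) f U →
      u (k + 1) f = ∑ L, (σ L * taylorTerm s b k (pd L f) + s L * u k (pd L f)))
    (k : ℕ) {f : (Fin n → ℝ) → ℝ} (hf : ContDiffOn ℝ (⊤ : ℕ∞) f U) :
    u (k + 1) f = ∑ L, β L * taylorTerm s b (k + 1) (pd L f) +
      ((k + 1 : ℕ) : ℂ) • ∑ L, σ L * taylorTerm s b k (pd L f) := by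
  -- Symmetry of second derivatives and centrality of the increments `s` allow the outer sum over
  -- `s` to be absorbed into the Taylor term, whose order rises by one.
  have comm (ρ : Fin n → Grass N) (k : ℕ) {f : (Fin n → ℝ) → ℝ}
      (hf : ContDiffOn ℝ (⊤ : ℕ∞) f U) :
      ∑ L, s L * ∑ M, ρ M * taylorTerm s b k (pd M (pd L f)) =
        ∑ M, ρ M * taylorTerm s b (k + 1) (pd M f) := by
    simp only [taylorTerm, Finset.mul_sum]
    rw [Finset.sum_comm]
    refine Finset.sum_congr rfl fun M _ => Finset.sum_congr rfl fun L _ => ?_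
    rw [← mul_assoc, ← mul_assoc, mul_comm_of_parity_eq (hs L),
      taylorTerm_congr hU hb k (pd_comm hU hf M L)]
  induction k generalizing f with
  | zero =>
    rw [h1 0 f hf, Finset.sum_add_distrib, add_comm]
    congr 1
    · rw [← comm β 0 hf]
      exact Finset.sum_congr rfl fun L _ => by rw [h0 _ (pd_contDiffOn hU hf L)]
    · simp
  | succ k ih =>
    rw [h1 (k + 1) f hf, Finset.sum_add_distrib]
    have h2 : ∑ L, s L * u (k + 1) (pd L f) = ∑ L, β L * taylorTerm s b (k + 2) (pd L f) +
        ((k + 1 : ℕ) : ℂ) • ∑ L, σ L * taylorTerm s b (k + 1) (pd L f) := by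
      rw [← comm β (k + 1) hf, ← comm σ k hf, Finset.smul_sum, ← Finset.sum_add_distrib]
      refine Finset.sum_congr rfl fun L _ => ?_
      rw [ih (pd_contDiffOn hU hf L), mul_add, mul_smul_comm]
    rw [h2]
    push_cast
    module

/-- Here `u` is the effect of a derivation or of an increment on the Taylor terms, `β` its effect on
the base point and `σ` its effect on `s`. The `σ` part of order `k + 1` carries the factor `k + 1`,
which turns `1/(k+1)!` into `1/k!`; so `N + 3` terms of `u` match exactly `N + 2` terms in `σ`,
while the surplus term in `β` vanishes by nilpotency. The uses are `∂_θ`, `∂_t` and a shift of the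
nilpotent part. -/
theorem taylorSum_chain (hU : IsOpen U) (hb : b ∈ U) (hs : ∀ L, parity (s L) = s L)
    (hs' : ∀ L, ExteriorAlgebra.algebraMapInv (s L) = 0)
    (β σ : Fin n → Grass N) (u : ℕ → ((Fin n → ℝ) → ℝ) → Grass N)
    (h0 : ∀ f, ContDiffOn ℝ (⊤ : ℕ∞) f U → u 0 f = ∑ L, β L * taylorTerm s b 0 (pd L f))
    (h1 : ∀ k f, ContDiffOn ℝ (⊤ : ℕ∞) f U →
      u (k + 1) f = ∑ L, (σ L * taylorTerm s b k (pd L f) + s L * u k (pd L f)))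
    {f : (Fin n → ℝ) → ℝ} (hf : ContDiffOn ℝ (⊤ : ℕ∞) f U) :
    ∑ k ∈ Finset.range (N + 3), ((k.factorial : ℂ)⁻¹) • u k f =
      ∑ L, (β L + σ L) * taylorSum s b (pd L f) := by
  have h2 : ∑ L, (β L + σ L) * taylorSum s b (pd L f) =
      ∑ L, β L * taylorSum s b (pd L f) + ∑ L, σ L * taylorSum s b (pd L f) := by
    simp only [add_mul, Finset.sum_add_distrib]
  have h3 : ∑ L, β L * taylorSum s b (pd L f) = ∑ k ∈ Finset.range (N + 3),
      ((k.factorial : ℂ)⁻¹) • ∑ L, β L * taylorTerm s b k (pd L f) := by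
    simp only [taylorSum_eq hs' (Nat.le_succ (N + 2)), Finset.mul_sum, Finset.smul_sum,
      mul_smul_comm]
    exact Finset.sum_comm
  have h4 : ∑ L, σ L * taylorSum s b (pd L f) = ∑ k ∈ Finset.range (N + 2),
      ((k.factorial : ℂ)⁻¹) • ∑ L, σ L * taylorTerm s b k (pd L f) := by
    simp only [taylorSum, Finset.mul_sum, Finset.smul_sum, mul_smul_comm]
    exact Finset.sum_comm
  rw [h2, h3, h4, Finset.sum_range_succ', Finset.sum_range_succ' _ (N + 2), h0 f hf,
    add_right_comm, ← Finset.sum_add_distrib]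
  congr 1
  refine Finset.sum_congr rfl fun k _ => ?_
  rw [taylorTerm_chain hU hb hs β σ u h0 h1 k hf, smul_add, smul_smul]
  congr 2
  rw [Nat.factorial_succ, Nat.cast_mul, mul_inv_rev, mul_assoc, inv_mul_cancel₀, mul_one]
  exact_mod_cast Nat.succ_ne_zero k

theorem dTheta_taylorSum (hU : IsOpen U) (hb : b ∈ U) (hs : ∀ L, parity (s L) = s L)
    (hs' : ∀ L, ExteriorAlgebra.algebraMapInv (s L) = 0)
    {f : (Fin n → ℝ) → ℝ} (hf : ContDiffOn ℝ (⊤ : ℕ∞) f U) :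
    dTheta (taylorSum s b f) = ∑ L, dTheta (s L) * taylorSum s b (pd L f) := by
  have h := taylorSum_chain hU hb hs hs' 0 (fun L => dTheta (s L))
    (fun k f => dTheta (taylorTerm s b k f))
    (fun f _ => by simp [taylorTerm, dTheta_algebraMap])
    (fun k f _ => by simp only [taylorTerm, map_sum, dTheta_mul, hs]) hf
  rw [taylorSum_eq hs' (Nat.le_succ (N + 2)), map_sum]
  simpa only [map_smul, Pi.zero_apply, zero_add] using h

/-- Products of two increments vanish, so `η` annihilates the difference of the two expansions. That
difference then obeys the recursion of `taylorSum_chain` with `β = 0` and `σ = η`, and no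
second-order term survives. -/
theorem taylorSum_add_increment (hU : IsOpen U) (hb : b ∈ U) (hs : ∀ L, parity (s L) = s L)
    (hs' : ∀ L, ExteriorAlgebra.algebraMapInv (s L) = 0) (η : Fin n → Grass N)
    (hη : ∀ L M w, η L * (η M * w) = 0) (hη' : ∀ L, ExteriorAlgebra.algebraMapInv (η L) = 0)
    {f : (Fin n → ℝ) → ℝ} (hf : ContDiffOn ℝ (⊤ : ℕ∞) f U) :
    taylorSum (s + η) b f = taylorSum s b f + ∑ L, η L * taylorSum s b (pd L f) := by
  have h1 (M : Fin n) (k : ℕ) (f : (Fin n → ℝ) → ℝ) :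
      η M * (taylorTerm (s + η) b k f - taylorTerm s b k f) = 0 := by
    induction k generalizing f with
    | zero => simp [taylorTerm]
    | succ k ih =>
      simp only [taylorTerm, ← Finset.sum_sub_distrib, Finset.mul_sum]
      refine Finset.sum_eq_zero fun L _ => ?_
      have h2 : (s + η) L * taylorTerm (s + η) b k (pd L f) - s L * taylorTerm s b k (pd L f) =
          s L * (taylorTerm (s + η) b k (pd L f) - taylorTerm s b k (pd L f)) +
            η L * taylorTerm (s + η) b k (pd L f) := by
        rw [Pi.add_apply]; noncomm_ring
      rw [h2, mul_add, hη, add_zero, ← mul_assoc, mul_comm_of_parity_eq (hs L), mul_assoc, ih,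
        mul_zero]
  have h := taylorSum_chain hU hb hs hs' 0 η
    (fun k f => taylorTerm (s + η) b k f - taylorTerm s b k f)
    (fun f _ => by simp [taylorTerm])
    (fun k f _ => by
      simp only [taylorTerm, ← Finset.sum_sub_distrib]
      refine Finset.sum_congr rfl fun L _ => ?_
      have h2 := h1 L k (pd L f)
      rw [mul_sub, sub_eq_zero] at h2
      rw [← h2, Pi.add_apply]; noncomm_ring) hf
  have hsum (L) : ExteriorAlgebra.algebraMapInv ((s + η) L) = 0 := by
    rw [Pi.add_apply, map_add, hs', hη', add_zero]
  rw [← sub_eq_iff_eq_add', taylorSum_eq hs' (Nat.le_succ (N + 2)),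
    taylorSum_eq hsum (Nat.le_succ (N + 2)), ← Finset.sum_sub_distrib]
  simpa only [smul_sub, Pi.zero_apply, zero_add] using h

theorem taylorTerm_mul (hU : IsOpen U) (hb : b ∈ U) (hs : ∀ L, parity (s L) = s L) (k : ℕ)
    {f h : (Fin n → ℝ) → ℝ} (hf : ContDiffOn ℝ (⊤ : ℕ∞) f U) (hh : ContDiffOn ℝ (⊤ : ℕ∞) h U) :
    taylorTerm s b k (f * h) = ∑ ij ∈ Finset.HasAntidiagonal.antidiagonal k,
      (k.choose ij.1 : Grass N) * (taylorTerm s b ij.1 f * taylorTerm s b ij.2 h) := by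
  induction k generalizing f h with
  | zero => simp [taylorTerm]
  | succ k ih =>
    rw [Finset.sum_antidiagonal_choose_succ_mul
      (fun i j => taylorTerm s b i f * taylorTerm s b j h)]
    simp only [taylorTerm]
    have h1 (L) : taylorTerm s b k (pd L (f * h)) =
        taylorTerm s b k (f * pd L h) + taylorTerm s b k (pd L f * h) := by
      have hf' := pd_contDiffOn hU hf L
      have hh' := pd_contDiffOn hU hh L
      rw [taylorTerm_congr hU hb k (pd_mul hU hf hh L),
        taylorTerm_add (f := pd L f * h) (h := f * pd L h) hU hb k (hf'.mul hh) (hf.mul hh'),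
        add_comm]
    simp only [h1, mul_add, Finset.sum_add_distrib]
    congr 1
    · simp only [fun L => ih hf (pd_contDiffOn hU hh L), Finset.mul_sum]
      rw [Finset.sum_comm]
      refine Finset.sum_congr rfl fun ij _ => Finset.sum_congr rfl fun L _ => ?_
      rw [← mul_assoc, ← mul_assoc, ← mul_assoc, ← mul_assoc, ← mul_comm_of_parity_eq (hs L),
        mul_assoc, mul_assoc, mul_assoc, mul_assoc, ← mul_assoc (s L) (taylorTerm s b ij.1 f),
        ← mul_comm_of_parity_eq (hs L), mul_assoc]
    · simp only [fun L => ih (pd_contDiffOn hU hf L) hh, Finset.mul_sum, Finset.sum_mul]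
      rw [Finset.sum_comm]
      refine Finset.sum_congr rfl fun ij hij => Finset.sum_congr rfl fun L _ => ?_
      rw [Nat.choose_symm_of_eq_add (Finset.HasAntidiagonal.mem_antidiagonal.1 hij).symm, ← mul_assoc,
        ← mul_comm_of_parity_eq (hs L), mul_assoc, mul_assoc]

/-- The binomial Leibniz rule for the terms, divided by factorials, is the Cauchy product of the two
series. -/
theorem taylorSum_mul (hU : IsOpen U) (hb : b ∈ U) (hs : ∀ L, parity (s L) = s L)
    (hs' : ∀ L, ExteriorAlgebra.algebraMapInv (s L) = 0)
    {f h : (Fin n → ℝ) → ℝ} (hf : ContDiffOn ℝ (⊤ : ℕ∞) f U) (hh : ContDiffOn ℝ (⊤ : ℕ∞) h U) :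
    taylorSum s b (f * h) = taylorSum s b f * taylorSum s b h := by
  have h1 (k : ℕ) : ((k.factorial : ℂ)⁻¹) • taylorTerm s b k (f * h) =
      ∑ ij ∈ Finset.HasAntidiagonal.antidiagonal k, (((ij.1.factorial : ℂ)⁻¹) • taylorTerm s b ij.1 f) *
        (((ij.2.factorial : ℂ)⁻¹) • taylorTerm s b ij.2 h) := by
    rw [taylorTerm_mul hU hb hs k hf hh, Finset.smul_sum]
    refine Finset.sum_congr rfl fun ij hij => ?_
    have h2 : (k.choose ij.1 : Grass N) = algebraMap ℂ (Grass N) (k.choose ij.1 : ℂ) :=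
      (map_natCast _ _).symm
    rw [h2, ← Algebra.smul_def, smul_mul_smul_comm, smul_smul]
    congr 1
    obtain rfl := Finset.HasAntidiagonal.mem_antidiagonal.1 hij
    have h3 := Nat.add_choose_mul_factorial_mul_factorial ij.1 ij.2
    rw [← Nat.choose_symm_add] at h3
    have h4 : (((ij.1 + ij.2).choose ij.1 : ℕ) : ℂ) * (ij.1.factorial : ℂ) * (ij.2.factorial : ℂ) =
        ((ij.1 + ij.2).factorial : ℂ) := by exact_mod_cast h3
    have h5 : (ij.1.factorial : ℂ) ≠ 0 := by exact_mod_cast Nat.factorial_ne_zero _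
    have h6 : (ij.2.factorial : ℂ) ≠ 0 := by exact_mod_cast Nat.factorial_ne_zero _
    have h7 : ((ij.1 + ij.2).factorial : ℂ) ≠ 0 := by exact_mod_cast Nat.factorial_ne_zero _
    field_simp
    linear_combination h4
  have h0 (k : ℕ) (hk : N + 2 ≤ k) (f) : ((k.factorial : ℂ)⁻¹) • taylorTerm s b k f = 0 := by
    rw [eq_zero_of_mem_degreeGE hk (taylorTerm_mem_degreeGE hs' k f), smul_zero]
  -- The cutoff `2(N + 2)` is large enough for the sum of any two indices below `N + 2`.
  -- Antidiagonal pairs outside this square contribute nothing, since one of their factors has order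
  -- at least `N + 2`.
  rw [taylorSum_eq hs' (show N + 2 ≤ (N + 2) + (N + 2) by omega), taylorSum, taylorSum,
    Finset.sum_mul_sum, ← Finset.sum_product']
  simp only [h1]
  rw [← Finset.sum_fiberwise_of_maps_to (s := Finset.range (N + 2) ×ˢ Finset.range (N + 2))
    (t := Finset.range ((N + 2) + (N + 2))) (g := fun ij => ij.1 + ij.2)
    (fun ij hij => by
      rw [Finset.mem_product, Finset.mem_range, Finset.mem_range] at hij
      rw [Finset.mem_range]
      omega)]
  refine Finset.sum_congr rfl fun k _ => ?_
  symm
  refine Finset.sum_subset (fun ij hij => ?_) fun ij hij hij' => ?_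
  · exact Finset.HasAntidiagonal.mem_antidiagonal.2 (Finset.mem_filter.1 hij).2
  · rw [Finset.mem_filter, Finset.mem_product, Finset.mem_range, Finset.mem_range] at hij'
    have := Finset.HasAntidiagonal.mem_antidiagonal.1 hij
    by_cases h2 : ij.1 < N + 2
    · rw [h0 ij.2 (by by_contra h3; exact hij' ⟨⟨h2, not_le.1 h3⟩, this⟩), mul_zero]
    · rw [h0 ij.1 (not_lt.1 h2), zero_mul]

/-- This links the definition of `superEval` to the recursion. Splitting off the last index turns
the last argument of the iterated derivative into a partial derivative of `f`; the matching even
factor at the end of the product is then moved to the front. -/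
theorem sum_iteratedFDeriv_eq_taylorTerm (hU : IsOpen U) (hb : b ∈ U)
    (hs : ∀ L, parity (s L) = s L) (k : ℕ) {f : (Fin n → ℝ) → ℝ}
    (hf : ContDiffOn ℝ (⊤ : ℕ∞) f U) :
    ∑ i : Fin k → Fin n,
      ((iteratedFDeriv ℝ k f b (fun j => Pi.single (i j) 1) : ℝ) : ℂ) •
        (List.ofFn (fun j => s (i j))).prod = taylorTerm s b k f := by
  induction k generalizing f with
  | zero =>
    rw [taylorTerm, Fintype.sum_unique]
    simp [Algebra.algebraMap_eq_smul_one]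
  | succ k ih =>
    have h1 (L : Fin n) (m : Fin k → (Fin n → ℝ)) :
        iteratedFDeriv ℝ k (pd L f) b m =
          iteratedFDeriv ℝ k (fun y => fderiv ℝ f y) b m (Pi.single L 1) := by
      -- Smoothness is known only on `U`, so evaluation in a fixed direction is commuted with
      -- derivatives within `U`, which on an open set are the ordinary ones.
      have h2 := iteratedFDerivWithin_clm_apply_const_apply (𝕜 := ℝ) (n := (⊤ : ℕ∞))
        hU.uniqueDiffOn (hf.fderiv_of_isOpen hU (m := (⊤ : ℕ∞)) (by simp)) (i := k)
        (by exact_mod_cast le_top) hb (u := Pi.single L 1) (m := m)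
      rwa [iteratedFDerivWithin_of_isOpen k hU hb, iteratedFDerivWithin_of_isOpen k hU hb] at h2
    rw [taylorTerm, ← (Fin.snocEquiv (fun _ => Fin n)).sum_comp, Fintype.sum_prod_type]
    refine Finset.sum_congr rfl fun L _ => ?_
    rw [← ih (pd_contDiffOn hU hf L), Finset.mul_sum]
    refine Finset.sum_congr rfl fun i _ => ?_
    rw [iteratedFDeriv_succ_apply_right, h1, mul_smul_comm, List.ofFn_succ', List.concat_eq_append,
      List.prod_append, List.prod_singleton, mul_comm_of_parity_eq (hs _)]
    have h3 : (Fin.init fun j => Pi.single (M := fun _ => ℝ)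
        ((Fin.snocEquiv fun _ => Fin n) (L, i) j) (1 : ℝ)) = fun j => Pi.single (i j) 1 := by
      funext j
      simp [Fin.init, Fin.snocEquiv]
    rw [h3]
    simp [Fin.snocEquiv]

end

end SuperSigma

namespace SuperSigma

variable {N n : ℕ}

/-! ### Evaluation of target functions on superfields -/

section

variable {U : Set (Fin n → ℝ)} {X : Fin n → SFun N}

theorem IsSuperfield.algebraMapInv_soul (hX : IsSuperfield U X) (L : Fin n) (t : ℝ) :
    ExteriorAlgebra.algebraMapInv (soul X L t) = 0 := by
  rw [soul, map_sub, AlgHom.commutes, Algebra.algebraMap_self, RingHom.id_apply, sub_eq_zero]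
  exact Complex.ext rfl (by rw [hX.body_real, Complex.ofReal_im])

theorem IsSuperfield.parity_soul (hX : IsSuperfield U X) (L : Fin n) (t : ℝ) :
    parity (soul X L t) = soul X L t := by
  rw [soul, map_sub, (hX.even L t).parity_eq, parity_algebraMap]

theorem IsSuperfield.superEval_eq (hU : IsOpen U) (hX : IsSuperfield U X) {f : (Fin n → ℝ) → ℝ}
    (hf : ContDiffOn ℝ (⊤ : ℕ∞) f U) (t : ℝ) :
    superEval f X t = taylorSum (fun L => soul X L t) (body X t) f := by
  rw [superEval, taylorSum]
  refine Finset.sum_congr rfl fun k _ => ?_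
  rw [← sum_iteratedFDeriv_eq_taylorTerm hU (hX.body_mem t) (fun L => hX.parity_soul L t) k hf]

theorem smooth_algebraMapInv {F : SFun N} (hF : SmoothInTime F) :
    ContDiff ℝ (⊤ : ℕ∞) fun t => ExteriorAlgebra.algebraMapInv (F t) := by
  have h : (fun t => ExteriorAlgebra.algebraMapInv (F t)) = fun t => ∑ s,
      (grassBasis N).repr (F t) s * ExteriorAlgebra.algebraMapInv (grassBasis N s) := by
    funext t
    conv_lhs => rw [← (grassBasis N).sum_repr (F t)]
    simp only [map_sum, map_smul, smul_eq_mul]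
  rw [h]
  exact ContDiff.sum fun s _ => (hF s).mul contDiff_const

theorem IsSuperfield.contDiff_body (hX : IsSuperfield U X) :
    ContDiff ℝ (⊤ : ℕ∞) (body X) :=
  contDiff_pi.2 fun M => Complex.reCLM.contDiff.comp (smooth_algebraMapInv (hX.smooth M))

theorem repr_algebraMap (c : ℂ) (s : Finset (Fin (N + 1))) :
    (grassBasis N).repr (algebraMap ℂ (Grass N) c) s = c * (grassBasis N).repr 1 s := by
  rw [Algebra.algebraMap_eq_smul_one, map_smul]
  rfl

theorem smoothInTime_algebraMap {f : ℝ → ℝ} (hf : ContDiff ℝ (⊤ : ℕ∞) f) :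
    SmoothInTime (fun t => algebraMap ℂ (Grass N) (f t)) := fun s => by
  simp only [repr_algebraMap]
  exact (Complex.ofRealCLM.contDiff.comp hf).mul contDiff_const

theorem timeDeriv_algebraMap {f : ℝ → ℝ} {f' t : ℝ} (hf : HasDerivAt f f' t) :
    timeDeriv (fun t => algebraMap ℂ (Grass N) (f t)) t = algebraMap ℂ (Grass N) f' :=
  timeDeriv_eq_of_hasDerivAt fun s => by
    simp only [repr_algebraMap]
    exact hf.ofReal_comp.mul_const _

theorem IsSuperfield.smooth_comp_body (hU : IsOpen U) (hX : IsSuperfield U X)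
    {f : (Fin n → ℝ) → ℝ} (hf : ContDiffOn ℝ (⊤ : ℕ∞) f U) :
    ContDiff ℝ (⊤ : ℕ∞) fun t => f (body X t) :=
  contDiff_iff_contDiffAt.2 fun t => ContDiffAt.comp t
    (hf.contDiffAt (hU.mem_nhds (hX.body_mem t))) hX.contDiff_body.contDiffAt

/-- The numerical part as a smooth function. -/
def IsSuperfield.bodyFun (hX : IsSuperfield U X) (L : Fin n) : SmoothFun N :=
  .mk (fun t => algebraMap ℂ (Grass N) (body X t L))
    (smoothInTime_algebraMap (contDiff_pi.1 hX.contDiff_body L))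

/-- The components of a superfield as smooth functions. -/
def IsSuperfield.fieldFun (hX : IsSuperfield U X) (L : Fin n) : SmoothFun N := .mk (X L) (hX.smooth L)

/-- The nilpotent part as a smooth function. -/
def IsSuperfield.soulFun (hX : IsSuperfield U X) (L : Fin n) : SmoothFun N :=
  hX.fieldFun L - hX.bodyFun L

theorem SmoothFun.sum_apply {ι : Type*} (s : Finset ι) (F : ι → SmoothFun N) (t : ℝ) :
    (∑ i ∈ s, F i).val t = ∑ i ∈ s, (F i).val t := by
  classical
  induction s using Finset.induction_on with
  | empty => rfl
  | insert a s ha ih => rw [Finset.sum_insert ha, Finset.sum_insert ha, ← ih]; rfl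

theorem IsSuperfield.smooth_taylorTerm (hU : IsOpen U) (hX : IsSuperfield U X) (k : ℕ)
    {f : (Fin n → ℝ) → ℝ} (hf : ContDiffOn ℝ (⊤ : ℕ∞) f U) :
    SmoothInTime fun t => taylorTerm (fun L => soul X L t) (body X t) k f := by
  induction k generalizing f with
  | zero => exact smoothInTime_algebraMap (hX.smooth_comp_body hU hf)
  | succ k ih =>
    have h := (∑ L, hX.soulFun L * SmoothFun.mk _ (ih (pd_contDiffOn hU hf L))).prop
    convert h using 1
    funext t
    rw [SmoothFun.sum_apply]
    rfl

/-- The Taylor terms of a target function as smooth functions. -/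
def IsSuperfield.termFun (hU : IsOpen U) (hX : IsSuperfield U X) (k : ℕ) {f : (Fin n → ℝ) → ℝ}
    (hf : ContDiffOn ℝ (⊤ : ℕ∞) f U) : SmoothFun N := .mk _ (hX.smooth_taylorTerm hU k hf)

theorem IsSuperfield.termFun_succ (hU : IsOpen U) (hX : IsSuperfield U X) (k : ℕ)
    {f : (Fin n → ℝ) → ℝ} (hf : ContDiffOn ℝ (⊤ : ℕ∞) f U) :
    hX.termFun hU (k + 1) hf =
      ∑ L, hX.soulFun L * hX.termFun hU k (pd_contDiffOn hU hf L) :=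
  SmoothFun.ext fun t => by rw [SmoothFun.sum_apply]; rfl

/-- The value of a target function on a superfield, as a smooth function. -/
def IsSuperfield.evalFun (hU : IsOpen U) (hX : IsSuperfield U X) {f : (Fin n → ℝ) → ℝ}
    (hf : ContDiffOn ℝ (⊤ : ℕ∞) f U) : SmoothFun N :=
  -- One term more than in `superEval`: it vanishes by nilpotency, and this length is the one for
  -- which `taylorSum_chain` is stated.
  ∑ k ∈ Finset.range (N + 3), ((k.factorial : ℂ)⁻¹) • hX.termFun hU k hf

theorem IsSuperfield.evalFun_apply (hU : IsOpen U) (hX : IsSuperfield U X) {f : (Fin n → ℝ) → ℝ}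
    (hf : ContDiffOn ℝ (⊤ : ℕ∞) f U) (t : ℝ) : (hX.evalFun hU hf).val t =
      taylorSum (fun L => soul X L t) (body X t) f := by
  rw [taylorSum_eq (fun L => hX.algebraMapInv_soul L t) (Nat.le_succ (N + 2))]
  exact SmoothFun.sum_apply _ _ t

theorem IsSuperfield.coe_evalFun (hU : IsOpen U) (hX : IsSuperfield U X) {f : (Fin n → ℝ) → ℝ}
    (hf : ContDiffOn ℝ (⊤ : ℕ∞) f U) : (hX.evalFun hU hf).val = superEval f X :=
  funext fun t => by rw [hX.evalFun_apply, hX.superEval_eq hU hf]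

/-- The motion of the numerical part shifts the base point and that of the nilpotent part shifts the
increments; `taylorSum_chain` combines them, and only their sum `Ẋ` remains. -/
theorem IsSuperfield.ddt_evalFun (hU : IsOpen U) (hX : IsSuperfield U X) {f : (Fin n → ℝ) → ℝ}
    (hf : ContDiffOn ℝ (⊤ : ℕ∞) f U) : ddt (hX.evalFun hU hf) =
      ∑ L, hX.evalFun hU (pd_contDiffOn hU hf L) * ddt (hX.fieldFun L) := by
  refine SmoothFun.ext fun t => ?_
  have hpar (L) := hX.parity_soul L t
  have h := taylorSum_chain hU (hX.body_mem t) hpar (fun L => hX.algebraMapInv_soul L t)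
    (fun L => (ddt (hX.bodyFun L)).val t) (fun L => (ddt (hX.soulFun L)).val t)
    (fun k f => timeDeriv (fun t => taylorTerm (fun L => soul X L t) (body X t) k f) t)
    (fun f hf => by
      have h1 : HasDerivAt (body X) (fun L => deriv (fun t => body X t L) t) t :=
        hasDerivAt_pi.2 fun L =>
          (((contDiff_pi.1 hX.contDiff_body L).differentiable (by simp)) t).hasDerivAt
      have h2 := ((differentiableAt_of_contDiffOn hU hf (hX.body_mem t)).hasFDerivAt).comp_hasDerivAt
        t h1
      refine (timeDeriv_algebraMap h2).trans ?_
      have h3 : (fun L => deriv (fun t => body X t L) t) =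
          ∑ L, deriv (fun t => body X t L) t • (Pi.single L 1 : Fin n → ℝ) := by
        ext M
        simp [Finset.sum_apply, Pi.single_apply]
      rw [h3, map_sum, Complex.ofReal_sum, map_sum]
      refine Finset.sum_congr rfl fun L _ => ?_
      have h4 : (ddt (hX.bodyFun L)).val t =
          algebraMap ℂ (Grass N) ((deriv (fun t => body X t L) t : ℝ) : ℂ) :=
        timeDeriv_algebraMap (N := N) (f := fun t => body X t L)
          (((contDiff_pi.1 hX.contDiff_body L).differentiable (by simp)) t).hasDerivAt
      rw [h4, taylorTerm, ← map_mul, map_smul, smul_eq_mul, Complex.ofReal_mul]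
      rfl)
    (fun k f hf => by
      have h1 : timeDeriv (fun t => taylorTerm (fun L => soul X L t) (body X t) (k + 1) f) t =
          (ddt (hX.termFun hU (k + 1) hf)).val t := rfl
      rw [h1, hX.termFun_succ, map_sum, SmoothFun.sum_apply]
      refine Finset.sum_congr rfl fun L _ => ?_
      rw [ddt_mul]
      rfl) hf
  rw [SmoothFun.sum_apply, IsSuperfield.evalFun, map_sum, SmoothFun.sum_apply]
  simp only [map_smul]
  refine h.trans (Finset.sum_congr rfl fun L _ => ?_)
  rw [IsSuperfield.soulFun, map_sub]
  change ((ddt (hX.bodyFun L)).val t + ((ddt (hX.fieldFun L)).val t - (ddt (hX.bodyFun L)).val t)) * _ =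
    (hX.evalFun hU _).val t * (ddt (hX.fieldFun L)).val t
  rw [add_sub_cancel, hX.evalFun_apply]
  refine mul_comm_of_parity_eq ?_ _
  rw [taylorSum, map_sum]
  simp only [map_smul, parity_taylorTerm hpar]

theorem IsSuperfield.evalFun_mem (hU : IsOpen U) (hX : IsSuperfield U X) {f : (Fin n → ℝ) → ℝ}
    (hf : ContDiffOn ℝ (⊤ : ℕ∞) f U) : hX.evalFun hU hf ∈ evenAlg N := by
  refine mem_evenAlg.2 (SmoothFun.ext fun t => ?_)
  change parity ((hX.evalFun hU hf).val t) = _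
  rw [hX.evalFun_apply, taylorSum, map_sum]
  simp only [map_smul, parity_taylorTerm (fun L => hX.parity_soul L t)]

/-- The numerical part is free of `θ`, so `∂_θ` acts through the nilpotent part alone; the other
half of the operator is the chain rule in time, with `θ` moved past central coefficients. -/
theorem IsSuperfield.superDeriv_evalFun (hU : IsOpen U) (hX : IsSuperfield U X) (c : ℂ)
    {f : (Fin n → ℝ) → ℝ} (hf : ContDiffOn ℝ (⊤ : ℕ∞) f U) : superDeriv c (hX.evalFun hU hf) =
      ∑ L, hX.evalFun hU (pd_contDiffOn hU hf L) * superDeriv c (hX.fieldFun L) := by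
  have h1 : mapValues dTheta (hX.evalFun hU hf) =
      ∑ L, hX.evalFun hU (pd_contDiffOn hU hf L) * mapValues dTheta (hX.fieldFun L) := by
    refine SmoothFun.ext fun t => ?_
    rw [SmoothFun.sum_apply]
    refine (congrArg dTheta (hX.evalFun_apply hU hf t)).trans ?_
    rw [dTheta_taylorSum hU (hX.body_mem t) (fun L => hX.parity_soul L t)
      (fun L => hX.algebraMapInv_soul L t) hf]
    refine Finset.sum_congr rfl fun L _ => ?_
    change _ = (hX.evalFun hU _).val t * dTheta (X L t)
    rw [hX.evalFun_apply, soul, map_sub, dTheta_algebraMap, sub_zero]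
    refine mul_comm_of_parity_eq ?_ _
    rw [taylorSum, map_sum]
    simp only [map_smul, parity_taylorTerm (fun L => hX.parity_soul L t)]
  rw [superDeriv_eq, h1, hX.ddt_evalFun, Finset.mul_sum, Finset.smul_sum,
    ← Finset.sum_add_distrib]
  refine Finset.sum_congr rfl fun L _ => ?_
  rw [← mul_assoc, ← commute_of_mem_evenAlg (hX.evalFun_mem hU _), mul_assoc, ← mul_smul_comm,
    ← mul_add, superDeriv_eq]

theorem IsSuperfield.evalFun_congr (hU : IsOpen U) (hX : IsSuperfield U X)
    {f h : (Fin n → ℝ) → ℝ} (hf : ContDiffOn ℝ (⊤ : ℕ∞) f U) (hh : ContDiffOn ℝ (⊤ : ℕ∞) h U)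
    (hfh : Set.EqOn f h U) : hX.evalFun hU hf = hX.evalFun hU hh :=
  SmoothFun.ext fun t => by
    rw [hX.evalFun_apply, hX.evalFun_apply, taylorSum, taylorSum]
    exact Finset.sum_congr rfl fun k _ => by rw [taylorTerm_congr hU (hX.body_mem t) k hfh]

/-! ### Evaluation on a superfield as a ring homomorphism -/

/-- Smooth functions on a domain of the target. -/
def targetAlg (U : Set (Fin n → ℝ)) : Subalgebra ℝ ((Fin n → ℝ) → ℝ) where
  carrier := {f | ContDiffOn ℝ (⊤ : ℕ∞) f U}
  mul_mem' := ContDiffOn.mul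
  add_mem' := ContDiffOn.add
  algebraMap_mem' _ := contDiffOn_const

/-- Smooth functions on a domain of the target. -/
def TargetFun (U : Set (Fin n → ℝ)) : Type := targetAlg U

instance : CommRing (TargetFun U) := inferInstanceAs (CommRing (targetAlg U))

/-- The underlying function. -/
def TargetFun.val (f : TargetFun U) : (Fin n → ℝ) → ℝ := Subtype.val f

theorem TargetFun.prop (f : TargetFun U) : ContDiffOn ℝ (⊤ : ℕ∞) f.val U := Subtype.property f

/-- A smooth function as an element of the algebra of smooth functions. -/
def TargetFun.mk (f : (Fin n → ℝ) → ℝ) (hf : ContDiffOn ℝ (⊤ : ℕ∞) f U) : TargetFun U := ⟨f, hf⟩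

theorem taylorTerm_zero_fun (hU : IsOpen U) {b : Fin n → ℝ} (hb : b ∈ U) (s : Fin n → Grass N)
    (k : ℕ) : taylorTerm s b k 0 = 0 := by
  have := taylorTerm_add (s := s) hU hb k (f := 0) (h := 0) contDiffOn_const contDiffOn_const
  rwa [add_zero, left_eq_add] at this

theorem taylorTerm_succ_one (hU : IsOpen U) {b : Fin n → ℝ} (hb : b ∈ U) (s : Fin n → Grass N)
    (k : ℕ) : taylorTerm s b (k + 1) 1 = 0 :=
  Finset.sum_eq_zero fun L _ => by
    have h2 : pd L (1 : (Fin n → ℝ) → ℝ) = 0 := by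
      funext x
      simp [pd, fderiv_one]
    rw [h2, taylorTerm_zero_fun hU hb, mul_zero]

theorem taylorSum_zero_fun (hU : IsOpen U) {b : Fin n → ℝ} (hb : b ∈ U) (s : Fin n → Grass N) :
    taylorSum s b 0 = 0 :=
  Finset.sum_eq_zero fun k _ => by rw [taylorTerm_zero_fun hU hb, smul_zero]

theorem taylorSum_one (hU : IsOpen U) {b : Fin n → ℝ} (hb : b ∈ U) (s : Fin n → Grass N) :
    taylorSum s b 1 = 1 := by
  rw [taylorSum, Finset.sum_range_succ', Finset.sum_eq_zero, zero_add]
  · simp [taylorTerm]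
  · intro k _
    rw [taylorTerm_succ_one hU hb, smul_zero]

theorem taylorSum_add (hU : IsOpen U) {b : Fin n → ℝ} (hb : b ∈ U) (s : Fin n → Grass N)
    {f h : (Fin n → ℝ) → ℝ} (hf : ContDiffOn ℝ (⊤ : ℕ∞) f U) (hh : ContDiffOn ℝ (⊤ : ℕ∞) h U) :
    taylorSum s b (f + h) = taylorSum s b f + taylorSum s b h := by
  simp only [taylorSum, ← Finset.sum_add_distrib, ← smul_add, taylorTerm_add hU hb _ hf hh]

/-- Evaluation of target functions on a superfield. -/
def IsSuperfield.eval (hU : IsOpen U) (hX : IsSuperfield U X) : TargetFun U →+* EvenFun N where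
  toFun f := .mk (hX.evalFun hU f.prop) (hX.evalFun_mem hU f.prop)
  map_zero' := Subtype.ext (SmoothFun.ext fun t =>
    (hX.evalFun_apply hU _ t).trans (taylorSum_zero_fun hU (hX.body_mem t) _))
  map_one' := Subtype.ext (SmoothFun.ext fun t =>
    (hX.evalFun_apply hU _ t).trans (taylorSum_one hU (hX.body_mem t) _))
  map_add' f h := Subtype.ext (SmoothFun.ext fun t =>
    (hX.evalFun_apply hU _ t).trans ((taylorSum_add hU (hX.body_mem t) _ f.prop h.prop).trans
      (congrArg₂ _ (hX.evalFun_apply hU f.prop t) (hX.evalFun_apply hU h.prop t)).symm))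
  map_mul' f h := Subtype.ext (SmoothFun.ext fun t =>
    (hX.evalFun_apply hU _ t).trans ((taylorSum_mul hU (hX.body_mem t)
      (fun L => hX.parity_soul L t) (fun L => hX.algebraMapInv_soul L t) f.prop h.prop).trans
      (congrArg₂ _ (hX.evalFun_apply hU f.prop t) (hX.evalFun_apply hU h.prop t)).symm))

theorem IsSuperfield.coe_eval (hU : IsOpen U) (hX : IsSuperfield U X) (f : TargetFun U) :
    (hX.eval hU f).val.val = superEval f.val X := hX.coe_evalFun hU f.prop

theorem IsSuperfield.eval_congr (hU : IsOpen U) (hX : IsSuperfield U X) {f h : TargetFun U}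
    (hfh : ∀ x ∈ U, f.val x = h.val x) : hX.eval hU f = hX.eval hU h :=
  Subtype.ext (hX.evalFun_congr hU f.prop h.prop hfh)

/-- Partial derivatives of smooth functions on the target. -/
def TargetFun.pd (hU : IsOpen U) (L : Fin n) (f : TargetFun U) : TargetFun U :=
  .mk (SuperSigma.pd L f.val) (pd_contDiffOn hU f.prop L)

theorem IsSuperfield.ddt_eval (hU : IsOpen U) (hX : IsSuperfield U X) (f : TargetFun U) :
    ddt (hX.eval hU f).val = ∑ L, hX.eval hU (f.pd hU L) • ddt (hX.fieldFun L) :=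
  hX.ddt_evalFun hU f.prop

theorem IsSuperfield.superDeriv_eval (hU : IsOpen U) (hX : IsSuperfield U X) (c : ℂ)
    (f : TargetFun U) : superDeriv c (hX.eval hU f).val =
      ∑ L, hX.eval hU (f.pd hU L) • superDeriv c (hX.fieldFun L) :=
  hX.superDeriv_evalFun hU c f.prop

theorem IsSuperfield.fieldFun_mem (hX : IsSuperfield U X) (L : Fin n) :
    hX.fieldFun L ∈ evenAlg N :=
  mem_evenAlg.2 (SmoothFun.ext fun t => (hX.even L t).parity_eq)

/-! ### Variations of superfields -/

theorem isEven_of_parity_eq {z : Grass N} (hz : parity z = z) : IsEven z := by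
  have h : z ∈ CliffordAlgebra.evenOdd (0 : QuadraticForm ℂ (Fin (N + 1) → ℂ)) 0 ⊔
      CliffordAlgebra.evenOdd (0 : QuadraticForm ℂ (Fin (N + 1) → ℂ)) 1 := by
    rw [(CliffordAlgebra.evenOdd_isCompl (0 : QuadraticForm ℂ (Fin (N + 1) → ℂ))).sup_eq_top]
    trivial
  obtain ⟨x, hx, y, hy, rfl⟩ := Submodule.mem_sup.1 h
  have hx' : parity x = x := IsEven.parity_eq hx
  have hy' : parity y = -y := IsOdd.parity_eq hy
  rw [map_add, hx', hy', add_right_inj] at hz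
  rw [eq_zero_of_eq_neg hz.symm, add_zero]
  exact hx

variable {ε : Grass N} {Y : Fin n → SmoothFun N}

theorem IsSuperfield.body_vary (hε : parity ε = -ε) (Y : Fin n → SmoothFun N) (t : ℝ) :
    body (fun M t => X M t + ε * (Y M).val t) t = body X t := by
  funext M
  rw [body, map_add, map_mul, algebraMapInv_eq_zero_of_parity_eq_neg hε, zero_mul, add_zero, body]

/-- The superfield `X + ε Y`. -/
theorem IsSuperfield.vary (hX : IsSuperfield U X) (hε : parity ε = -ε) (hY : ∀ M, OddFun (Y M)) :
    IsSuperfield U (fun M t => X M t + ε * (Y M).val t) where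
  smooth M := (hX.fieldFun M + constFun ε * Y M).prop
  even M t := isEven_of_parity_eq (by
    have h : parity ((Y M).val t) = -(Y M).val t :=
      congrFun (congrArg SmoothFun.val (hY M)) t
    rw [map_add, map_mul, hε, h, neg_mul_neg, (hX.even M t).parity_eq])
  body_real M t := by
    rw [map_add, map_mul, algebraMapInv_eq_zero_of_parity_eq_neg hε, zero_mul, add_zero]
    exact hX.body_real M t
  body_mem t := by
    rw [IsSuperfield.body_vary hε]
    exact hX.body_mem t

theorem IsSuperfield.fieldFun_vary (hX : IsSuperfield U X) (hε : parity ε = -ε)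
    (hY : ∀ M, OddFun (Y M)) (M : Fin n) :
    (hX.vary hε hY).fieldFun M = hX.fieldFun M + constFun ε * Y M := rfl

/-- An odd `ε` has no numerical part, so the expansion point stays fixed and the nilpotent part is
shifted by `ε Y`. Products of two such shifts contain `ε` twice, which makes the first-order formula
exact. -/
theorem IsSuperfield.eval_vary (hU : IsOpen U) (hX : IsSuperfield U X) (hε : parity ε = -ε)
    (hY : ∀ M, OddFun (Y M)) (f : TargetFun U) : ((hX.vary hε hY).eval hU f).val =
      (hX.eval hU f).val + constFun ε * ∑ L, hX.eval hU (f.pd hU L) • Y L := by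
  refine SmoothFun.ext fun t => ?_
  have hY' (L) : parity ((Y L).val t) = -(Y L).val t :=
    congrFun (congrArg SmoothFun.val (hY L)) t
  refine ((hX.vary hε hY).evalFun_apply hU f.prop t).trans ?_
  have h1 : (fun L => soul (fun M t => X M t + ε * (Y M).val t) L t) =
      (fun L => soul X L t) + fun L => ε * (Y L).val t := by
    funext L
    rw [Pi.add_apply, soul, soul, IsSuperfield.body_vary hε]
    abel
  have h2 := taylorSum_add_increment hU (hX.body_mem t) (fun L => hX.parity_soul L t)
    (fun L => hX.algebraMapInv_soul L t) (fun L => ε * (Y L).val t)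
    (fun L M w => by
      rw [mul_assoc, mul_assoc ε, ← mul_assoc _ ε, mul_eq_mul_parity hε, mul_assoc, ← mul_assoc ε,
        mul_self_of_parity_eq_neg hε, zero_mul])
    (fun L => by rw [map_mul, algebraMapInv_eq_zero_of_parity_eq_neg hε, zero_mul]) f.prop
  rw [IsSuperfield.body_vary hε, h1, h2]
  change _ = (hX.evalFun hU f.prop).val t + ε * (∑ L, hX.eval hU (f.pd hU L) • Y L).val t
  rw [hX.evalFun_apply, SmoothFun.sum_apply, Finset.mul_sum]
  congr 1
  refine Finset.sum_congr rfl fun L _ => ?_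
  change _ = ε * ((hX.evalFun hU (pd_contDiffOn hU f.prop L)).val t * (Y L).val t)
  rw [hX.evalFun_apply, mul_assoc]
  congr 1
  refine mul_comm_of_parity_eq ?_ _
  rw [taylorSum, map_sum]
  simp only [map_smul, parity_taylorTerm (fun L => hX.parity_soul L t)]

end

end SuperSigma

namespace SuperSigma

/-! ### Contractions with odd quantities -/

section Contraction

variable {ι R A : Type*} [Fintype ι] [CommRing R] [Ring A] [Algebra R A]

/-- The contraction `f_{LKM} p^L ξ^K ξ^M`. -/
def cubic (p : ι → R) (ξ : ι → A) : (ι → ι → ι → R) →ₗ[R] A where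
  toFun f := ∑ K, ∑ M, (∑ L, f L K M * p L) • (ξ K * ξ M)
  map_add' f h := by simp only [Pi.add_apply, add_mul, add_smul, Finset.sum_add_distrib]
  map_smul' c f := by
    simp only [Pi.smul_apply, Finset.smul_sum, smul_smul, smul_eq_mul, Finset.mul_sum, mul_assoc,
      RingHom.id_apply]

/-- The contraction `f_{abcd} ξ^a ξ^b ξ^c ξ^d`. -/
def quartic (ξ : ι → A) : (ι → ι → ι → ι → R) →ₗ[R] A where
  toFun f := ∑ a, ∑ b, ∑ c, ∑ d, f a b c d • (ξ a * ξ b * ξ c * ξ d)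
  map_add' f h := by simp only [Pi.add_apply, add_smul, Finset.sum_add_distrib]
  map_smul' c f := by
    simp only [Pi.smul_apply, Finset.smul_sum, smul_smul, smul_eq_mul, RingHom.id_apply]

theorem cubic_apply (p : ι → R) (ξ : ι → A) (f : ι → ι → ι → R) :
    cubic p ξ f = ∑ K, ∑ M, (∑ L, f L K M * p L) • (ξ K * ξ M) := rfl

theorem quartic_apply (ξ : ι → A) (f : ι → ι → ι → ι → R) :
    quartic ξ f = ∑ a, ∑ b, ∑ c, ∑ d, f a b c d • (ξ a * ξ b * ξ c * ξ d) := rfl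

theorem cubic_swap (p : ι → R) {ξ : ι → A} (hξ : ∀ a b, ξ a * ξ b = -(ξ b * ξ a))
    (f : ι → ι → ι → R) : cubic p ξ (fun L K M => f L M K) = -cubic p ξ f := by
  simp only [cubic_apply, ← Finset.sum_neg_distrib]
  rw [Finset.sum_comm]
  refine Finset.sum_congr rfl fun K _ => Finset.sum_congr rfl fun M _ => ?_
  rw [hξ, smul_neg]

theorem quartic_swap_01 {ξ : ι → A} (hξ : ∀ a b, ξ a * ξ b = -(ξ b * ξ a))
    (f : ι → ι → ι → ι → R) : quartic ξ (fun a b c d => f b a c d) = -quartic ξ f := by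
  simp only [quartic_apply, ← Finset.sum_neg_distrib]
  rw [Finset.sum_comm]
  refine Finset.sum_congr rfl fun a _ => Finset.sum_congr rfl fun b _ =>
    Finset.sum_congr rfl fun c _ => Finset.sum_congr rfl fun d _ => ?_
  rw [hξ b a, neg_mul, neg_mul, smul_neg]

theorem quartic_swap_12 {ξ : ι → A} (hξ : ∀ a b, ξ a * ξ b = -(ξ b * ξ a))
    (f : ι → ι → ι → ι → R) : quartic ξ (fun a b c d => f a c b d) = -quartic ξ f := by
  simp only [quartic_apply, ← Finset.sum_neg_distrib]
  refine Finset.sum_congr rfl fun a _ => ?_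
  rw [Finset.sum_comm]
  refine Finset.sum_congr rfl fun b _ =>
    Finset.sum_congr rfl fun c _ => Finset.sum_congr rfl fun d _ => ?_
  rw [mul_assoc (ξ a), hξ c b, mul_neg, neg_mul, smul_neg, ← mul_assoc]

theorem quartic_swap_23 {ξ : ι → A} (hξ : ∀ a b, ξ a * ξ b = -(ξ b * ξ a))
    (f : ι → ι → ι → ι → R) : quartic ξ (fun a b c d => f a b d c) = -quartic ξ f := by
  simp only [quartic_apply, ← Finset.sum_neg_distrib]
  refine Finset.sum_congr rfl fun a _ => Finset.sum_congr rfl fun b _ => ?_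
  rw [Finset.sum_comm]
  refine Finset.sum_congr rfl fun c _ => Finset.sum_congr rfl fun d _ => ?_
  rw [mul_assoc (ξ a * ξ b), hξ d c, mul_neg, smul_neg, ← mul_assoc]

/-! ### Normal forms of the terms built from the odd field `Y = J ξ` -/

variable (p : ι → R) (ξ τ : ι → A) (G J : ι → ι → R) (dG dJ : ι → ι → ι → R)
  (C : ι → ι → ι → R) (dC : ι → ι → ι → ι → R)

/-- `Y^M = J_K^M ξ^K`. -/
def rot (ξ : ι → A) (J : ι → ι → R) (M : ι) : A := ∑ K, J K M • ξ K

/-- The time derivative of `Y^M`. -/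
def rotDot (p : ι → R) (ξ τ : ι → A) (J : ι → ι → R) (dJ : ι → ι → ι → R) (M : ι) : A :=
  ∑ K, ((∑ L, dJ L K M * p L) • ξ K + J K M • τ K)

/-- The part quadratic in `ξ` of the covariant derivative of `Y^M`. -/
def rotQuad (ξ : ι → A) (dJ : ι → ι → ι → R) (M : ι) : A :=
  ∑ K, (∑ L, dJ L K M • ξ L) * ξ K

theorem sum_smul_rot (h : ι → R) : ∑ M, h M • rot ξ J M = ∑ K, (∑ M, J K M * h M) • ξ K := by
  simp only [rot, Finset.smul_sum, Finset.sum_smul, smul_smul, mul_comm (h _)]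
  exact Finset.sum_comm

theorem sum_rot_mul (T : ι → ι → R) : ∑ M, ∑ K, T M K • (rot ξ J M * τ K) =
    ∑ R, ∑ K, (∑ M, J R M * T M K) • (ξ R * τ K) := by
  rw [Finset.sum_comm]
  conv_rhs => rw [Finset.sum_comm]
  refine Finset.sum_congr rfl fun K _ => ?_
  simp only [← smul_mul_assoc, ← Finset.sum_mul, sum_smul_rot]

theorem sum_mul_rot (T : ι → ι → R) : ∑ M, ∑ K, T M K • (τ M * rot ξ J K) =
    ∑ M, ∑ R, (∑ K, J R K * T M K) • (τ M * ξ R) := by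
  refine Finset.sum_congr rfl fun M _ => ?_
  simp only [← mul_smul_comm, ← Finset.mul_sum, sum_smul_rot]

theorem sum_smul_rotQuad (h : ι → R) : ∑ K, h K • rotQuad ξ dJ K =
    ∑ L, ∑ R, (∑ K, h K * dJ L R K) • (ξ L * ξ R) := by
  simp only [rotQuad, Finset.smul_sum, Finset.sum_smul, Finset.sum_mul, smul_mul_assoc, smul_smul]
  rw [Finset.sum_comm]
  conv_rhs => rw [Finset.sum_comm]
  exact Finset.sum_congr rfl fun R _ => Finset.sum_comm

theorem sum_grad_rot_mul : ∑ M, ∑ K, (∑ L, dG L M K • rot ξ J L) * (p M • ξ K) =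
    cubic p ξ (fun M R K => ∑ L, J R L * dG L M K) := by
  simp only [sum_smul_rot, Finset.sum_mul, smul_mul_smul_comm]
  rw [cubic_apply, Finset.sum_comm]
  conv_rhs => rw [Finset.sum_comm]
  refine Finset.sum_congr rfl fun K _ => ?_
  rw [Finset.sum_comm]
  refine Finset.sum_congr rfl fun R _ => ?_
  simp only [Finset.sum_mul, Finset.sum_smul]

theorem sum_rotDot_mul : ∑ M, ∑ K, G M K • (rotDot p ξ τ J dJ M * ξ K) =
      cubic p ξ (fun L R K => ∑ M, G M K * dJ L R M) +
        ∑ R, ∑ K, (∑ M, J R M * G M K) • (τ R * ξ K) := by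
  -- The time derivative of `J ξ` is again of this shape: `ξ` contracted with the derivative of `J`,
  -- plus `τ` contracted with `J`.
  have h (M) : rotDot p ξ τ J dJ M = rot ξ (fun K M => ∑ L, dJ L K M * p L) M + rot τ J M := by
    simp only [rotDot, rot, Finset.sum_add_distrib]
  simp only [h, add_mul, smul_add, Finset.sum_add_distrib]
  rw [sum_rot_mul, sum_rot_mul, cubic_apply]
  congr 1
  refine Finset.sum_congr rfl fun R _ => Finset.sum_congr rfl fun K _ => ?_
  congr 1
  simp only [Finset.sum_mul]
  rw [Finset.sum_comm]
  exact Finset.sum_congr rfl fun L _ => Finset.sum_congr rfl fun M _ => by ring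

theorem sum_mul_smul_rotQuad : ∑ M, ∑ K, (G M K * p M) • rotQuad ξ dJ K =
      cubic p ξ (fun M L R => ∑ K, G M K * dJ L R K) := by
  rw [Finset.sum_comm]
  simp only [← Finset.sum_smul]
  rw [sum_smul_rotQuad, cubic_apply]
  refine Finset.sum_congr rfl fun L _ => Finset.sum_congr rfl fun R _ => ?_
  congr 1
  simp only [Finset.sum_mul]
  rw [Finset.sum_comm]
  exact Finset.sum_congr rfl fun L _ => Finset.sum_congr rfl fun M _ => by ring

theorem sum_grad_mul_rot : ∑ M, ∑ K, (∑ L, dG L M K • ξ L) * (p M • rot ξ J K) =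
    cubic p ξ (fun M L R => ∑ K, J R K * dG L M K) := by
  have h (M) : ∑ K, (∑ L, dG L M K • ξ L) * (p M • rot ξ J K) =
      ∑ L, ∑ R, ((∑ K, J R K * dG L M K) * p M) • (ξ L * ξ R) := by
    have := sum_mul_rot ξ ξ J (fun L K => dG L M K * p M)
    rw [Finset.sum_comm] at this
    simp only [Finset.sum_mul, smul_mul_smul_comm]
    refine this.trans (Finset.sum_congr rfl fun L _ => Finset.sum_congr rfl fun R _ => ?_)
    congr 1
    exact Finset.sum_congr rfl fun K _ => by ring
  simp only [h, cubic_apply, Finset.sum_smul]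
  rw [Finset.sum_comm]
  exact Finset.sum_congr rfl fun L _ => Finset.sum_comm

theorem sum_gradDot_rot_mul : ∑ M, ∑ K, (∑ L, dG L M K * p L) • (rot ξ J M * ξ K) =
    cubic p ξ (fun L R K => ∑ M, J R M * dG L M K) := by
  rw [sum_rot_mul, cubic_apply]
  refine Finset.sum_congr rfl fun R _ => Finset.sum_congr rfl fun K _ => ?_
  congr 1
  simp only [Finset.sum_mul, Finset.mul_sum]
  rw [Finset.sum_comm]
  exact Finset.sum_congr rfl fun L _ => Finset.sum_congr rfl fun M _ => by ring

theorem sum_torsion_vel_rot_mul :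
    ∑ S, ∑ P, ∑ M, (C S P M * p P) • (rot ξ J S * ξ M) =
      cubic p ξ (fun P R M => ∑ S, J R S * C S P M) := by
  have h (S) : ∑ P, ∑ M, (C S P M * p P) • (rot ξ J S * ξ M) =
      ∑ M, (∑ P, C S P M * p P) • (rot ξ J S * ξ M) := by
    rw [Finset.sum_comm]
    simp only [Finset.sum_smul]
  simp only [h]
  exact sum_gradDot_rot_mul p ξ J (fun P S M => C S P M)

theorem sum_torsion_rotVel_mul :
    ∑ S, ∑ P, ∑ M, (C S P M * ∑ K, J K S * p K) • (ξ P * ξ M) =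
      cubic p ξ (fun K P M => ∑ S, J K S * C S P M) := by
  rw [Finset.sum_comm, cubic_apply]
  refine Finset.sum_congr rfl fun P _ => ?_
  rw [Finset.sum_comm]
  refine Finset.sum_congr rfl fun M _ => ?_
  rw [← Finset.sum_smul]
  congr 1
  simp only [Finset.sum_mul, Finset.mul_sum]
  rw [Finset.sum_comm]
  exact Finset.sum_congr rfl fun L _ => Finset.sum_congr rfl fun M _ => by ring

theorem sum_torsion_rotQuad_mul :
    ∑ S, ∑ P, ∑ M, C S P M • (rotQuad ξ dJ S * (ξ P * ξ M)) =
      quartic ξ (fun L R P M => ∑ S, C S P M * dJ L R S) := by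
  have h (P M) : ∑ S, C S P M • (rotQuad ξ dJ S * (ξ P * ξ M)) =
      ∑ L, ∑ R, (∑ S, C S P M * dJ L R S) • (ξ L * ξ R * ξ P * ξ M) := by
    simp only [← smul_mul_assoc, ← Finset.sum_mul]
    rw [sum_smul_rotQuad, mul_assoc]
    simp only [Finset.sum_mul, smul_mul_assoc, mul_assoc]
  calc _ = ∑ P, ∑ M, ∑ S, C S P M • (rotQuad ξ dJ S * (ξ P * ξ M)) := by
        rw [Finset.sum_comm]; exact Finset.sum_congr rfl fun P _ => Finset.sum_comm
    _ = ∑ P, ∑ M, ∑ L, ∑ R, (∑ S, C S P M * dJ L R S) • (ξ L * ξ R * ξ P * ξ M) := by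
        simp only [h]
    _ = ∑ P, ∑ L, ∑ R, ∑ M, (∑ S, C S P M * dJ L R S) • (ξ L * ξ R * ξ P * ξ M) := by
        refine Finset.sum_congr rfl fun P _ => ?_
        rw [Finset.sum_comm]; exact Finset.sum_congr rfl fun L _ => Finset.sum_comm
    _ = _ := by
        rw [Finset.sum_comm, quartic_apply]
        exact Finset.sum_congr rfl fun L _ => Finset.sum_comm

theorem sum_torsionGrad_rot_mul :
    ∑ S, ∑ P, ∑ M, (∑ L, dC L S P M • rot ξ J L) * (ξ S * ξ P * ξ M) =
      quartic ξ (fun R S P M => ∑ L, J R L * dC L S P M) := by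
  simp only [sum_smul_rot, Finset.sum_mul, smul_mul_assoc, ← mul_assoc]
  calc _ = ∑ S, ∑ P, ∑ R, ∑ M, (∑ L, J R L * dC L S P M) • (ξ R * ξ S * ξ P * ξ M) :=
        Finset.sum_congr rfl fun S _ => Finset.sum_congr rfl fun P _ => Finset.sum_comm
    _ = ∑ S, ∑ R, ∑ P, ∑ M, (∑ L, J R L * dC L S P M) • (ξ R * ξ S * ξ P * ξ M) :=
        Finset.sum_congr rfl fun S _ => Finset.sum_comm
    _ = _ := Finset.sum_comm

theorem sum_torsionGrad_mul_rot :
    ∑ S, ∑ P, ∑ M, (∑ L, dC L S P M • ξ L) * (rot ξ J S * (ξ P * ξ M)) =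
      quartic ξ (fun L R P M => ∑ S, J R S * dC L S P M) := by
  have h (P M) : ∑ S, (∑ L, dC L S P M • ξ L) * (rot ξ J S * (ξ P * ξ M)) =
      ∑ L, ∑ R, (∑ S, J R S * dC L S P M) • (ξ L * ξ R * ξ P * ξ M) := by
    have := sum_mul_rot ξ ξ J (fun L S => dC L S P M)
    rw [Finset.sum_comm] at this
    simp only [← mul_assoc, ← Finset.sum_mul]
    simp only [mul_assoc, Finset.sum_mul, smul_mul_assoc]
    have h2 := congrArg (· * (ξ P * ξ M)) this
    simp only [Finset.sum_mul, smul_mul_assoc, mul_assoc] at h2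
    exact h2
  calc _ = ∑ P, ∑ M, ∑ S, (∑ L, dC L S P M • ξ L) * (rot ξ J S * (ξ P * ξ M)) := by
        rw [Finset.sum_comm]; exact Finset.sum_congr rfl fun P _ => Finset.sum_comm
    _ = ∑ P, ∑ M, ∑ L, ∑ R, (∑ S, J R S * dC L S P M) • (ξ L * ξ R * ξ P * ξ M) := by
        simp only [h]
    _ = ∑ P, ∑ L, ∑ R, ∑ M, (∑ S, J R S * dC L S P M) • (ξ L * ξ R * ξ P * ξ M) := by
        refine Finset.sum_congr rfl fun P _ => ?_
        rw [Finset.sum_comm]; exact Finset.sum_congr rfl fun L _ => Finset.sum_comm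
    _ = _ := by
        rw [Finset.sum_comm, quartic_apply]
        exact Finset.sum_congr rfl fun L _ => Finset.sum_comm

end Contraction

end SuperSigma

namespace SuperSigma

/-! ### Alternating sums and the cancellation of the contracted terms -/

section Contraction

variable {ι R A : Type*} [Fintype ι] [CommRing R] [Ring A] [Algebra R A] [Algebra ℂ A]

theorem eq_zero_of_add_self {M : Type*} [AddCommGroup M] [Module ℂ M] {x : M} (h : x + x = 0) :
    x = 0 := by
  rw [← two_smul ℂ] at h
  exact (smul_eq_zero.1 h).resolve_left two_ne_zero

theorem cubic_eq_zero (p : ι → R) {ξ : ι → A} (hξ : ∀ a b, ξ a * ξ b = -(ξ b * ξ a))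
    {f : ι → ι → ι → R} (hf : ∀ L K M, f L K M = f L M K) : cubic p ξ f = 0 := by
  have h := cubic_swap p hξ f
  have h2 : (fun L K M => f L M K) = f := by funext L K M; rw [hf]
  rw [h2] at h
  exact eq_zero_of_add_self (by nth_rewrite 1 [h]; exact neg_add_cancel _)

/-- The alternating sum over the position of the first index. -/
def alternate₁ (f : ι → ι → ι → ι → R) (a b c d : ι) : R :=
  f a b c d - f b a c d + f c a b d - f d a b c

/-- The alternating sum over the positions of the first two indices. -/
def alternate₂ (f : ι → ι → ι → ι → R) (a b c d : ι) : R :=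
  f a b c d - f a c b d + f a d b c - f b a c d + f b c a d - f b d a c +
    f c a b d - f c b a d + f c d a b - f d a b c + f d b a c - f d c a b

/-- Each of the four signed summands contracts to the same value: `e1`, `e2`, `e3` move the
distinguished index one place at a time, and every adjacent transposition costs a sign. -/
theorem quartic_alternate₁ {ξ : ι → A} (hξ : ∀ a b, ξ a * ξ b = -(ξ b * ξ a)) (f : ι → ι → ι → ι → R) :
    quartic ξ (alternate₁ f) = (4 : ℂ) • quartic ξ f := by
  have e1 := quartic_swap_01 hξ f
  have e2 := quartic_swap_12 hξ (fun a b c d => f b a c d)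
  have e3 := quartic_swap_23 hξ (fun a b c d => f c a b d)
  have e : alternate₁ f = f - (fun a b c d => f b a c d) + (fun a b c d => f c a b d) -
    (fun a b c d => f d a b c) := rfl
  rw [e, map_sub, map_add, map_sub]
  linear_combination (norm := module) (-3 : ℂ) • e1 + (2 : ℂ) • e2 - e3

/-- There are twelve ways to place the first two indices with the other two kept in order. Each is
reached from an earlier one by an adjacent transposition, and its sign cancels that of the
contraction. -/
theorem quartic_alternate₂ {ξ : ι → A} (hξ : ∀ a b, ξ a * ξ b = -(ξ b * ξ a)) (f : ι → ι → ι → ι → R) :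
    quartic ξ (alternate₂ f) = (12 : ℂ) • quartic ξ f := by
  have e1 := quartic_swap_12 hξ f
  have e2 := quartic_swap_23 hξ (fun a b c d => f a c b d)
  have e3 := quartic_swap_01 hξ f
  have e4 := quartic_swap_01 hξ (fun a b c d => f a c b d)
  have e5 := quartic_swap_01 hξ (fun a b c d => f a d b c)
  have e6 := quartic_swap_12 hξ (fun a b c d => f b a c d)
  have e7 := quartic_swap_12 hξ (fun a b c d => f b c a d)
  have e8 := quartic_swap_12 hξ (fun a b c d => f b d a c)
  have e9 := quartic_swap_23 hξ (fun a b c d => f c a b d)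
  have e10 := quartic_swap_23 hξ (fun a b c d => f c b a d)
  have e11 := quartic_swap_23 hξ (fun a b c d => f c d a b)
  have e : alternate₂ f = f - (fun a b c d => f a c b d) + (fun a b c d => f a d b c) -
    (fun a b c d => f b a c d) + (fun a b c d => f b c a d) - (fun a b c d => f b d a c) +
    (fun a b c d => f c a b d) - (fun a b c d => f c b a d) + (fun a b c d => f c d a b) -
    (fun a b c d => f d a b c) + (fun a b c d => f d b a c) - (fun a b c d => f d c a b) := rfl
  simp only [e, map_sub, map_add]
  rw [e11, e10, e9, e8, e7, e6, e5, e4, e3, e2, e1]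
  module

variable [Algebra ℂ R] [IsScalarTower ℂ R A]

variable (p : ι → R) (ξ τ : ι → A) (G J : ι → ι → R) (dG dJ : ι → ι → ι → R)
  (C : ι → ι → ι → R) (dC : ι → ι → ι → ι → R)

/-- The covariant derivative of `Y^M`. -/
def rotCov (p : ι → R) (ξ : ι → A) (J : ι → ι → R) (dJ : ι → ι → ι → R) (M : ι) : A :=
  rotQuad ξ dJ M - Complex.I • ((∑ K, J K M * p K) • (1 : A))

variable {p ξ τ G J dG dJ C dC}

/-- The left side is twelve times the varied Lagrangian without `ε`, the right side twelve times `D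
B`. After reduction to normal forms, skewness of `G J` handles `p p` and `τ ξ`, `hcubic` handles `p
ξ ξ`, and `hquartic` handles `ξ ξ ξ ξ`. No geometry is left at this level: the statement is linear
algebra over the commutative ring of even coefficients. -/
theorem variation_eq_superDeriv (hξ : ∀ a b, ξ a * ξ b = -(ξ b * ξ a))
    (hτ : ∀ a b, τ a * ξ b = -(ξ b * τ a)) (hG : ∀ M K, G M K = G K M)
    (hGJ : ∀ M K, ∑ L, J M L * G L K = -∑ L, J K L * G L M)
    (hC : ∀ S P M, C S P M = -C S M P)
    (hcubic : ∀ L K N,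
      3 * (∑ M, J K M * dG M L N) + 2 * (∑ M, G M N * dJ L K M) - 2 * (∑ M, G L M * dJ K N M) +
        (∑ M, J N M * dG K L M) - (∑ M, J K M * dG L M N) - (∑ S, J K S * C S L N) -
        (∑ S, J L S * C S K N) =
      3 * (∑ M, J N M * dG M L K) + 2 * (∑ M, G M K * dJ L N M) - 2 * (∑ M, G L M * dJ N K M) +
        (∑ M, J K M * dG N L M) - (∑ M, J N M * dG L M K) - (∑ S, J N S * C S L K) -
        (∑ S, J L S * C S N K))
    (hquartic : quartic ξ (fun a b c d => ∑ S, J a S * dC S b c d) +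
      quartic ξ (fun a b c d => ∑ S, J b S * dC a S c d) -
      (2 : ℂ) • quartic ξ (fun a b c d => ∑ S, C S c d * dJ a b S) = 0) :
    (6 * Complex.I) • ∑ M, ∑ K, ((∑ L, dG L M K • rot ξ J L) * (p M • ξ K) +
        G M K • (rotDot p ξ τ J dJ M * ξ K) - (G M K * p M) • rotCov p ξ J dJ K) -
      ∑ S, ∑ P, ∑ M, ((∑ L, dC L S P M • rot ξ J L) * (ξ S * ξ P * ξ M) -
        (3 : ℂ) • C S P M • (rotCov p ξ J dJ S * (ξ P * ξ M))) =
    (-2 * Complex.I) • ∑ M, ∑ K, ((∑ L, dG L M K • ξ L) * (p M • rot ξ J K) +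
        G M K • (τ M * rot ξ J K) + (G M K * p M) • rotCov p ξ J dJ K) +
      ∑ S, ∑ P, ∑ M, ((∑ L, dC L S P M • ξ L) * (rot ξ J S * (ξ P * ξ M)) +
        C S P M • (rotCov p ξ J dJ S * (ξ P * ξ M)) +
        Complex.I • C S P M • (rot ξ J S * (p P • ξ M) - rot ξ J S * (p M • ξ P))) +
      (2 * Complex.I) • ∑ M, ∑ K, ((∑ L, dG L M K * p L) • (rot ξ J M * ξ K) +
        G M K • (rotDot p ξ τ J dJ M * ξ K) + G M K • (rot ξ J M * τ K)) := by
  -- The velocities commute, so they contract the skew tensor `G J` with a symmetric product.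
  have hpp : ∑ M, ∑ K, (G M K * p M) • ((∑ N, J N K * p N) • (1 : A)) = 0 := by
    simp only [smul_smul, ← Finset.sum_smul]
    have h : ∑ M, ∑ K, G M K * p M * ∑ N, J N K * p N = 0 := by
      have h1 : ∑ M, ∑ K, G M K * p M * ∑ N, J N K * p N =
          ∑ M, ∑ N, (∑ K, J N K * G K M) * (p M * p N) := by
        refine Finset.sum_congr rfl fun M _ => ?_
        simp only [Finset.mul_sum, Finset.sum_mul]
        rw [Finset.sum_comm]
        refine Finset.sum_congr rfl fun N _ => Finset.sum_congr rfl fun K _ => ?_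
        rw [hG M K]; ring
      refine eq_zero_of_add_self ?_
      rw [h1]
      nth_rewrite 1 [Finset.sum_comm]
      simp only [← Finset.sum_add_distrib]
      refine Finset.sum_eq_zero fun M _ => Finset.sum_eq_zero fun N _ => ?_
      rw [hGJ M N]; ring
    rw [h, zero_smul]
  have hcov : ∑ M, ∑ K, (G M K * p M) • rotCov p ξ J dJ K =
      cubic p ξ (fun M L R => ∑ K, G M K * dJ L R K) := by
    have h (M K) : (G M K * p M) • rotCov p ξ J dJ K = (G M K * p M) • rotQuad ξ dJ K -
        Complex.I • ((G M K * p M) • ((∑ N, J N K * p N) • (1 : A))) := by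
      rw [rotCov, smul_sub, smul_comm (G M K * p M) Complex.I]
    simp only [h, Finset.sum_sub_distrib, ← Finset.smul_sum]
    rw [hpp, smul_zero, sub_zero, sum_mul_smul_rotQuad]
  have htor : ∑ S, ∑ P, ∑ M, C S P M • (rotCov p ξ J dJ S * (ξ P * ξ M)) =
      quartic ξ (fun a b c d => ∑ S, C S c d * dJ a b S) -
        Complex.I • cubic p ξ (fun K P M => ∑ S, J K S * C S P M) := by
    have h (S P M) : C S P M • (rotCov p ξ J dJ S * (ξ P * ξ M)) =
        C S P M • (rotQuad ξ dJ S * (ξ P * ξ M)) -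
          Complex.I • ((C S P M * ∑ K, J K S * p K) • (ξ P * ξ M)) := by
      rw [rotCov, sub_mul, smul_sub, smul_mul_assoc, smul_mul_assoc, one_mul,
        smul_comm (C S P M) Complex.I, smul_smul]
    simp only [h, Finset.sum_sub_distrib, ← Finset.smul_sum]
    rw [sum_torsion_rotQuad_mul, sum_torsion_rotVel_mul]
  have hvel1 : ∑ S, ∑ P, ∑ M, C S P M • (rot ξ J S * (p P • ξ M)) =
      cubic p ξ (fun P R M => ∑ S, J R S * C S P M) := by
    simp only [mul_smul_comm, smul_smul]
    exact sum_torsion_vel_rot_mul p ξ J C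
  have hvel2 : ∑ S, ∑ P, ∑ M, C S P M • (rot ξ J S * (p M • ξ P)) =
      -cubic p ξ (fun P R M => ∑ S, J R S * C S P M) := by
    rw [← hvel1, ← Finset.sum_neg_distrib]
    refine Finset.sum_congr rfl fun S _ => ?_
    rw [Finset.sum_comm]
    simp only [← Finset.sum_neg_distrib]
    refine Finset.sum_congr rfl fun M _ => Finset.sum_congr rfl fun P _ => ?_
    rw [hC S P M, neg_smul]
  -- Together with `hA3` this writes all terms in `τ` through one contraction. Its coefficient is
  -- `6i` on the left and `2i + 2i + 2i` on the right.
  have hA2 : ∑ M, ∑ K, G M K • (τ M * rot ξ J K) =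
      -∑ R, ∑ K, (∑ M, J R M * G M K) • (τ R * ξ K) := by
    rw [sum_mul_rot]
    simp only [← Finset.sum_neg_distrib]
    refine Finset.sum_congr rfl fun M _ => Finset.sum_congr rfl fun R _ => ?_
    rw [← neg_smul]
    congr 1
    rw [← hGJ R M]
    exact Finset.sum_congr rfl fun K _ => by rw [hG M K]
  have hA3 : ∑ M, ∑ K, G M K • (rot ξ J M * τ K) =
      ∑ R, ∑ K, (∑ M, J R M * G M K) • (τ R * ξ K) := by
    rw [sum_rot_mul, Finset.sum_comm]
    refine Finset.sum_congr rfl fun M _ => Finset.sum_congr rfl fun R _ => ?_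
    rw [hτ, smul_neg, hGJ R M, neg_smul]
  have hcub := cubic_eq_zero p hξ hcubic
  have hcub' : (3 : ℂ) • cubic p ξ (fun M R K => ∑ L, J R L * dG L M K) +
      (2 : ℂ) • cubic p ξ (fun L R K => ∑ M, G M K * dJ L R M) -
      (2 : ℂ) • cubic p ξ (fun M L R => ∑ K, G M K * dJ L R K) +
      cubic p ξ (fun M L R => ∑ K, J R K * dG L M K) -
      cubic p ξ (fun L R K => ∑ M, J R M * dG L M K) -
      cubic p ξ (fun P R M => ∑ S, J R S * C S P M) -
      cubic p ξ (fun K P M => ∑ S, J K S * C S P M) = 0 := by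
    rw [← hcub]
    have h3 (x : A) : (3 : ℂ) • x = (3 : R) • x := by
      rw [← algebraMap_smul R (_ : ℂ) x, map_ofNat]
    have h2 (x : A) : (2 : ℂ) • x = (2 : R) • x := by
      rw [← algebraMap_smul R (_ : ℂ) x, map_ofNat]
    simp only [h2, h3, ← map_smul, ← map_add, ← map_sub]
    rfl
  simp only [Finset.sum_add_distrib, Finset.sum_sub_distrib, ← Finset.smul_sum, smul_sub]
  rw [sum_grad_rot_mul, sum_rotDot_mul, hcov, htor, hvel1, hvel2, hA2, hA3,
    sum_torsionGrad_rot_mul, sum_grad_mul_rot, sum_torsionGrad_mul_rot, sum_gradDot_rot_mul]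
  linear_combination (norm := module) (2 * Complex.I) • hcub' - hquartic

/-- Contraction replaces the alternating sums by multiples `4` and `12`, so the hypothesis reads
`3(4α + 12β) = 2(12β + 12γ)`, that is `α + β = 2γ`. The factor `2/3` of condition 5 is the one that
produces this combination. -/
theorem quartic_relation (hξ : ∀ a b, ξ a * ξ b = -(ξ b * ξ a)) {α β γ : ι → ι → ι → ι → R}
    (h : ∀ a b c d, 3 * (alternate₁ α a b c d + alternate₂ β a b c d) =
      2 * (alternate₂ β a b c d + alternate₂ γ a b c d)) :
    quartic ξ α + quartic ξ β - (2 : ℂ) • quartic ξ γ = 0 := by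
  have h1 : (3 : R) • (alternate₁ α + alternate₂ β) = (2 : R) • (alternate₂ β + alternate₂ γ) := by
    funext a b c d
    exact h a b c d
  have h2 := congrArg (quartic ξ) h1
  have h3 (x : A) : (3 : R) • x = (3 : ℂ) • x := by
    rw [← algebraMap_smul R (_ : ℂ) x, map_ofNat]
  have h4 (x : A) : (2 : R) • x = (2 : ℂ) • x := by
    rw [← algebraMap_smul R (_ : ℂ) x, map_ofNat]
  simp only [map_smul, map_add, quartic_alternate₁ hξ, quartic_alternate₂ hξ, h3, h4] at h2
  linear_combination (norm := module) (1 / 12 : ℂ) • h2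

end Contraction

end SuperSigma

namespace SuperSigma

variable {n : ℕ}

/-! ### Identities for the tensors on the target -/

section

variable {U : Set (Fin n → ℝ)} {g I : (Fin n → ℝ) → Matrix (Fin n) (Fin n) ℝ}
  {C : (Fin n → ℝ) → (Fin n → ℝ) [⋀^Fin 3]→L[ℝ] ℝ}

theorem pd_fun_mul {f h : (Fin n → ℝ) → ℝ} {x : Fin n → ℝ} (hf : DifferentiableAt ℝ f x)
    (hh : DifferentiableAt ℝ h x) (L : Fin n) :
    pd L (fun y => f y * h y) x = pd L f x * h x + f x * pd L h x := by
  rw [pd, fderiv_fun_mul hf hh]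
  simp [pd]
  ring

theorem pd_fun_sum {ι : Type*} {s : Finset ι} {f : ι → (Fin n → ℝ) → ℝ} {x : Fin n → ℝ}
    (hf : ∀ i ∈ s, DifferentiableAt ℝ (f i) x) (L : Fin n) :
    pd L (fun y => ∑ i ∈ s, f i y) x = ∑ i ∈ s, pd L (f i) x := by
  rw [pd, fderiv_fun_sum hf, _root_.sum_apply]
  rfl

theorem comp3_rotate (S P M : Fin n) (x : Fin n → ℝ) : comp3 C S P M x = comp3 C M S P x := by
  have h := (C x).toAlternatingMap.map_perm
    ![Pi.single S 1, Pi.single P 1, Pi.single M 1] (finRotate 3)⁻¹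
  have h2 : (![Pi.single S 1, Pi.single P 1, Pi.single M 1] : Fin 3 → Fin n → ℝ) ∘
      ⇑(finRotate 3)⁻¹ = ![Pi.single M 1, Pi.single S 1, Pi.single P 1] := by
    funext i
    fin_cases i <;> rfl
  have h3 : Equiv.Perm.sign (finRotate 3)⁻¹ = 1 := by decide
  rw [h2, h3, one_smul] at h
  exact h.symm

theorem comp3_swap (S P M : Fin n) (x : Fin n → ℝ) : comp3 C S P M x = -comp3 C S M P x := by
  have h := (C x).toAlternatingMap.map_swap
    ![Pi.single S 1, Pi.single M 1, Pi.single P 1] (show (1 : Fin 3) ≠ 2 by decide)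
  have h2 : (![Pi.single S 1, Pi.single M 1, Pi.single P 1] : Fin 3 → Fin n → ℝ) ∘
      ⇑(Equiv.swap (1 : Fin 3) 2) = ![Pi.single S 1, Pi.single P 1, Pi.single M 1] := by
    funext i
    fin_cases i <;> rfl
  rw [h2] at h
  exact h

/-- The connection `Γ̂` with its upper index lowered. -/
theorem sum_metric_mul_gammaHat {x : Fin n → ℝ} (hdet : IsUnit (g x).det) (K P M : Fin n) :
    ∑ Q, g x K Q * gammaHat g C Q P M x =
      (1 / 2) * (pd P (fun y => g y K M) x + pd M (fun y => g y K P) x -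
        pd K (fun y => g y P M) x + comp3 C K P M x) := by
  have h (v : Fin n → ℝ) : ∑ Q, g x K Q * ∑ S, (g x)⁻¹ Q S * v S = v K := by
    have h1 : (g x).mulVec ((g x)⁻¹.mulVec v) = v := by
      rw [Matrix.mulVec_mulVec, Matrix.mul_nonsing_inv _ hdet, Matrix.one_mulVec]
    exact congrFun h1 K
  simp only [gammaHat, christoffel]
  have h1 := h (fun S => pd P (fun y => g y S M) x + pd M (fun y => g y S P) x -
    pd S (fun y => g y P M) x)
  have h2 := h (fun S => comp3 C S P M x)
  have h3 (u v : Fin n → ℝ) : ∑ Q, g x K Q * (1 / 2 * u Q + 1 / 2 * v Q) =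
      1 / 2 * ∑ Q, g x K Q * u Q + 1 / 2 * ∑ Q, g x K Q * v Q := by
    simp only [Finset.mul_sum, ← Finset.sum_add_distrib]
    exact Finset.sum_congr rfl fun Q _ => by ring
  rw [h3, h1, h2]
  ring

/-- In the first connection term the free index sits on `I`. Skewness of the lowered `I` moves the
metric onto `Γ̂`, so that both connection terms are expressed by derivatives of `g` and by `C`, with
no inverse metric left. -/
theorem sum_metric_mul_nablaHat {x : Fin n → ℝ} (hsymm : (g x).IsSymm) (hdet : IsUnit (g x).det)
    (h3 : ∀ M K, lowered g I M K x = -lowered g I K M x) (L K M : Fin n) :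
    ∑ N, g x M N * nablaHat g C I L K N x =
      ∑ N, g x M N * pd L (fun y => I y K N) x +
      ∑ R, I x M R * ((1 / 2) * (pd L (fun y => g y R K) x + pd K (fun y => g y R L) x -
        pd R (fun y => g y L K) x + comp3 C R L K x)) +
      ∑ Q, I x K Q * ((1 / 2) * (pd L (fun y => g y M Q) x + pd Q (fun y => g y M L) x -
        pd M (fun y => g y L Q) x + comp3 C M L Q x)) := by
  simp only [← sum_metric_mul_gammaHat hdet, nablaHat, mul_add, mul_sub, Finset.sum_add_distrib,
    Finset.sum_sub_distrib]
  have e1 : ∑ N, g x M N * ∑ Q, gammaHat g C Q L K x * I x Q N =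
      -∑ R, I x M R * ∑ Q, g x R Q * gammaHat g C Q L K x := by
    have h4 (Q) : ∑ N, g x M N * I x Q N = -∑ R, g x Q R * I x M R := h3 Q M
    calc _ = ∑ Q, gammaHat g C Q L K x * ∑ N, g x M N * I x Q N := by
          simp only [Finset.mul_sum]
          rw [Finset.sum_comm]
          exact Finset.sum_congr rfl fun Q _ => Finset.sum_congr rfl fun N _ => by ring
      _ = _ := by
          simp only [h4, Finset.mul_sum, mul_neg, Finset.sum_neg_distrib]
          rw [Finset.sum_comm]
          congr 1
          exact Finset.sum_congr rfl fun Q _ => Finset.sum_congr rfl fun N _ => by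
            rw [← hsymm.apply N Q]; ring
  have e2 : ∑ N, g x M N * ∑ Q, gammaHat g C N L Q x * I x K Q =
      ∑ Q, I x K Q * ∑ N, g x M N * gammaHat g C N L Q x := by
    simp only [Finset.mul_sum]
    rw [Finset.sum_comm]
    exact Finset.sum_congr rfl fun Q _ => Finset.sum_congr rfl fun N _ => by ring
  rw [e1, e2]
  ring

theorem pd_lowered_skew (hU : IsOpen U)
    (hg : ∀ M K, ContDiffOn ℝ (⊤ : ℕ∞) (fun x => g x M K) U)
    (hI : ∀ M K, ContDiffOn ℝ (⊤ : ℕ∞) (fun x => I x M K) U)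
    (h3 : ∀ x ∈ U, ∀ M K, lowered g I M K x = -lowered g I K M x) {x : Fin n → ℝ} (hx : x ∈ U)
    (L M K : Fin n) :
    (∑ R, g x K R * pd L (fun y => I y M R) x + ∑ R, I x M R * pd L (fun y => g y K R) x) +
      (∑ R, g x M R * pd L (fun y => I y K R) x + ∑ R, I x K R * pd L (fun y => g y M R) x)
      = 0 := by
  have h (M K) : pd L (lowered g I M K) x =
      ∑ R, g x K R * pd L (fun y => I y M R) x + ∑ R, I x M R * pd L (fun y => g y K R) x := by
    have hg' (R) := differentiableAt_of_contDiffOn hU (hg K R) hx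
    have hI' (R) := differentiableAt_of_contDiffOn hU (hI M R) hx
    have e : lowered g I M K = fun y => ∑ R, g y K R * I y M R := rfl
    rw [e, ← Finset.sum_add_distrib]
    refine (pd_fun_sum (f := fun R y => g y K R * I y M R)
      (fun R _ => (hg' R).fun_mul (hI' R)) L).trans (Finset.sum_congr rfl fun R _ => ?_)
    rw [pd_fun_mul (hg' R) (hI' R)]
    ring
  rw [← h, ← h]
  have h5 := pd_congr hU (f := lowered g I M K) (h := -lowered g I K M)
    (fun y hy => h3 y hy M K) L hx
  rw [h5, pd, fderiv_neg]
  simp [pd]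

/-- The identity expresses symmetry in `K` and `N` of the coefficient of `p ξ ξ`. It is a linear
combination of condition 4 with its upper index lowered, and of the derivative of condition 3, taken
over the arrangements of the three indices. -/
theorem cubic_identity (hU : IsOpen U)
    (hg : ∀ M K, ContDiffOn ℝ (⊤ : ℕ∞) (fun x => g x M K) U)
    (hI : ∀ M K, ContDiffOn ℝ (⊤ : ℕ∞) (fun x => I x M K) U)
    (hgsymm : ∀ x ∈ U, (g x).IsSymm) (hgdet : ∀ x ∈ U, IsUnit (g x).det)
    (h3 : ∀ x ∈ U, ∀ M K, lowered g I M K x = -lowered g I K M x)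
    (h4 : ∀ x ∈ U, ∀ L M K, nablaHat g C I L M K x + nablaHat g C I M L K x = 0)
    {x : Fin n → ℝ} (hx : x ∈ U) (L K N : Fin n) :
    3 * (∑ M, I x K M * pd M (fun y => g y L N) x) +
        2 * (∑ M, g x M N * pd L (fun y => I y K M) x) -
        2 * (∑ M, g x L M * pd K (fun y => I y N M) x) +
        (∑ M, I x N M * pd K (fun y => g y L M) x) -
        (∑ M, I x K M * pd L (fun y => g y M N) x) - (∑ S, I x K S * comp3 C S L N x) -
        (∑ S, I x L S * comp3 C S K N x) =
      3 * (∑ M, I x N M * pd M (fun y => g y L K) x) +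
        2 * (∑ M, g x M K * pd L (fun y => I y N M) x) -
        2 * (∑ M, g x L M * pd N (fun y => I y K M) x) +
        (∑ M, I x K M * pd N (fun y => g y L M) x) -
        (∑ M, I x N M * pd L (fun y => g y M K) x) - (∑ S, I x N S * comp3 C S L K x) -
        (∑ S, I x L S * comp3 C S N K x) := by
  have hsym (P M Q) : pd P (fun y => g y M Q) x = pd P (fun y => g y Q M) x :=
    pd_congr hU (fun y hy => (hgsymm y hy).apply Q M) P hx
  set G := g x with hGdef
  set J := I x with hJdef
  have hGs (M K) : G M K = G K M := (hgsymm x hx).apply K M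
  obtain ⟨dG, hdG⟩ : ∃ dG : Fin n → Fin n → Fin n → ℝ,
      ∀ L M K, pd L (fun y => g y M K) x = dG L M K := ⟨_, fun _ _ _ => rfl⟩
  obtain ⟨dJ, hdJ⟩ : ∃ dJ : Fin n → Fin n → Fin n → ℝ,
      ∀ L M K, pd L (fun y => I y M K) x = dJ L M K := ⟨_, fun _ _ _ => rfl⟩
  obtain ⟨T, hT⟩ : ∃ T : Fin n → Fin n → Fin n → ℝ,
      ∀ L M K, comp3 C L M K x = T L M K := ⟨_, fun _ _ _ => rfl⟩
  have hTrot (S P M) : T S P M = T M S P := by simp only [← hT]; exact comp3_rotate S P M x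
  have hTswap (S P M) : T S P M = -T S M P := by simp only [← hT]; exact comp3_swap S P M x
  simp only [hdG] at hsym
  -- From here on everything is linear in four arrays: `h` from `g ∂I`, `a` from `I ∂g` with `I` on
  -- the derivative index, `b` from `I ∂g` with `I` on a metric index, and `c` from `I C`. Naming
  -- them makes the final step plain linear arithmetic.
  obtain ⟨h, hh⟩ : ∃ h : Fin n → Fin n → Fin n → ℝ,
      ∀ L K N, ∑ M, G M N * dJ L K M = h L K N := ⟨_, fun _ _ _ => rfl⟩
  obtain ⟨a, ha⟩ : ∃ a : Fin n → Fin n → Fin n → ℝ,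
      ∀ K L N, ∑ M, J K M * dG M L N = a K L N := ⟨_, fun _ _ _ => rfl⟩
  obtain ⟨b, hb⟩ : ∃ b : Fin n → Fin n → Fin n → ℝ,
      ∀ N K L, ∑ M, J N M * dG K L M = b N K L := ⟨_, fun _ _ _ => rfl⟩
  obtain ⟨c, hc⟩ : ∃ c : Fin n → Fin n → Fin n → ℝ,
      ∀ K L N, ∑ S, J K S * T S L N = c K L N := ⟨_, fun _ _ _ => rfl⟩
  have hh' (L K N) : ∑ M, G N M * dJ L K M = h L K N := by simp only [← hh, hGs N]
  have hb' (N K L) : ∑ M, J N M * dG K M L = b N K L := by simp only [← hb, hsym K _ L]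
  have has (K L N) : a K L N = a K N L := by simp only [← ha, hsym _ L N]
  have hcs (K L N) : c K L N = -c K N L := by
    simp only [← hc, hTswap _ L N, mul_neg, Finset.sum_neg_distrib]
  have hA (L K M) : h L K M + (1 / 2) * (b M L K + b M K L - a M L K + c M L K) +
      (1 / 2) * (b K L M + a K L M - b K M L + c K M L) +
      (h K L M + (1 / 2) * (b M K L + b M L K - a M K L + c M K L) +
      (1 / 2) * (b L K M + a L K M - b L M K + c L M K)) = 0 := by
    have e (u v w z : Fin n → ℝ) (J : Fin n → ℝ) :
        ∑ R, J R * ((1 / 2) * (u R + v R - w R + z R)) = (1 / 2) *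
        (∑ R, J R * u R + ∑ R, J R * v R - ∑ R, J R * w R + ∑ R, J R * z R) := by
      simp only [Finset.mul_sum, ← Finset.sum_add_distrib, ← Finset.sum_sub_distrib]
      exact Finset.sum_congr rfl fun R _ => by ring
    have e2 (L K) := sum_metric_mul_nablaHat (C := C) (hgsymm x hx) (hgdet x hx) (h3 x hx) L K M
    have e3 : ∑ N, g x M N * nablaHat g C I L K N x + ∑ N, g x M N * nablaHat g C I K L N x = 0 := by
      simp only [← Finset.sum_add_distrib, ← mul_add, h4 x hx, mul_zero, Finset.sum_const_zero]
    have e4 (K M L) : ∑ Q, J K Q * T M L Q = c K M L := by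
      simp only [← hc]
      exact Finset.sum_congr rfl fun Q _ => by rw [hTrot M L Q]
    have e5 (K M L) : ∑ Q, J K Q * dG Q M L = a K L M := by rw [ha, has]
    rw [e2, e2, e, e, e, e] at e3
    simp only [hdG, hdJ, hT, ← hGdef, ← hJdef, hh', hb', hb, e4] at e3
    simp only [ha, hc] at e3
    linarith [has K M L, has L M K]
  have hS (L M K) : h L M K + b M L K + (h L K M + b K L M) = 0 := by
    have := pd_lowered_skew hU hg hI h3 hx L M K
    simp only [hdG, hdJ, ← hGdef, ← hJdef, hh', hb] at this
    exact this
  simp only [hdG, hdJ, hT, hh, hh', ha, hb, hb', hc]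
  linarith [hA L K N, hA L N K, hA K N L, hA K L N, hA N L K, hA N K L, hS L K N, hS K L N, hS N K L, has K L N,
    has L K N, has N K L, hcs K L N, hcs L K N, hcs N K L]

end

end SuperSigma

namespace SuperSigma

variable {n : ℕ}

/-! ### The derivation-like action on forms in components -/

section

variable {U : Set (Fin n → ℝ)} {I : (Fin n → ℝ) → Matrix (Fin n) (Fin n) ℝ}
  {C : (Fin n → ℝ) → (Fin n → ℝ) [⋀^Fin 3]→L[ℝ] ℝ}

theorem iota_apply {k : ℕ} (A : (Fin n → ℝ) →L[ℝ] (Fin n → ℝ))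
    (η : (Fin n → ℝ) [⋀^Fin k]→L[ℝ] ℝ) (v : Fin k → Fin n → ℝ) :
    iota A η v = ∑ j, η (Function.update v j (A (v j))) := by
  change (∑ j, η.toContinuousMultilinearMap.compContinuousLinearMap
      (fun i => if i = j then A else ContinuousLinearMap.id ℝ (Fin n → ℝ))) v = _
  rw [_root_.sum_apply]
  refine Finset.sum_congr rfl fun j _ => ?_
  change η (fun i => (if i = j then A else ContinuousLinearMap.id ℝ (Fin n → ℝ)) (v i)) = _
  congr 1
  funext i
  by_cases h : i = j
  · subst h; simp
  · simp [h]

theorem map_update_eq_sum {k : ℕ} (η : (Fin n → ℝ) [⋀^Fin k]→L[ℝ] ℝ) (v : Fin k → Fin n → ℝ)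
    (j : Fin k) (w : Fin n → ℝ) :
    η (Function.update v j w) = ∑ S, w S * η (Function.update v j (Pi.single S 1)) := by
  have hw : w = ∑ S, w S • (Pi.single S 1 : Fin n → ℝ) := by
    funext i
    simp [Finset.sum_apply, Pi.single_apply]
  conv_lhs => rw [hw]
  refine (η.toContinuousMultilinearMap.toMultilinearMap.map_update_sum _ _ _ _).trans
    (Finset.sum_congr rfl fun S _ => ?_)
  exact η.toContinuousMultilinearMap.toMultilinearMap.map_update_smul _ _ _ _

theorem iota_endo_apply {k : ℕ} (A : Matrix (Fin n) (Fin n) ℝ)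
    (η : (Fin n → ℝ) [⋀^Fin k]→L[ℝ] ℝ) (s : Fin k → Fin n) :
    iota (endo A) η (fun j => Pi.single (s j) 1) =
      ∑ j, ∑ S, A (s j) S * η (fun i => Pi.single (Function.update s j S i) 1) := by
  rw [iota_apply]
  refine Finset.sum_congr rfl fun j _ => ?_
  rw [map_update_eq_sum]
  refine Finset.sum_congr rfl fun S _ => ?_
  have h : endo A (Pi.single (s j) 1) = A (s j) := by
    change Matrix.vecMul (Pi.single (s j) 1) A = _
    exact Matrix.single_one_vecMul _ _
  rw [h]
  congr 2
  funext i
  by_cases hi : i = j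
  · subst hi; simp
  · simp [hi]

theorem eq_vec3 (s : Fin 3 → Fin n) : (fun j => Pi.single (s j) 1 : Fin 3 → Fin n → ℝ) =
    ![Pi.single (s 0) 1, Pi.single (s 1) 1, Pi.single (s 2) 1] := by
  funext j
  fin_cases j <;> rfl

theorem iota_comp3 (A : Matrix (Fin n) (Fin n) ℝ) (a b c : Fin n) (x : Fin n → ℝ) :
    iota (endo A) (C x) (fun j => Pi.single (![a, b, c] j) 1) =
      ∑ S, A a S * comp3 C S b c x + ∑ S, A b S * comp3 C a S c x +
        ∑ S, A c S * comp3 C a b S x := by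
  rw [iota_endo_apply, Fin.sum_univ_three]
  simp only [eq_vec3]
  rfl

/-- `iota` is linear in the endomorphism as well, so the form is a finite sum of the entries of `I`
times fixed continuous linear maps applied to `C`. Differentiability is what permits the expansion
of `d(ι C)` in components. -/
theorem differentiableAt_iota (hU : IsOpen U) (hC : ContDiffOn ℝ (⊤ : ℕ∞) C U)
    (hI : ∀ M K, ContDiffOn ℝ (⊤ : ℕ∞) (fun x => I x M K) U) {x : Fin n → ℝ} (hx : x ∈ U) :
    DifferentiableAt ℝ (fun y => iota (endo (I y)) (C y)) x := by
  have hCx : DifferentiableAt ℝ C x :=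
    (hC.contDiffAt (hU.mem_nhds hx)).differentiableAt (by simp)
  let L (B : (Fin n → ℝ) →L[ℝ] (Fin n → ℝ)) :
      (Fin n → ℝ) [⋀^Fin 3]→L[ℝ] ℝ →L[ℝ] (Fin n → ℝ) [⋀^Fin 3]→L[ℝ] ℝ :=
    { toFun := iota B
      map_add' := fun η η' => by
        ext v
        simp [iota_apply, Finset.sum_add_distrib]
      map_smul' := fun r η => by
        ext v
        simp [iota_apply, Finset.mul_sum]
      cont := by
        rw [ContinuousAlternatingMap.isEmbedding_toContinuousMultilinearMap.continuous_iff]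
        exact continuous_finsetSum Finset.univ fun (j : Fin 3) _ =>
          (ContinuousMultilinearMap.compContinuousLinearMapL (𝕜 := ℝ) (F := ℝ) fun i : Fin 3 =>
            if i = j then B else ContinuousLinearMap.id ℝ (Fin n → ℝ)).continuous.comp
          ContinuousAlternatingMap.continuous_toContinuousMultilinearMap }
  have h : (fun y => iota (endo (I y)) (C y)) =
      fun y => ∑ M, ∑ K, I y M K • L (endo (Matrix.single M K 1)) (C y) := by
    funext y
    ext v
    have h1 : endo (I y) = ∑ M, ∑ K, I y M K • endo (Matrix.single M K 1) := by
      have h2 : I y = ∑ M, ∑ K, I y M K • Matrix.single M K (1 : ℝ) := by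
        conv_lhs => rw [Matrix.matrix_eq_sum_single (I y)]
        simp
      ext1 w
      have h3 (A : Matrix (Fin n) (Fin n) ℝ) : endo A w = Matrix.vecMul w A := rfl
      conv_lhs => rw [h3, h2]
      simp only [_root_.sum_apply, h3, Matrix.vecMul_sum, Matrix.vecMul_smul,
        _root_.smul_apply]
    have h4 (j : Fin 3) : C y (Function.update v j (endo (I y) (v j))) =
        ∑ M, ∑ K, I y M K * C y (Function.update v j (endo (Matrix.single M K 1) (v j))) := by
      rw [h1]
      simp only [_root_.sum_apply]
      refine ((C y).toContinuousMultilinearMap.toMultilinearMap.map_update_sum _ _ _ _).trans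
        (Finset.sum_congr rfl fun M _ => ?_)
      refine ((C y).toContinuousMultilinearMap.toMultilinearMap.map_update_sum _ _ _ _).trans
        (Finset.sum_congr rfl fun K _ => ?_)
      exact (C y).toContinuousMultilinearMap.toMultilinearMap.map_update_smul _ _ _ _
    rw [iota_apply]
    have h5 : (∑ M, ∑ K, I y M K • L (endo (Matrix.single M K 1)) (C y)) v =
        ∑ M, ∑ K, I y M K * iota (endo (Matrix.single M K 1)) (C y) v := by
      change ContinuousAlternatingMap.apply ℝ (Fin n → ℝ) ℝ v _ = _
      simp only [map_sum]
      rfl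
    rw [h5]
    simp only [h4]
    rw [Finset.sum_comm]
    refine Finset.sum_congr rfl fun M _ => ?_
    rw [Finset.sum_comm]
    refine Finset.sum_congr rfl fun K _ => ?_
    rw [← Finset.mul_sum, ← iota_apply]
  rw [h]
  exact DifferentiableAt.fun_sum fun M _ => DifferentiableAt.fun_sum fun K _ =>
    (differentiableAt_of_contDiffOn hU (hI M K) hx).smul
      ((L _).differentiableAt.comp x hCx)

theorem extDeriv_apply_single {ω : (Fin n → ℝ) → (Fin n → ℝ) [⋀^Fin 3]→L[ℝ] ℝ} {x : Fin n → ℝ}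
    (hω : DifferentiableAt ℝ ω x) (s : Fin 4 → Fin n) :
    extDeriv ω x (fun j => Pi.single (s j) 1) =
      pd (s 0) (fun y => ω y (fun j => Pi.single (![s 1, s 2, s 3] j) 1)) x -
      pd (s 1) (fun y => ω y (fun j => Pi.single (![s 0, s 2, s 3] j) 1)) x +
      pd (s 2) (fun y => ω y (fun j => Pi.single (![s 0, s 1, s 3] j) 1)) x -
      pd (s 3) (fun y => ω y (fun j => Pi.single (![s 0, s 1, s 2] j) 1)) x := by
  have e0 : (0 : Fin 4).removeNth (fun j => Pi.single (s j) 1 : Fin 4 → Fin n → ℝ) =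
      fun j => Pi.single (![s 1, s 2, s 3] j) 1 := by
    funext j; fin_cases j <;> rfl
  have e1 : (1 : Fin 4).removeNth (fun j => Pi.single (s j) 1 : Fin 4 → Fin n → ℝ) =
      fun j => Pi.single (![s 0, s 2, s 3] j) 1 := by
    funext j; fin_cases j <;> rfl
  have e2 : (2 : Fin 4).removeNth (fun j => Pi.single (s j) 1 : Fin 4 → Fin n → ℝ) =
      fun j => Pi.single (![s 0, s 1, s 3] j) 1 := by
    funext j; fin_cases j <;> rfl
  have e3 : (3 : Fin 4).removeNth (fun j => Pi.single (s j) 1 : Fin 4 → Fin n → ℝ) =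
      fun j => Pi.single (![s 0, s 1, s 2] j) 1 := by
    funext j; fin_cases j <;> rfl
  rw [extDeriv_apply hω, Fin.sum_univ_four, e0, e1, e2, e3]
  simp only [pd, Fin.val_zero, Fin.val_one, Fin.val_two, pow_zero, pow_one, one_smul, neg_smul]
  norm_num
  ring

theorem contDiffOn_comp3 (hC : ContDiffOn ℝ (⊤ : ℕ∞) C U) (S P M : Fin n) :
    ContDiffOn ℝ (⊤ : ℕ∞) (comp3 C S P M) U :=
  (ContinuousAlternatingMap.apply ℝ (Fin n → ℝ) ℝ
    ![Pi.single S 1, Pi.single P 1, Pi.single M 1]).contDiff.comp_contDiffOn hC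

/-- In components `ι dC` has four terms where `I` meets the derivative index and twelve where it
meets an index of `C`. The form `d(ι C)` has the same twelve and twelve more in which `I` is
differentiated. The antisymmetry of `C` brings these groups into the shapes of `alternate₁` and
`alternate₂`. -/
theorem torsion_identity (hU : IsOpen U) (hC : ContDiffOn ℝ (⊤ : ℕ∞) C U)
    (hI : ∀ M K, ContDiffOn ℝ (⊤ : ℕ∞) (fun x => I x M K) U) {x : Fin n → ℝ} (hx : x ∈ U)
    (h5 : iota (endo (I x)) (extDeriv C x) =
      (2 / 3 : ℝ) • extDeriv (fun y => iota (endo (I y)) (C y)) x) (a b c d : Fin n) :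
    3 * (alternate₁ (fun a b c d => ∑ S, I x a S * pd S (comp3 C b c d) x) a b c d +
        alternate₂ (fun a b c d => ∑ S, I x b S * pd a (comp3 C S c d) x) a b c d) =
      2 * (alternate₂ (fun a b c d => ∑ S, I x b S * pd a (comp3 C S c d) x) a b c d +
        alternate₂ (fun a b c d => ∑ S, comp3 C S c d x * pd a (fun y => I y b S) x)
          a b c d) := by
  have hCx : DifferentiableAt ℝ C x :=
    (hC.contDiffAt (hU.mem_nhds hx)).differentiableAt (by simp)
  have hswap (L S P M) : pd L (comp3 C S P M) x = -pd L (comp3 C S M P) x := by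
    have h : comp3 C S P M = -comp3 C S M P := funext fun y => comp3_swap S P M y
    rw [h, pd, fderiv_neg]
    rfl
  have hrot (L S P M) : pd L (comp3 C S P M) x = pd L (comp3 C M S P) x := by
    have h : comp3 C S P M = comp3 C M S P := funext fun y => comp3_rotate S P M y
    rw [h]
  have h := congrFun (congrArg DFunLike.coe h5) (fun j => Pi.single (![a, b, c, d] j) 1)
  have hcomp (a b c) : (fun y => C y (fun j => Pi.single (![a, b, c] j) 1)) = comp3 C a b c := by
    funext y
    rw [eq_vec3]
    rfl
  -- The transformed index is moved to the first slot of `C`, so that only one pattern of terms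
  -- occurs in the alternating sums.
  have hι (L a b c) : pd L (fun y => iota (endo (I y)) (C y)
      (fun j => Pi.single (![a, b, c] j) 1)) x =
      (∑ S, comp3 C S b c x * pd L (fun y => I y a S) x + ∑ S, I x a S * pd L (comp3 C S b c) x) -
      (∑ S, comp3 C S a c x * pd L (fun y => I y b S) x + ∑ S, I x b S * pd L (comp3 C S a c) x) +
      (∑ S, comp3 C S a b x * pd L (fun y => I y c S) x +
        ∑ S, I x c S * pd L (comp3 C S a b) x) := by
    simp only [iota_comp3]
    have hI' (u v) := differentiableAt_of_contDiffOn hU (hI u v) hx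
    have hC' (u v w) := differentiableAt_of_contDiffOn hU (contDiffOn_comp3 hC u v w) hx
    have hd (u : Fin n) (T : Fin n → (Fin n → ℝ) → ℝ) (hT : ∀ S, DifferentiableAt ℝ (T S) x) :
        DifferentiableAt ℝ (fun y => ∑ S, I y u S * T S y) x ∧
        pd L (fun y => ∑ S, I y u S * T S y) x =
          ∑ S, T S x * pd L (fun y => I y u S) x + ∑ S, I x u S * pd L (T S) x := by
      refine ⟨DifferentiableAt.fun_sum fun S _ => (hI' u S).fun_mul (hT S), ?_⟩
      rw [pd_fun_sum (fun S _ => (hI' u S).fun_mul (hT S)), ← Finset.sum_add_distrib]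
      refine Finset.sum_congr rfl fun S _ => ?_
      rw [pd_fun_mul (hI' u S) (hT S)]
      ring
    have d1 := hd a (fun S => comp3 C S b c) fun S => hC' S b c
    have d2 := hd b (fun S => comp3 C a S c) fun S => hC' a S c
    have d3 := hd c (fun S => comp3 C a b S) fun S => hC' a b S
    have e : pd L (fun y => ∑ S, I y a S * comp3 C S b c y + ∑ S, I y b S * comp3 C a S c y +
        ∑ S, I y c S * comp3 C a b S y) x = pd L (fun y => ∑ S, I y a S * comp3 C S b c y) x +
        pd L (fun y => ∑ S, I y b S * comp3 C a S c y) x +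
        pd L (fun y => ∑ S, I y c S * comp3 C a b S y) x := by
      rw [pd, fderiv_fun_add (d1.1.fun_add d2.1) d3.1, fderiv_fun_add d1.1 d2.1]
      rfl
    rw [e, d1.2, d2.2, d3.2]
    have e2 (S) : comp3 C a S c x = -comp3 C S a c x := by
      rw [comp3_rotate, comp3_swap, comp3_rotate, comp3_rotate]
    have e3 (S) : pd L (comp3 C a S c) x = -pd L (comp3 C S a c) x := by
      rw [hrot, hswap, hrot, hrot]
    have e4 (S) : comp3 C a b S x = comp3 C S a b x := comp3_rotate _ _ _ _
    have e5 (S) : pd L (comp3 C a b S) x = pd L (comp3 C S a b) x := hrot _ _ _ _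
    simp only [e2, e3, e4, e5, neg_mul, mul_neg, Finset.sum_neg_distrib]
    ring
  have h6 : iota (endo (I x)) (extDeriv C x) (fun j => Pi.single (![a, b, c, d] j) 1) =
      2 / 3 * extDeriv (fun y => iota (endo (I y)) (C y)) x
        (fun j => Pi.single (![a, b, c, d] j) 1) := h
  rw [iota_endo_apply, extDeriv_apply_single (differentiableAt_iota hU hC hI hx)] at h6
  have h7 := (Fin.sum_univ_four (fun j => ∑ S, I x (![a, b, c, d] j) S * extDeriv C x
    (fun i => Pi.single (Function.update ![a, b, c, d] j S i) 1))).symm.trans h6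
  simp only [extDeriv_apply_single hCx, hcomp, hι] at h7
  have u0 (S) : Function.update ![a, b, c, d] 0 S = ![S, b, c, d] := by
    funext i; fin_cases i <;> rfl
  have u1 (S) : Function.update ![a, b, c, d] 1 S = ![a, S, c, d] := by
    funext i; fin_cases i <;> rfl
  have u2 (S) : Function.update ![a, b, c, d] 2 S = ![a, b, S, d] := by
    funext i; fin_cases i <;> rfl
  have u3 (S) : Function.update ![a, b, c, d] 3 S = ![a, b, c, S] := by
    funext i; fin_cases i <;> rfl
  simp only [u0, u1, u2, u3, Matrix.cons_val, mul_add, mul_sub, Finset.sum_add_distrib,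
    Finset.sum_sub_distrib] at h7
  have e3 (L u v S) : pd L (comp3 C u S v) x = -pd L (comp3 C S u v) x := by
    rw [hrot, hswap, hrot, hrot]
  have r1 (L w u v) : ∑ S, I x w S * pd L (comp3 C u S v) x =
      -∑ S, I x w S * pd L (comp3 C S u v) x := by
    simp only [e3 L u v, mul_neg, Finset.sum_neg_distrib]
  have r2 (L w u v) : ∑ S, I x w S * pd L (comp3 C u v S) x =
      ∑ S, I x w S * pd L (comp3 C S u v) x := by
    simp only [hrot L u v]
  simp only [alternate₁, alternate₂]
  simp only [r1, r2] at h7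
  linarith

end

end SuperSigma

namespace SuperSigma

variable {N n : ℕ} {U : Set (Fin n → ℝ)} {X : Fin n → SFun N} {ε ε₁ ε₂ : Grass N}

/-! ### Algebra of smooth target functions -/

theorem TargetFun.val_sum {ι : Type*} (s : Finset ι) (f : ι → TargetFun U) (x : Fin n → ℝ) :
    (∑ i ∈ s, f i).val x = ∑ i ∈ s, (f i).val x := by
  classical
  induction s using Finset.induction_on with
  | empty => rfl
  | insert a s ha ih => rw [Finset.sum_insert ha, Finset.sum_insert ha, ← ih]; rfl

theorem TargetFun.val_add (f h : TargetFun U) (x : Fin n → ℝ) :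
    (f + h).val x = f.val x + h.val x := rfl

theorem TargetFun.val_sub (f h : TargetFun U) (x : Fin n → ℝ) :
    (f - h).val x = f.val x - h.val x := rfl

theorem TargetFun.val_mul (f h : TargetFun U) (x : Fin n → ℝ) :
    (f * h).val x = f.val x * h.val x := rfl

theorem TargetFun.val_neg (f : TargetFun U) (x : Fin n → ℝ) : (-f).val x = -f.val x := rfl

/-! ### Velocities of a superfield -/

/-- The time derivative `Ẋ^M`. -/
def IsSuperfield.vel (hX : IsSuperfield U X) (M : Fin n) : EvenFun N :=
  .mk (ddt (hX.fieldFun M)) (ddt_mem_evenAlg (hX.fieldFun_mem M))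

/-- The covariant derivative `D X^M`. -/
def IsSuperfield.covVel (hX : IsSuperfield U X) (M : Fin n) : SmoothFun N :=
  superDeriv (-Complex.I) (hX.fieldFun M)

theorem IsSuperfield.val_vel (hX : IsSuperfield U X) (M : Fin n) :
    (hX.vel M).val = ddt (hX.fieldFun M) := rfl

theorem IsSuperfield.oddFun_covVel (hX : IsSuperfield U X) (M : Fin n) : OddFun (hX.covVel M) :=
  .superDeriv (hX.fieldFun_mem M) _

theorem IsSuperfield.covVel_anticomm (hX : IsSuperfield U X) (M K : Fin n) :
    hX.covVel M * hX.covVel K = -(hX.covVel K * hX.covVel M) :=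
  (hX.oddFun_covVel M).mul_comm (hX.oddFun_covVel K)

theorem superDeriv_sq (c : ℂ) (F : SmoothFun N) : superDeriv c (superDeriv c F) = c • ddt F := by
  rw [superDeriv_superDeriv, sub_self, zero_smul, add_zero]

theorem superDeriv_neg_anticomm (c : ℂ) (F : SmoothFun N) :
    superDeriv (-c) (superDeriv c F) = -superDeriv c (superDeriv (-c) F) := by
  rw [superDeriv_superDeriv, superDeriv_superDeriv]
  module

theorem IsSuperfield.superDeriv_covVel (hX : IsSuperfield U X) (M : Fin n) :
    superDeriv (-Complex.I) (hX.covVel M) = -Complex.I • (hX.vel M).val := superDeriv_sq _ _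

theorem oddFun_rot {ξ : Fin n → SmoothFun N} (hξ : ∀ M, OddFun (ξ M))
    (J : Fin n → Fin n → EvenFun N) (M : Fin n) : OddFun (rot ξ J M) :=
  .sum fun K _ => .smul _ (hξ K)

/-- The chain rule on the coefficients gives the part quadratic in `DX`, and `D² = -i ∂_t` gives the
part with the velocity. -/
theorem IsSuperfield.superDeriv_rot (hU : IsOpen U) (hX : IsSuperfield U X)
    (J : Fin n → Fin n → TargetFun U) (M : Fin n) :
    superDeriv (-Complex.I) (rot hX.covVel (fun K M => hX.eval hU (J K M)) M) =
      rotCov hX.vel hX.covVel (fun K M => hX.eval hU (J K M))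
        (fun L K M => hX.eval hU ((J K M).pd hU L)) M := by
  rw [rot, map_sum, rotCov, rotQuad, Finset.sum_smul, Finset.smul_sum, ← Finset.sum_sub_distrib]
  refine Finset.sum_congr rfl fun K _ => ?_
  have h : (hX.eval hU (J K M) * hX.vel K) • (1 : SmoothFun N) =
      hX.eval hU (J K M) • (hX.vel K).val := by
    rw [mul_smul, even_smul_def (hX.vel K), mul_one]
  rw [superDeriv_smul, hX.superDeriv_covVel, hX.superDeriv_eval hU, sub_eq_add_neg, h,
    smul_comm _ (-Complex.I), ← neg_smul]
  rfl

theorem IsSuperfield.ddt_rot (hU : IsOpen U) (hX : IsSuperfield U X)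
    (J : Fin n → Fin n → TargetFun U) (M : Fin n) :
    ddt (rot hX.covVel (fun K M => hX.eval hU (J K M)) M) =
      rotDot hX.vel hX.covVel (fun K => ddt (hX.covVel K)) (fun K M => hX.eval hU (J K M))
        (fun L K M => hX.eval hU ((J K M).pd hU L)) M := by
  rw [rot, map_sum, rotDot]
  refine Finset.sum_congr rfl fun K _ => ?_
  rw [even_smul_def, ddt_mul, hX.ddt_eval hU, Finset.sum_smul, Finset.sum_mul]
  congr 1

/-! ### First-order variations -/

theorem oddFun_constFun (hε : parity ε = -ε) : OddFun (constFun ε) :=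
  SmoothFun.ext fun _ => hε

theorem constFun_mul_mul_constFun (hε : parity ε = -ε) (F : SmoothFun N) :
    constFun ε * F * constFun ε = 0 := by
  refine SmoothFun.ext fun t => ?_
  change ε * F.val t * ε = 0
  rw [mul_assoc, mul_eq_mul_parity hε, ← mul_assoc, mul_self_of_parity_eq_neg hε, zero_mul]

variable {W : Fin n → SmoothFun N}

theorem IsSuperfield.covVel_vary (hX : IsSuperfield U X) (hε : parity ε = -ε) (hdε : dTheta ε = 0)
    (hW : ∀ M, OddFun (W M)) (M : Fin n) : (hX.vary hε hW).covVel M =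
      hX.covVel M - constFun ε * superDeriv (-Complex.I) (W M) := by
  rw [covVel, hX.fieldFun_vary hε hW, map_add, superDeriv_odd_mul _ (oddFun_constFun hε),
    superDeriv_constFun hdε, zero_mul, zero_sub, ← sub_eq_add_neg]
  rfl

theorem IsSuperfield.val_vel_vary (hX : IsSuperfield U X) (hε : parity ε = -ε)
    (hW : ∀ M, OddFun (W M)) (M : Fin n) : ((hX.vary hε hW).vel M).val =
      (hX.vel M).val + constFun ε * ddt (W M) := by
  rw [val_vel, hX.fieldFun_vary hε hW, map_add, ddt_mul, ddt_constFun, zero_mul, zero_add]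
  rfl

/-- The product of the two first-order changes contains `ε` twice and drops out. The minus sign
comes from `D` passing the odd `ε`. -/
theorem IsSuperfield.rot_vary (hU : IsOpen U) (hX : IsSuperfield U X) (hε : parity ε = -ε)
    (hdε : dTheta ε = 0) (hW : ∀ M, OddFun (W M)) (J : Fin n → Fin n → TargetFun U) (M : Fin n) :
    rot (hX.vary hε hW).covVel (fun K M => (hX.vary hε hW).eval hU (J K M)) M =
      rot hX.covVel (fun K M => hX.eval hU (J K M)) M + constFun ε *
        ∑ K, ((∑ L, hX.eval hU ((J K M).pd hU L) • W L) * hX.covVel K -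
          hX.eval hU (J K M) • superDeriv (-Complex.I) (W K)) := by
  rw [rot, rot, Finset.mul_sum, ← Finset.sum_add_distrib]
  refine Finset.sum_congr rfl fun K _ => ?_
  rw [even_smul_def, hX.eval_vary hU hε hW, hX.covVel_vary hε hdε hW, even_smul_def, even_smul_def]
  generalize ∑ L, hX.eval hU ((J K M).pd hU L) • W L = A
  have h1 := constFun_mul_mul_constFun hε A
  have h2 := commute_of_mem_evenAlg (hX.eval hU (J K M)).prop (constFun ε)
  rw [add_mul, mul_sub, mul_sub, ← mul_assoc (constFun ε * A), h1, zero_mul, sub_zero, mul_sub,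
    ← mul_assoc _ (constFun ε), h2]
  noncomm_ring

/-! ### The supersymmetry algebra -/

theorem manifestSusy_eq (hX : IsSuperfield U X) :
    manifestSusy ε X = fun M t => X M t + ε * (superDeriv Complex.I (hX.fieldFun M)).val t := rfl

theorem IsSuperfield.rot_apply (hU : IsOpen U) (hX : IsSuperfield U X)
    (J : Fin n → Fin n → TargetFun U) (M : Fin n) (t : ℝ) :
    (rot hX.covVel (fun K M => hX.eval hU (J K M)) M).val t =
      ∑ K, superEval (J K M).val X t * covD (X K) t := by
  rw [rot, SmoothFun.sum_apply]
  refine Finset.sum_congr rfl fun K _ => ?_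
  rw [← hX.coe_eval hU]
  have h : (hX.covVel K).val = covD (X K) := coe_superDeriv_neg_I _
  rw [← h]
  rfl

variable {I : (Fin n → ℝ) → Matrix (Fin n) (Fin n) ℝ}

/-- The components of a matrix of smooth functions as target functions. -/
def matFun (hI : ∀ M K, ContDiffOn ℝ (⊤ : ℕ∞) (fun x => I x M K) U) (M K : Fin n) : TargetFun U :=
  .mk (fun x => I x M K) (hI M K)

/-- The odd vector field `I_K^M DX^K` on a superfield. -/
def IsSuperfield.extra (hU : IsOpen U) (hX : IsSuperfield U X)
    (hI : ∀ M K, ContDiffOn ℝ (⊤ : ℕ∞) (fun x => I x M K) U) (M : Fin n) : SmoothFun N :=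
  rot hX.covVel (fun K M => hX.eval hU (matFun hI K M)) M

theorem IsSuperfield.oddFun_extra (hU : IsOpen U) (hX : IsSuperfield U X)
    (hI : ∀ M K, ContDiffOn ℝ (⊤ : ℕ∞) (fun x => I x M K) U) (M : Fin n) :
    OddFun (hX.extra hU hI M) := oddFun_rot hX.oddFun_covVel _ M

theorem IsSuperfield.extraVar_eq (hU : IsOpen U) (hX : IsSuperfield U X)
    (hI : ∀ M K, ContDiffOn ℝ (⊤ : ℕ∞) (fun x => I x M K) U) :
    extraVar I ε X = fun M t => ε * (hX.extra hU hI M).val t := by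
  funext M t
  rw [extra, hX.rot_apply hU]
  rfl

theorem IsSuperfield.extraSusy_eq (hU : IsOpen U) (hX : IsSuperfield U X)
    (hI : ∀ M K, ContDiffOn ℝ (⊤ : ℕ∞) (fun x => I x M K) U) :
    extraSusy I ε X = fun M t => X M t + ε * (hX.extra hU hI M).val t := by
  funext M t
  rw [extraSusy, hX.extraVar_eq hU hI]

/-- The first-order change of `I_K^M DX^K` under `X ↦ X + ε W`. -/
def IsSuperfield.extraChange (hU : IsOpen U) (hX : IsSuperfield U X)
    (hI : ∀ M K, ContDiffOn ℝ (⊤ : ℕ∞) (fun x => I x M K) U) (W : Fin n → SmoothFun N)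
    (M : Fin n) : SmoothFun N :=
  ∑ K, ((∑ L, hX.eval hU ((matFun hI K M).pd hU L) • W L) * hX.covVel K -
    hX.eval hU (matFun hI K M) • superDeriv (-Complex.I) (W K))

theorem IsSuperfield.extraSusy_vary (hU : IsOpen U) (hX : IsSuperfield U X)
    (hI : ∀ M K, ContDiffOn ℝ (⊤ : ℕ∞) (fun x => I x M K) U)
    (hε₁ : parity ε₁ = -ε₁) (hdε₁ : dTheta ε₁ = 0) (hW : ∀ M, OddFun (W M)) (M : Fin n) (t : ℝ) :
    extraSusy I ε₂ (fun M t => X M t + ε₁ * (W M).val t) M t =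
      X M t + ε₁ * (W M).val t +
        ε₂ * ((hX.extra hU hI M).val t + ε₁ * (hX.extraChange hU hI W M).val t) := by
  have h := congrFun (congrArg SmoothFun.val
    (hX.rot_vary hU hε₁ hdε₁ hW (fun K M => matFun hI K M) M)) t
  rw [(hX.vary hε₁ hW).extraSusy_eq hU hI]
  exact congrArg (fun z => X M t + ε₁ * (W M).val t + ε₂ * z) h

/-- Only the terms with both parameters survive. In each order `Q² = i ∂_t` yields `-i ε' ε Ẋ`, and
anticommutation of the parameters doubles it in the difference. -/
theorem commutator_manifest (hX : IsSuperfield U X) (h₁ : IsOddParameter ε₁)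
    (h₂ : IsOddParameter ε₂) (M : Fin n) (t : ℝ) :
    commutator (manifestSusy ε₁) (manifestSusy ε₂) X M t =
      -(2 * Complex.I) • (ε₁ * ε₂ * timeDeriv (X M) t) := by
  have h (ε ε' : Grass N) (hε : IsOddParameter ε) :
      manifestSusy ε' (manifestSusy ε X) M t = X M t + ε * genQ (X M) t +
        ε' * (genQ (X M) t - ε * (Complex.I • timeDeriv (X M) t)) := by
    have e : superDeriv Complex.I (hX.fieldFun M + constFun ε * superDeriv Complex.I (hX.fieldFun M)) =
        superDeriv Complex.I (hX.fieldFun M) - constFun ε * (Complex.I • ddt (hX.fieldFun M)) := by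
      rw [map_add, superDeriv_odd_mul _ (oddFun_constFun hε.1.parity_eq),
        superDeriv_constFun hε.2, zero_mul, zero_sub, superDeriv_sq, ← sub_eq_add_neg]
    have e2 := congrFun (congrArg SmoothFun.val e) t
    exact congrArg (fun z => X M t + ε * genQ (X M) t + ε' * z) e2
  rw [commutator, h ε₂ ε₁ h₂, h ε₁ ε₂ h₁]
  have e := mul_anticomm_of_parity_eq_neg h₁.1.parity_eq h₂.1.parity_eq
  simp only [mul_sub, ← mul_assoc, e, mul_smul_comm, neg_mul, smul_neg]
  module

/-- The field `I DX` is built from `X` with `D`, which anticommutes with `Q`. Its change under `δX =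
ε Q X` is therefore `ε Q(I DX)`, and the two orders give opposite products of parameters, which
cancel. -/
theorem commutator_manifest_extra (hU : IsOpen U) (hX : IsSuperfield U X)
    (hI : ∀ M K, ContDiffOn ℝ (⊤ : ℕ∞) (fun x => I x M K) U) (h₁ : IsOddParameter ε₁)
    (h₂ : IsOddParameter ε₂) (M : Fin n) (t : ℝ) :
    commutator (manifestSusy ε₁) (extraSusy I ε₂) X M t = 0 := by
  have hW (M) : OddFun (superDeriv Complex.I (hX.fieldFun M)) := .superDeriv (hX.fieldFun_mem M) _
  have e1 : manifestSusy ε₁ (extraSusy I ε₂ X) M t = X M t + ε₂ * (hX.extra hU hI M).val t +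
      ε₁ * (genQ (X M) t - ε₂ * (superDeriv Complex.I (hX.extra hU hI M)).val t) := by
    rw [hX.extraSusy_eq hU hI]
    have e : superDeriv Complex.I (hX.fieldFun M + constFun ε₂ * hX.extra hU hI M) =
        superDeriv Complex.I (hX.fieldFun M) -
          constFun ε₂ * superDeriv Complex.I (hX.extra hU hI M) := by
      rw [map_add, superDeriv_odd_mul _ (oddFun_constFun h₂.1.parity_eq),
        superDeriv_constFun h₂.2, zero_mul, zero_sub, ← sub_eq_add_neg]
    have e2 := congrFun (congrArg SmoothFun.val e) t
    exact congrArg (fun z => X M t + ε₂ * (hX.extra hU hI M).val t + ε₁ * z) e2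
  have e2 := hX.extraSusy_vary hU hI (ε₂ := ε₂) h₁.1.parity_eq h₁.2 hW M t
  have e3 : hX.extraChange hU hI (fun M => superDeriv Complex.I (hX.fieldFun M)) M =
      superDeriv Complex.I (hX.extra hU hI M) := by
    rw [IsSuperfield.extraChange, IsSuperfield.extra, rot, map_sum]
    refine Finset.sum_congr rfl fun K _ => ?_
    rw [superDeriv_smul, hX.superDeriv_eval hU, superDeriv_neg_anticomm, smul_neg, sub_neg_eq_add]
    rfl
  rw [commutator, e1, manifestSusy_eq hX, e2, e3]
  have e := mul_anticomm_of_parity_eq_neg h₁.1.parity_eq h₂.1.parity_eq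
  simp only [mul_sub, mul_add, ← mul_assoc, e, neg_mul]
  have e4 : (superDeriv Complex.I (hX.fieldFun M)).val t = genQ (X M) t := rfl
  rw [e4]
  abel

/-- Contracting condition 2 with a further `I` collapses one pair `I I` to `-1` (`hN`). The
derivative of `I² = -1` (`hd`) then trades the derivatives of the first factor for derivatives of
the second. This is the form in which integrability meets the product `DX^L DX^R`. -/
theorem nijenhuis_contracted (hU : IsOpen U)
    (hI : ∀ M K, ContDiffOn ℝ (⊤ : ℕ∞) (fun x => I x M K) U) (h1 : ∀ x ∈ U, I x * I x = -1)
    (h2 : IsIntegrableOn I U) {x : Fin n → ℝ} (hx : x ∈ U) (L R M : Fin n) :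
    ∑ S, I x L S * pd S (fun y => I y R M) x - ∑ S, I x R S * pd S (fun y => I y L M) x =
      ∑ S, I x S M * pd L (fun y => I y R S) x - ∑ S, I x S M * pd R (fun y => I y L S) x := by
  have hI' (M K) := differentiableAt_of_contDiffOn hU (hI M K) hx
  have hsq (a b) : ∑ S, I x a S * I x S b = if a = b then -1 else 0 := by
    have := congrFun (congrFun (h1 x hx) a) b
    rw [Matrix.mul_apply] at this
    rw [this, Matrix.neg_apply, Matrix.one_apply]
    split <;> simp
  have hd (R L) : ∑ S, pd R (fun y => I y L S) x * I x S M +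
      ∑ S, I x L S * pd R (fun y => I y S M) x = 0 := by
    have e : pd R (fun y => ∑ S, I y L S * I y S M) x = 0 := by
      rw [pd_congr hU (h := fun _ => (-1 : Matrix (Fin n) (Fin n) ℝ) L M) (fun y hy => by
        rw [← Matrix.mul_apply, h1 y hy]) R hx]
      simp [pd]
    rw [pd_fun_sum (f := fun S y => I y L S * I y S M)
      (fun S _ => (hI' L S).fun_mul (hI' S M))] at e
    rw [← e, ← Finset.sum_add_distrib]
    exact Finset.sum_congr rfl fun S _ => (pd_fun_mul (hI' L S) (hI' S M) R).symm
  have hN : ∑ S, I x L S * (pd S (fun y => I y R M) x - pd R (fun y => I y S M) x) =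
      ∑ S, I x R S * (pd S (fun y => I y L M) x - pd L (fun y => I y S M) x) := by
    have e : ∑ S, I x L S * (pd S (fun y => I y R M) x - pd R (fun y => I y S M) x) =
        ∑ Q, (∑ S, I x L S * I x S Q) * ∑ T, I x R T *
          (pd Q (fun y => I y T M) x - pd T (fun y => I y Q M) x) := by
      simp only [h2 x hx _ R M, Finset.mul_sum, Finset.sum_mul]
      rw [Finset.sum_comm]
      refine Finset.sum_congr rfl fun Q _ => ?_
      rw [Finset.sum_comm]
      exact Finset.sum_congr rfl fun S _ => Finset.sum_congr rfl fun T _ => by ring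
    rw [e]
    simp only [hsq, ite_mul, zero_mul, Finset.sum_ite_eq, Finset.mem_univ, if_true,
      neg_one_mul]
    rw [← Finset.sum_neg_distrib]
    exact Finset.sum_congr rfl fun S _ => by ring
  simp only [mul_sub, Finset.sum_sub_distrib] at hN
  have e1 := hd R L
  have e2 := hd L R
  simp only [mul_comm _ (I x _ M)] at e1 e2
  linarith

theorem IsSuperfield.sum_matFun_mul (hU : IsOpen U) (hX : IsSuperfield U X)
    (hI : ∀ M K, ContDiffOn ℝ (⊤ : ℕ∞) (fun x => I x M K) U) (h1 : ∀ x ∈ U, I x * I x = -1)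
    (M K : Fin n) : ∑ S, hX.eval hU (matFun hI M S) * hX.eval hU (matFun hI S K) =
      if M = K then -1 else 0 := by
  have h := hX.eval_congr hU (f := ∑ S, matFun hI M S * matFun hI S K)
    (h := if M = K then -1 else 0) (fun x hx => by
      rw [TargetFun.val_sum]
      have := congrFun (congrFun (h1 x hx) M) K
      rw [Matrix.mul_apply, Matrix.neg_apply, Matrix.one_apply] at this
      refine Eq.trans this ?_
      split
      · rfl
      · exact neg_zero)
  rw [map_sum] at h
  simp only [map_mul] at h
  rw [h]
  split <;> simp

theorem sum_smul_mul_eq_zero {R A : Type*} [CommRing R] [Ring A] [Algebra R A] [Algebra ℂ A]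
    {ξ : Fin n → A} (hξ : ∀ a b, ξ a * ξ b = -(ξ b * ξ a)) {f : Fin n → Fin n → R}
    (hf : ∀ a b, f a b = f b a) : ∑ a, ∑ b, f a b • (ξ a * ξ b) = 0 := by
  refine eq_zero_of_add_self ?_
  nth_rewrite 1 [Finset.sum_comm]
  simp only [← Finset.sum_add_distrib]
  refine Finset.sum_eq_zero fun a _ => Finset.sum_eq_zero fun b _ => ?_
  rw [hf b a, hξ b a, smul_neg, neg_add_cancel]

/-- The coefficient of the part quadratic in `DX` is symmetric by `nijenhuis_contracted`, so it
vanishes against the anticommuting factors. What remains is `i I² Ẋ = -i Ẋ`, the same as for the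
square of `D`. -/
theorem IsSuperfield.extraChange_extra (hU : IsOpen U) (hX : IsSuperfield U X)
    (hI : ∀ M K, ContDiffOn ℝ (⊤ : ℕ∞) (fun x => I x M K) U) (h1 : ∀ x ∈ U, I x * I x = -1)
    (h2 : IsIntegrableOn I U) (M : Fin n) :
    hX.extraChange hU hI (hX.extra hU hI) M = -Complex.I • (hX.vel M).val := by
  have hY (K) : superDeriv (-Complex.I) (hX.extra hU hI K) = _ := hX.superDeriv_rot hU _ K
  set J : Fin n → Fin n → EvenFun N := fun K M => hX.eval hU (matFun hI K M) 
  set dJ : Fin n → Fin n → Fin n → EvenFun N :=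
    fun L K M => hX.eval hU ((matFun hI K M).pd hU L) 
  have hNij (L R) : ∑ S, J L S * dJ S R M - ∑ S, J R S * dJ S L M =
      ∑ S, J S M * dJ L R S - ∑ S, J S M * dJ R L S := by
    have h := hX.eval_congr hU
      (f := ∑ S, matFun hI L S * (matFun hI R M).pd hU S -
        ∑ S, matFun hI R S * (matFun hI L M).pd hU S)
      (h := ∑ S, matFun hI S M * (matFun hI R S).pd hU L -
        ∑ S, matFun hI S M * (matFun hI L S).pd hU R) (fun x hx => by
      simp only [TargetFun.val_sub, TargetFun.val_sum, TargetFun.val_mul]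
      exact nijenhuis_contracted hU hI h1 h2 hx L R M)
    simpa only [map_sub, map_sum, map_mul] using h
  have hquad : ∑ L, ∑ R, (∑ S, J L S * dJ S R M - ∑ S, J S M * dJ L R S) •
      (hX.covVel L * hX.covVel R) = 0 :=
    sum_smul_mul_eq_zero hX.covVel_anticomm fun L R => by linear_combination hNij L R
  have e1 : ∑ K, (∑ L, dJ L K M • rot hX.covVel J L) * hX.covVel K =
      ∑ L, ∑ R, (∑ S, J L S * dJ S R M) • (hX.covVel L * hX.covVel R) := by
    rw [Finset.sum_comm]
    refine Finset.sum_congr rfl fun K _ => ?_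
    rw [sum_smul_rot, Finset.sum_mul]
    simp only [smul_mul_assoc]
  have e2 : ∑ K, J K M • rotQuad hX.covVel dJ K =
      ∑ L, ∑ R, (∑ S, J S M * dJ L R S) • (hX.covVel L * hX.covVel R) := by
    simp only [rotQuad, Finset.sum_mul, Finset.smul_sum, Finset.sum_smul, smul_mul_assoc,
      mul_smul]
    rw [Finset.sum_comm]
    conv_rhs => rw [Finset.sum_comm]
    refine Finset.sum_congr rfl fun R _ => ?_
    rw [Finset.sum_comm]
  have e3 : ∑ K, J K M • (∑ L, J L K * hX.vel L) • (1 : SmoothFun N) = (-hX.vel M).val := by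
    have h : ∑ K, J K M * ∑ L, J L K * hX.vel L = -hX.vel M := by
      have h : ∑ K, J K M * ∑ L, J L K * hX.vel L =
          ∑ L, (∑ K, J L K * J K M) * hX.vel L := by
        simp only [Finset.mul_sum, Finset.sum_mul]
        rw [Finset.sum_comm]
        exact Finset.sum_congr rfl fun L _ => Finset.sum_congr rfl fun K _ => by ring
      rw [h]
      have hJJ (L) : ∑ K, J L K * J K M = if L = M then -1 else 0 :=
        hX.sum_matFun_mul hU hI h1 L M
      simp only [hJJ, ite_mul, zero_mul, Finset.sum_ite_eq',
        Finset.mem_univ, if_true, neg_one_mul]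
    have h' : ∑ K, J K M • (∑ L, J L K * hX.vel L) • (1 : SmoothFun N) =
        ∑ K, (J K M * ∑ L, J L K * hX.vel L) • (1 : SmoothFun N) :=
      Finset.sum_congr rfl fun K _ => (mul_smul _ _ _).symm
    rw [h', ← Finset.sum_smul, h, even_smul_def, mul_one]
  rw [extraChange]
  simp only [hY, rotCov, Finset.sum_sub_distrib, smul_sub]
  change ∑ K, (∑ L, dJ L K M • rot hX.covVel J L) * hX.covVel K -
    (∑ K, J K M • rotQuad hX.covVel dJ K - ∑ K, J K M • Complex.I • _) = _
  simp only [smul_comm _ Complex.I, ← Finset.smul_sum]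
  rw [e1, e2, e3]
  change _ - (_ - Complex.I • -(hX.vel M).val) = _
  simp only [sub_smul, Finset.sum_sub_distrib] at hquad
  linear_combination (norm := module) hquad

theorem commutator_extra (hU : IsOpen U) (hX : IsSuperfield U X)
    (hI : ∀ M K, ContDiffOn ℝ (⊤ : ℕ∞) (fun x => I x M K) U) (h1 : ∀ x ∈ U, I x * I x = -1)
    (h2 : IsIntegrableOn I U) (hε₁ : IsOddParameter ε₁) (hε₂ : IsOddParameter ε₂)
    (M : Fin n) (t : ℝ) : commutator (extraSusy I ε₁) (extraSusy I ε₂) X M t =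
      -(2 * Complex.I) • (ε₁ * ε₂ * timeDeriv (X M) t) := by
  have hW := hX.oddFun_extra hU hI
  have e (ε ε' : Grass N) (hε : IsOddParameter ε) :
      extraSusy I ε' (extraSusy I ε X) M t = X M t + ε * (hX.extra hU hI M).val t +
        ε' * ((hX.extra hU hI M).val t - ε * (Complex.I • timeDeriv (X M) t)) := by
    rw [hX.extraSusy_eq hU hI, hX.extraSusy_vary hU hI hε.1.parity_eq hε.2 hW,
      hX.extraChange_extra hU hI h1 h2]
    have e2 : (-Complex.I • (hX.vel M).val).val t = -(Complex.I • timeDeriv (X M) t) := by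
      rw [← neg_smul]; rfl
    rw [e2, mul_neg, ← sub_eq_add_neg]
  rw [commutator, e ε₂ ε₁ hε₂, e ε₁ ε₂ hε₁]
  have e := mul_anticomm_of_parity_eq_neg hε₁.1.parity_eq hε₂.1.parity_eq
  simp only [mul_sub, ← mul_assoc, e, mul_smul_comm, neg_mul, smul_neg]
  module

end SuperSigma

namespace SuperSigma

variable {N n : ℕ} {U : Set (Fin n → ℝ)} {X : Fin n → SFun N} {ε : Grass N}
  {W : Fin n → SmoothFun N}

/-! ### Variation of the Lagrangian -/

/-- The superspace Lagrangian as a smooth function. -/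
def IsSuperfield.lagrangian (hU : IsOpen U) (hX : IsSuperfield U X)
    (G : Fin n → Fin n → TargetFun U) (C : Fin n → Fin n → Fin n → TargetFun U) : SmoothFun N :=
  (Complex.I / 2) • (∑ M, ∑ K, hX.eval hU (G M K) • (hX.vel M).val * hX.covVel K) -
    (1 / 12 : ℂ) • (∑ S, ∑ P, ∑ M,
      hX.eval hU (C S P M) • (hX.covVel S * hX.covVel P * hX.covVel M))

theorem mul_constFun (hε : parity ε = -ε) (F : SmoothFun N) :
    F * constFun ε = constFun ε * parityFun F :=
  SmoothFun.ext fun t => mul_eq_mul_parity hε (F.val t)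

/-- Moving `ε` to the front past `F` replaces `F` by its parity, and the product of both increments
contains `ε` twice. -/
theorem first_order_mul (hε : parity ε = -ε) (F F' H H' : SmoothFun N) :
    (F + constFun ε * F') * (H + constFun ε * H') =
      F * H + constFun ε * (F' * H + parityFun F * H') := by
  have h1 : F * (constFun ε * H') = constFun ε * (parityFun F * H') := by
    rw [← mul_assoc, mul_constFun hε, mul_assoc]
  have h2 : constFun ε * F' * (constFun ε * H') = 0 := by
    rw [← mul_assoc, constFun_mul_mul_constFun hε, zero_mul]
  rw [add_mul, mul_add, mul_add, h1, h2, mul_add, mul_assoc]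
  abel

theorem EvenFun.parityFun_val (F : EvenFun N) : parityFun F.val = F.val := mem_evenAlg.1 F.prop

/-- Varying each of the three factors `DX` in the torsion term gives the same sum after relabelling,
because the signs of the relabelling and of `C` agree. -/
theorem sum_antisymm_mul {ξ η : Fin n → SmoothFun N} {C : Fin n → Fin n → Fin n → EvenFun N}
    (hC : ∀ S P M, C S P M = -C S M P) (hC' : ∀ S P M, C S P M = C M S P) :
    ∑ S, ∑ P, ∑ M, (C S P M • (η S * (ξ P * ξ M)) - C S P M • (η P * (ξ S * ξ M)) +
        C S P M • (η M * (ξ S * ξ P))) =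
      (3 : ℂ) • ∑ S, ∑ P, ∑ M, C S P M • (η S * (ξ P * ξ M)) := by
  have h1 : ∑ S, ∑ P, ∑ M, C S P M • (η P * (ξ S * ξ M)) =
      -∑ S, ∑ P, ∑ M, C S P M • (η S * (ξ P * ξ M)) := by
    rw [Finset.sum_comm]
    simp only [← Finset.sum_neg_distrib]
    refine Finset.sum_congr rfl fun S _ => Finset.sum_congr rfl fun P _ =>
      Finset.sum_congr rfl fun M _ => ?_
    have h : C P S M = -C S P M := by rw [hC' P S M, hC M P S, ← hC' S P M]
    rw [h, neg_smul]
  have h2 : ∑ S, ∑ P, ∑ M, C S P M • (η M * (ξ S * ξ P)) =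
      ∑ S, ∑ P, ∑ M, C S P M • (η S * (ξ P * ξ M)) := by
    have h (F : Fin n → Fin n → Fin n → SmoothFun N) :
        ∑ S, ∑ P, ∑ M, F S P M = ∑ S, ∑ P, ∑ M, F P M S := by
      rw [Finset.sum_comm' (t' := Finset.univ) (s' := fun _ => Finset.univ) (by simp)]
      conv_rhs => rw [Finset.sum_comm]
      conv_lhs => rw [Finset.sum_comm]
      refine Finset.sum_congr rfl fun P _ => ?_
      rw [Finset.sum_comm]
    rw [h]
    refine Finset.sum_congr rfl fun S _ => Finset.sum_congr rfl fun P _ =>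
      Finset.sum_congr rfl fun M _ => ?_
    rw [hC' P M S]
  simp only [Finset.sum_add_distrib, Finset.sum_sub_distrib]
  rw [h1, h2]
  module

/-- The product rule `first_order_mul` is applied factor by factor, and `D(ε W) = -ε DW` accounts
for the signs of the terms with `DW`. The factor `12` clears the denominators of the Lagrangian. -/
theorem IsSuperfield.lagrangian_vary (hU : IsOpen U) (hX : IsSuperfield U X)
    (G : Fin n → Fin n → TargetFun U) {C : Fin n → Fin n → Fin n → TargetFun U}
    (hC : ∀ S P M, hX.eval hU (C S P M) = -hX.eval hU (C S M P))
    (hC' : ∀ S P M, hX.eval hU (C S P M) = hX.eval hU (C M S P))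
    (hε : parity ε = -ε) (hdε : dTheta ε = 0) (hW : ∀ M, OddFun (W M)) :
    (12 : ℂ) • ((hX.vary hε hW).lagrangian hU G C - hX.lagrangian hU G C) = constFun ε *
      ((6 * Complex.I) • (∑ M, ∑ K, ((∑ L, hX.eval hU ((G M K).pd hU L) • W L) *
          (hX.vel M • hX.covVel K) + hX.eval hU (G M K) • (ddt (W M) * hX.covVel K) -
          (hX.eval hU (G M K) * hX.vel M) • superDeriv (-Complex.I) (W K))) -
        ∑ S, ∑ P, ∑ M, ((∑ L, hX.eval hU ((C S P M).pd hU L) • W L) *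
          (hX.covVel S * hX.covVel P * hX.covVel M) -
          (3 : ℂ) • hX.eval hU (C S P M) •
            (superDeriv (-Complex.I) (W S) * (hX.covVel P * hX.covVel M)))) := by
  have hξ (M) : (hX.vary hε hW).covVel M =
      hX.covVel M + constFun ε * -superDeriv (-Complex.I) (W M) := by
    rw [hX.covVel_vary hε hdε hW, mul_neg, sub_eq_add_neg]
  have e1 (M K) : (hX.vary hε hW).eval hU (G M K) • ((hX.vary hε hW).vel M).val *
      (hX.vary hε hW).covVel K = hX.eval hU (G M K) • (hX.vel M).val * hX.covVel K +
      constFun ε * ((∑ L, hX.eval hU ((G M K).pd hU L) • W L) *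
          (hX.vel M • hX.covVel K) + hX.eval hU (G M K) • (ddt (W M) * hX.covVel K) -
          (hX.eval hU (G M K) * hX.vel M) • superDeriv (-Complex.I) (W K)) := by
    rw [even_smul_def, hX.eval_vary hU hε hW, hX.val_vel_vary hε hW, hξ, first_order_mul hε,
      first_order_mul hε, map_mul, EvenFun.parityFun_val, EvenFun.parityFun_val, even_smul_def,
      mul_smul, even_smul_def _ (ddt _ * _), even_smul_def _ (hX.vel M • _), even_smul_def (hX.vel M),
      even_smul_def (hX.vel M)]
    noncomm_ring
  have e2 (S P M) : (hX.vary hε hW).eval hU (C S P M) • ((hX.vary hε hW).covVel S *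
      (hX.vary hε hW).covVel P * (hX.vary hε hW).covVel M) =
      hX.eval hU (C S P M) • (hX.covVel S * hX.covVel P * hX.covVel M) +
      constFun ε * ((∑ L, hX.eval hU ((C S P M).pd hU L) • W L) *
          (hX.covVel S * hX.covVel P * hX.covVel M) -
        (hX.eval hU (C S P M) •
            (superDeriv (-Complex.I) (W S) * (hX.covVel P * hX.covVel M)) -
          hX.eval hU (C S P M) •
            (superDeriv (-Complex.I) (W P) * (hX.covVel S * hX.covVel M)) +
          hX.eval hU (C S P M) •
            (superDeriv (-Complex.I) (W M) * (hX.covVel S * hX.covVel P)))) := by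
    -- `W` is odd, so `D W` is even and can be moved to the front of the product.
    have hP := commute_of_mem_evenAlg ((hW P).superDeriv_mem (-Complex.I)) (hX.covVel S)
    have hM := commute_of_mem_evenAlg ((hW M).superDeriv_mem (-Complex.I))
      (hX.covVel S * hX.covVel P)
    rw [even_smul_def, hX.eval_vary hU hε hW, hξ, hξ, hξ, first_order_mul hε, first_order_mul hε,
      first_order_mul hε, map_mul, EvenFun.parityFun_val, hX.oddFun_covVel S, hX.oddFun_covVel P,
      even_smul_def, even_smul_def, even_smul_def, even_smul_def, hM, ← mul_assoc _ (hX.covVel S), hP]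
    noncomm_ring
  have e3 := sum_antisymm_mul (ξ := hX.covVel) (η := fun M => superDeriv (-Complex.I) (W M)) hC hC'
  have s1 := Finset.sum_congr rfl fun M (_ : M ∈ Finset.univ) =>
    Finset.sum_congr rfl fun K (_ : K ∈ Finset.univ) => e1 M K
  have s2 := Finset.sum_congr rfl fun S (_ : S ∈ Finset.univ) =>
    Finset.sum_congr rfl fun P (_ : P ∈ Finset.univ) =>
      Finset.sum_congr rfl fun M (_ : M ∈ Finset.univ) => e2 S P M
  have hsum₂ (F H : Fin n → Fin n → SmoothFun N) : ∑ M, ∑ K, (F M K + constFun ε * H M K) =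
      ∑ M, ∑ K, F M K + constFun ε * ∑ M, ∑ K, H M K := by
    simp only [Finset.sum_add_distrib, Finset.mul_sum]
  have hsum₃ (F H : Fin n → Fin n → Fin n → SmoothFun N) :
      ∑ S, ∑ P, ∑ M, (F S P M + constFun ε * H S P M) =
      ∑ S, ∑ P, ∑ M, F S P M + constFun ε * ∑ S, ∑ P, ∑ M, H S P M := by
    simp only [Finset.sum_add_distrib, Finset.mul_sum]
  have hsub (F H : Fin n → Fin n → Fin n → SmoothFun N) :
      ∑ S, ∑ P, ∑ M, (F S P M - H S P M) =
      ∑ S, ∑ P, ∑ M, F S P M - ∑ S, ∑ P, ∑ M, H S P M := by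
    simp only [Finset.sum_sub_distrib]
  have hsmul (F : Fin n → Fin n → Fin n → SmoothFun N) :
      ∑ S, ∑ P, ∑ M, (3 : ℂ) • F S P M = (3 : ℂ) • ∑ S, ∑ P, ∑ M, F S P M := by
    simp only [Finset.smul_sum]
  rw [hsum₂] at s1
  rw [hsum₃, hsub, e3] at s2
  rw [lagrangian, lagrangian, s1, s2, hsub, hsmul]
  simp only [mul_sub, mul_smul_comm]
  module

/-! ### The Lagrangian varies by a total derivative -/

section Surface

variable (hU : IsOpen U) (hX : IsSuperfield U X) (G J : Fin n → Fin n → TargetFun U)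
  (C : Fin n → Fin n → Fin n → TargetFun U)

/-- The quantity `B` with `δL = -D(ε B)`. -/
def IsSuperfield.surface : SmoothFun N :=
  (1 / 12 : ℂ) • ((-2 * Complex.I) • (∑ M, ∑ K, hX.eval hU (G M K) • hX.vel M •
      rot hX.covVel (fun K M => hX.eval hU (J K M)) K) +
    (∑ S, ∑ P, ∑ M, hX.eval hU (C S P M) •
      (rot hX.covVel (fun K M => hX.eval hU (J K M)) S * (hX.covVel P * hX.covVel M))) -
    (2 : ℂ) • superDeriv (-Complex.I) (∑ M, ∑ K, hX.eval hU (G M K) •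
      (rot hX.covVel (fun K M => hX.eval hU (J K M)) M * hX.covVel K)))

variable {hU hX G J C}

theorem IsSuperfield.ddt_covVel (M : Fin n) :
    ddt (hX.covVel M) = superDeriv (-Complex.I) (hX.vel M).val := ddt_superDeriv _ _

/-- The last term of `B` is itself a `D`-derivative, and `D² = -i ∂_t` turns it into a total time
derivative. This is how a time integration by parts is expressed as `D` of something, and it
supplies the terms in `τ`. -/
theorem IsSuperfield.superDeriv_surface :
    (12 : ℂ) • superDeriv (-Complex.I) (hX.surface hU G J C) =
    (-2 * Complex.I) • ∑ M, ∑ K, ((∑ L, hX.eval hU ((G M K).pd hU L) • hX.covVel L) *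
        (hX.vel M • rot hX.covVel (fun K M => hX.eval hU (J K M)) K) +
      hX.eval hU (G M K) • (ddt (hX.covVel M) * rot hX.covVel (fun K M => hX.eval hU (J K M)) K) +
      (hX.eval hU (G M K) * hX.vel M) • rotCov hX.vel hX.covVel (fun K M => hX.eval hU (J K M))
        (fun L K M => hX.eval hU ((J K M).pd hU L)) K) +
      ∑ S, ∑ P, ∑ M, ((∑ L, hX.eval hU ((C S P M).pd hU L) • hX.covVel L) *
          (rot hX.covVel (fun K M => hX.eval hU (J K M)) S * (hX.covVel P * hX.covVel M)) +
        hX.eval hU (C S P M) • (rotCov hX.vel hX.covVel (fun K M => hX.eval hU (J K M))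
          (fun L K M => hX.eval hU ((J K M).pd hU L)) S * (hX.covVel P * hX.covVel M)) +
        Complex.I • hX.eval hU (C S P M) •
          (rot hX.covVel (fun K M => hX.eval hU (J K M)) S * (hX.vel P • hX.covVel M) -
           rot hX.covVel (fun K M => hX.eval hU (J K M)) S * (hX.vel M • hX.covVel P))) +
      (2 * Complex.I) • ∑ M, ∑ K, ((∑ L, hX.eval hU ((G M K).pd hU L) * hX.vel L) •
          (rot hX.covVel (fun K M => hX.eval hU (J K M)) M * hX.covVel K) +
        hX.eval hU (G M K) • (rotDot hX.vel hX.covVel (fun K => ddt (hX.covVel K))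
          (fun K M => hX.eval hU (J K M))
          (fun L K M => hX.eval hU ((J K M).pd hU L)) M * hX.covVel K) +
        hX.eval hU (G M K) • (rot hX.covVel (fun K M => hX.eval hU (J K M)) M *
          ddt (hX.covVel K))) := by
  have hY := oddFun_rot hX.oddFun_covVel (fun K M => hX.eval hU (J K M))
  have hDY := hX.superDeriv_rot hU J
  have hTY := hX.ddt_rot hU J
  have e1 (M K) : superDeriv (-Complex.I) (hX.eval hU (G M K) • hX.vel M •
      rot hX.covVel (fun K M => hX.eval hU (J K M)) K) =
      (∑ L, hX.eval hU ((G M K).pd hU L) • hX.covVel L) *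
        (hX.vel M • rot hX.covVel (fun K M => hX.eval hU (J K M)) K) +
      hX.eval hU (G M K) • (ddt (hX.covVel M) * rot hX.covVel (fun K M => hX.eval hU (J K M)) K) +
      (hX.eval hU (G M K) * hX.vel M) • rotCov hX.vel hX.covVel (fun K M => hX.eval hU (J K M))
        (fun L K M => hX.eval hU ((J K M).pd hU L)) K := by
    rw [superDeriv_smul, superDeriv_smul, hX.superDeriv_eval hU, ← ddt_covVel, hDY, smul_add,
      ← mul_smul, ← add_assoc]
    rfl
  have e2 (S P M) : superDeriv (-Complex.I) (hX.eval hU (C S P M) •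
      (rot hX.covVel (fun K M => hX.eval hU (J K M)) S * (hX.covVel P * hX.covVel M))) =
      (∑ L, hX.eval hU ((C S P M).pd hU L) • hX.covVel L) *
          (rot hX.covVel (fun K M => hX.eval hU (J K M)) S * (hX.covVel P * hX.covVel M)) +
        hX.eval hU (C S P M) • (rotCov hX.vel hX.covVel (fun K M => hX.eval hU (J K M))
          (fun L K M => hX.eval hU ((J K M).pd hU L)) S * (hX.covVel P * hX.covVel M)) +
        Complex.I • hX.eval hU (C S P M) •
          (rot hX.covVel (fun K M => hX.eval hU (J K M)) S * (hX.vel P • hX.covVel M) -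
           rot hX.covVel (fun K M => hX.eval hU (J K M)) S * (hX.vel M • hX.covVel P)) := by
    rw [superDeriv_smul, hX.superDeriv_eval hU, superDeriv_odd_mul _ (hY S),
      superDeriv_odd_mul _ (hX.oddFun_covVel P), hDY, hX.superDeriv_covVel, hX.superDeriv_covVel,
      add_assoc, ← smul_comm (hX.eval hU (C S P M)), ← smul_add]
    congr 2
    rw [mul_smul_comm, ← commute_of_mem_evenAlg (hX.vel M).prop, even_smul_def, even_smul_def]
    simp only [mul_sub, smul_mul_assoc, mul_smul_comm, smul_sub]
    module
  have e3 (M K) : ddt (hX.eval hU (G M K) •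
      (rot hX.covVel (fun K M => hX.eval hU (J K M)) M * hX.covVel K)) =
      (∑ L, hX.eval hU ((G M K).pd hU L) * hX.vel L) •
          (rot hX.covVel (fun K M => hX.eval hU (J K M)) M * hX.covVel K) +
        hX.eval hU (G M K) • (rotDot hX.vel hX.covVel (fun K => ddt (hX.covVel K))
          (fun K M => hX.eval hU (J K M))
          (fun L K M => hX.eval hU ((J K M).pd hU L)) M * hX.covVel K) +
        hX.eval hU (G M K) • (rot hX.covVel (fun K M => hX.eval hU (J K M)) M *
          ddt (hX.covVel K)) := by
    rw [even_smul_def, ddt_mul, hX.ddt_eval hU, Finset.sum_mul, Finset.sum_smul, ddt_mul, hTY,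
      ← even_smul_def, smul_add, ← add_assoc]
    rfl
  simp only [← e1, ← e2, ← e3, ← map_sum]
  rw [surface, map_smul, map_sub, map_add, map_smul, map_smul, superDeriv_sq]
  module

/-- Carrying out the inner `D` shows a factor `Y` or `DX` in every summand, which is what the
boundary argument needs. -/
theorem IsSuperfield.surface_eq : hX.surface hU G J C =
    (1 / 12 : ℂ) • ((-2 * Complex.I) • (∑ M, ∑ K, hX.eval hU (G M K) • hX.vel M •
        rot hX.covVel (fun K M => hX.eval hU (J K M)) K) +
      (∑ S, ∑ P, ∑ M, hX.eval hU (C S P M) •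
        (rot hX.covVel (fun K M => hX.eval hU (J K M)) S * (hX.covVel P * hX.covVel M))) -
      (2 : ℂ) • ∑ M, ∑ K, ((∑ L, hX.eval hU ((G M K).pd hU L) • hX.covVel L) *
          (rot hX.covVel (fun K M => hX.eval hU (J K M)) M * hX.covVel K) +
        hX.eval hU (G M K) • (hX.covVel K * rotCov hX.vel hX.covVel
          (fun K M => hX.eval hU (J K M)) (fun L K M => hX.eval hU ((J K M).pd hU L)) M +
          Complex.I • (rot hX.covVel (fun K M => hX.eval hU (J K M)) M * (hX.vel K).val)))) := by
  have hY := oddFun_rot hX.oddFun_covVel (fun K M => hX.eval hU (J K M))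
  have h (M K) : superDeriv (-Complex.I) (hX.eval hU (G M K) •
      (rot hX.covVel (fun K M => hX.eval hU (J K M)) M * hX.covVel K)) =
      (∑ L, hX.eval hU ((G M K).pd hU L) • hX.covVel L) *
          (rot hX.covVel (fun K M => hX.eval hU (J K M)) M * hX.covVel K) +
        hX.eval hU (G M K) • (hX.covVel K * rotCov hX.vel hX.covVel
          (fun K M => hX.eval hU (J K M)) (fun L K M => hX.eval hU ((J K M).pd hU L)) M +
          Complex.I • (rot hX.covVel (fun K M => hX.eval hU (J K M)) M * (hX.vel K).val)) := by
    rw [superDeriv_smul, hX.superDeriv_eval hU, superDeriv_odd_mul _ (hY M), hX.superDeriv_covVel,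
      commute_of_mem_evenAlg ((hY M).superDeriv_mem (-Complex.I)), hX.superDeriv_rot hU J,
      mul_smul_comm, neg_smul, sub_neg_eq_add]
    rfl
  simp only [surface, map_sum, h]

/-! ### Boundary values of the surface term -/

/-- The value at a moment of time. -/
def evalAt (t : ℝ) : SmoothFun N →ₐ[ℂ] Grass N where
  toFun F := F.val t
  map_one' := rfl
  map_mul' _ _ := rfl
  map_zero' := rfl
  map_add' _ _ := rfl
  commutes' _ := rfl

/-- The functions with equal values at `a` and `b` form a subalgebra. It contains `f(X)`, `Ẋ` and
`DX`, and expanding the inner `D` of the surface term produces nothing beyond these, in particular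
no second time derivative. -/
theorem IsSuperfield.surface_periodic {a b : ℝ} (hab : ∀ M, X M a = X M b)
    (hab' : ∀ M, timeDeriv (X M) a = timeDeriv (X M) b) :
    (hX.surface hU G J C).val a = (hX.surface hU G J C).val b := by
  set A := AlgHom.equalizer (evalAt (N := N) a) (evalAt b) with hA
  have heval (f) : (hX.eval hU f).val ∈ A := by
    change (hX.eval hU f).val.val a = (hX.eval hU f).val.val b
    have hbody : body X a = body X b := funext fun M => by rw [body, body, hab]
    have hsoul (M) : soul X M a = soul X M b := by rw [soul, soul, hab, hbody]
    simp only [hX.coe_eval, superEval, hbody, hsoul]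
  have hvel (M) : (hX.vel M).val ∈ A := hab' M
  have hcov (M) : hX.covVel M ∈ A := by
    have h : (hX.covVel M).val = covD (X M) := coe_superDeriv_neg_I _
    change (hX.covVel M).val a = (hX.covVel M).val b
    simp only [h, covD, hab, hab']
  have hsmul (F : EvenFun N) (H : SmoothFun N) (hF : F.val ∈ A) (hH : H ∈ A) : F • H ∈ A :=
    A.mul_mem hF hH
  have hrot (M) : rot hX.covVel (fun K M => hX.eval hU (J K M)) M ∈ A :=
    A.sum_mem fun K _ => hsmul _ _ (heval _) (hcov K)
  have hmem : hX.surface hU G J C ∈ A := by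
    refine A.smul_mem (A.sub_mem (A.add_mem (A.smul_mem (A.sum_mem fun M _ => A.sum_mem fun K _ =>
      hsmul _ _ (heval _) (hsmul _ _ (hvel M) (hrot K))) _)
      (A.sum_mem fun S _ => A.sum_mem fun P _ => A.sum_mem fun M _ =>
        hsmul _ _ (heval _) (A.mul_mem (hrot S) (A.mul_mem (hcov P) (hcov M))))) ?_) _
    rw [map_sum]
    refine A.smul_mem (A.sum_mem fun M _ => ?_) _
    rw [map_sum]
    refine A.sum_mem fun K _ => ?_
    rw [superDeriv_smul, hX.superDeriv_eval hU,
      superDeriv_odd_mul _ (oddFun_rot hX.oddFun_covVel _ M), hX.superDeriv_covVel,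
      hX.superDeriv_rot hU J]
    refine A.add_mem (A.mul_mem (A.sum_mem fun L _ => hsmul _ _ (heval _) (hcov L))
      (A.mul_mem (hrot M) (hcov K))) (hsmul _ _ (heval _) (A.sub_mem (A.mul_mem (A.sub_mem
        (A.sum_mem fun K _ => A.mul_mem (A.sum_mem fun L _ => hsmul _ _ (heval _) (hcov L))
          (hcov K)) (A.smul_mem ?_ _)) (hcov K)) (A.mul_mem (hrot M) (A.smul_mem (hvel K) _))))
    rw [Finset.sum_smul]
    refine A.sum_mem fun L _ => ?_
    rw [mul_smul]
    exact hsmul _ _ (heval _) (hsmul _ _ (hvel L) A.one_mem)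
  exact hmem

/-- The functions whose product with `ε` vanishes at `θ = 0` at a moment of time. -/
def vanishing (ε : Grass N) (t : ℝ) : Submodule ℂ (SmoothFun N) :=
  LinearMap.ker ((dTheta.comp (LinearMap.mulLeft ℂ (theta N))).comp
    ((LinearMap.mulLeft ℂ ε).comp (evalAt t).toLinearMap))

theorem mem_vanishing {t : ℝ} {F : SmoothFun N} :
    F ∈ vanishing ε t ↔ atThetaZero (ε * F.val t) = 0 := Iff.rfl

theorem mul_mem_vanishing {t : ℝ} {F : SmoothFun N} (hF : F ∈ vanishing ε t) (H : SmoothFun N) :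
    F * H ∈ vanishing ε t := by
  rw [mem_vanishing] at hF ⊢
  change atThetaZero (ε * (F.val t * H.val t)) = 0
  rw [← mul_assoc, atThetaZero_mul, hF, zero_mul]

theorem smul_mem_vanishing {t : ℝ} {F : SmoothFun N} (H : EvenFun N) (hF : F ∈ vanishing ε t) :
    H • F ∈ vanishing ε t := by
  rw [even_smul_def, commute_of_mem_evenAlg H.prop]
  exact mul_mem_vanishing hF _

/-- Because evaluation at `θ = 0` is multiplicative, one factor annihilated after multiplication by
`ε` suffices, and `surface_eq` exhibits such a factor in each summand. -/
theorem IsSuperfield.surface_mem_vanishing {t : ℝ}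
    (hY : ∀ M, rot hX.covVel (fun K M => hX.eval hU (J K M)) M ∈ vanishing ε t)
    (hξ : ∀ M, hX.covVel M ∈ vanishing ε t) : hX.surface hU G J C ∈ vanishing ε t := by
  rw [surface_eq]
  exact Submodule.smul_mem _ _ (Submodule.sub_mem _ (Submodule.add_mem _
    (Submodule.smul_mem _ _ (Submodule.sum_mem _ fun M _ => Submodule.sum_mem _ fun K _ =>
      smul_mem_vanishing _ (smul_mem_vanishing _ (hY K))))
    (Submodule.sum_mem _ fun S _ => Submodule.sum_mem _ fun P _ => Submodule.sum_mem _ fun M _ =>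
      smul_mem_vanishing _ (mul_mem_vanishing (hY S) _)))
    (Submodule.smul_mem _ _ (Submodule.sum_mem _ fun M _ => Submodule.sum_mem _ fun K _ =>
      Submodule.add_mem _ (mul_mem_vanishing (Submodule.sum_mem _ fun L _ =>
        smul_mem_vanishing _ (hξ L)) _) (smul_mem_vanishing _ (Submodule.add_mem _
          (mul_mem_vanishing (hξ K) _) (Submodule.smul_mem _ _ (mul_mem_vanishing (hY M) _)))))))

end Surface

end SuperSigma

namespace SuperSigma

variable {N n : ℕ} {U : Set (Fin n → ℝ)} {X : Fin n → SFun N} {ε : Grass N}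
  {g I : (Fin n → ℝ) → Matrix (Fin n) (Fin n) ℝ}
  {C : (Fin n → ℝ) → (Fin n → ℝ) [⋀^Fin 3]→L[ℝ] ℝ}

/-! ### Invariance of the action -/

/-- The components of a smooth 3-form as target functions. -/
def torsionFun (hC : ContDiffOn ℝ (⊤ : ℕ∞) C U) (S P M : Fin n) : TargetFun U :=
  .mk (comp3 C S P M) (contDiffOn_comp3 hC S P M)

theorem IsSuperfield.coe_lagrangian (hU : IsOpen U) (hX : IsSuperfield U X)
    (hg : ∀ M K, ContDiffOn ℝ (⊤ : ℕ∞) (fun x => g x M K) U) (hC : ContDiffOn ℝ (⊤ : ℕ∞) C U) :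
    (hX.lagrangian hU (matFun hg) (torsionFun hC)).val = superLagrangian g C X := by
  funext t
  have hcov (M) : (hX.covVel M).val t = covD (X M) t :=
    congrFun (coe_superDeriv_neg_I (hX.fieldFun M)) t
  have h1 : (∑ M, ∑ K, hX.eval hU (matFun hg M K) • (hX.vel M).val * hX.covVel K).val t =
      ∑ M, ∑ K, superEval (fun y => g y M K) X t * timeDeriv (X M) t * covD (X K) t := by
    simp only [SmoothFun.sum_apply, ← hcov]
    exact Finset.sum_congr rfl fun M _ => Finset.sum_congr rfl fun K _ =>
      congrArg (fun z => z * timeDeriv (X M) t * (hX.covVel K).val t)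
        (congrFun (hX.coe_eval hU (matFun hg M K)) t)
  have h2 : (∑ S, ∑ P, ∑ M, hX.eval hU (torsionFun hC S P M) •
      (hX.covVel S * hX.covVel P * hX.covVel M)).val t =
      ∑ S, ∑ P, ∑ M, superEval (comp3 C S P M) X t * covD (X S) t * covD (X P) t *
        covD (X M) t := by
    simp only [SmoothFun.sum_apply, ← hcov]
    refine Finset.sum_congr rfl fun S _ => Finset.sum_congr rfl fun P _ =>
      Finset.sum_congr rfl fun M _ => ?_
    have h := congrArg (fun z => z * ((hX.covVel S).val t * (hX.covVel P).val t *
      (hX.covVel M).val t)) (congrFun (hX.coe_eval hU (torsionFun hC S P M)) t)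
    refine Eq.trans h ?_
    simp only [mul_assoc]
    rfl
  have h : (hX.lagrangian hU (matFun hg) (torsionFun hC)).val t = (Complex.I / 2) •
      (∑ M, ∑ K, hX.eval hU (matFun hg M K) • (hX.vel M).val * hX.covVel K).val t -
      (1 / 12 : ℂ) • (∑ S, ∑ P, ∑ M, hX.eval hU (torsionFun hC S P M) •
        (hX.covVel S * hX.covVel P * hX.covVel M)).val t := rfl
  rw [h, h1, h2, superLagrangian]
  simp only [Pi.sub_apply, Pi.smul_apply, Finset.sum_apply, Pi.mul_apply]

/-- The tensor identities hold pointwise on `U`, and evaluation transports them to the even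
coefficients. They are the hypotheses of `variation_eq_superDeriv`, which identifies the two sides
up to the common factor `12`. -/
theorem IsSuperfield.lagrangian_extra (hU : IsOpen U) (hX : IsSuperfield U X)
    (hg : ∀ M K, ContDiffOn ℝ (⊤ : ℕ∞) (fun x => g x M K) U)
    (hI : ∀ M K, ContDiffOn ℝ (⊤ : ℕ∞) (fun x => I x M K) U)
    (hC : ContDiffOn ℝ (⊤ : ℕ∞) C U)
    (hgsymm : ∀ x ∈ U, (g x).IsSymm) (hgdet : ∀ x ∈ U, IsUnit (g x).det)
    (h3 : ∀ x ∈ U, ∀ M K, lowered g I M K x = -lowered g I K M x)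
    (h4 : ∀ x ∈ U, ∀ L M K, nablaHat g C I L M K x + nablaHat g C I M L K x = 0)
    (h5 : ∀ x ∈ U, iota (endo (I x)) (extDeriv C x) =
        (2 / 3 : ℝ) • extDeriv (fun y => iota (endo (I y)) (C y)) x) (hε : parity ε = -ε)
    (hdε : dTheta ε = 0) :
    (hX.vary hε (hX.oddFun_extra hU hI)).lagrangian hU (matFun hg) (torsionFun hC) -
        hX.lagrangian hU (matFun hg) (torsionFun hC) =
      constFun ε * superDeriv (-Complex.I)
        (hX.surface hU (matFun hg) (matFun hI) (torsionFun hC)) := by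
  have hswap (S P M) : hX.eval hU (torsionFun hC S P M) = -hX.eval hU (torsionFun hC S M P) := by
    rw [← map_neg]
    exact hX.eval_congr hU fun x _ => comp3_swap S P M x
  have hrot (S P M) : hX.eval hU (torsionFun hC S P M) = hX.eval hU (torsionFun hC M S P) :=
    hX.eval_congr hU fun x _ => comp3_rotate S P M x
  have hGs (M K) : hX.eval hU (matFun hg M K) = hX.eval hU (matFun hg K M) :=
    hX.eval_congr hU fun x hx => (hgsymm x hx).apply K M
  have hGJ (M K) : ∑ L, hX.eval hU (matFun hI M L) * hX.eval hU (matFun hg L K) =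
      -∑ L, hX.eval hU (matFun hI K L) * hX.eval hU (matFun hg L M) := by
    have h := hX.eval_congr hU (f := ∑ L, matFun hI M L * matFun hg L K)
      (h := -∑ L, matFun hI K L * matFun hg L M) (fun x hx => by
        simp only [TargetFun.val_neg, TargetFun.val_sum, TargetFun.val_mul]
        have e := h3 x hx M K
        simp only [lowered] at e
        have e2 (M K L) : (matFun hI M L).val x * (matFun hg L K).val x = g x K L * I x M L := by
          rw [mul_comm]
          exact congrArg (· * I x M L) ((hgsymm x hx).apply K L)
        simp only [e2]
        exact e)
    simpa only [map_neg, map_sum, map_mul] using h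
  have hcubic (L K N') := hX.eval_congr hU
    (f := 3 * (∑ M, matFun hI K M * (matFun hg L N').pd hU M) +
        2 * (∑ M, matFun hg M N' * (matFun hI K M).pd hU L) -
        2 * (∑ M, matFun hg L M * (matFun hI N' M).pd hU K) +
        (∑ M, matFun hI N' M * (matFun hg L M).pd hU K) -
        (∑ M, matFun hI K M * (matFun hg M N').pd hU L) -
        (∑ S, matFun hI K S * torsionFun hC S L N') - (∑ S, matFun hI L S * torsionFun hC S K N'))
    (h := 3 * (∑ M, matFun hI N' M * (matFun hg L K).pd hU M) +
        2 * (∑ M, matFun hg M K * (matFun hI N' M).pd hU L) -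
        2 * (∑ M, matFun hg L M * (matFun hI K M).pd hU N') +
        (∑ M, matFun hI K M * (matFun hg L M).pd hU N') -
        (∑ M, matFun hI N' M * (matFun hg M K).pd hU L) -
        (∑ S, matFun hI N' S * torsionFun hC S L K) - (∑ S, matFun hI L S * torsionFun hC S N' K))
    (fun x hx => by
      simp only [TargetFun.val_sub, TargetFun.val_add, TargetFun.val_sum, TargetFun.val_mul]
      exact cubic_identity hU hg hI hgsymm hgdet h3 h4 hx L K N')
  simp only [map_sub, map_add, map_sum, map_mul, map_ofNat] at hcubic
  have hquartic := quartic_relation hX.covVel_anticomm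
    (α := fun a b c d => ∑ S, hX.eval hU (matFun hI a S) *
      hX.eval hU ((torsionFun hC b c d).pd hU S))
    (β := fun a b c d => ∑ S, hX.eval hU (matFun hI b S) *
      hX.eval hU ((torsionFun hC S c d).pd hU a))
    (γ := fun a b c d => ∑ S, hX.eval hU (torsionFun hC S c d) *
      hX.eval hU ((matFun hI b S).pd hU a)) fun a b c d => by
    have h := hX.eval_congr hU
      (f := 3 * (alternate₁ (fun a b c d => ∑ S, matFun hI a S * (torsionFun hC b c d).pd hU S)
          a b c d +
        alternate₂ (fun a b c d => ∑ S, matFun hI b S * (torsionFun hC S c d).pd hU a) a b c d))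
      (h := 2 * (alternate₂ (fun a b c d => ∑ S, matFun hI b S * (torsionFun hC S c d).pd hU a)
          a b c d +
        alternate₂ (fun a b c d => ∑ S, torsionFun hC S c d * (matFun hI b S).pd hU a) a b c d))
      (fun x hx => by
        have e := torsion_identity hU hC hI hx (h5 x hx) a b c d
        simp only [alternate₁, alternate₂] at e ⊢
        simp only [TargetFun.val_sub, TargetFun.val_add, TargetFun.val_sum, TargetFun.val_mul]
        exact e)
    simp only [alternate₁, alternate₂] at h ⊢
    simpa only [map_sub, map_add, map_sum, map_mul, map_ofNat] using h
  have hvar := hX.lagrangian_vary hU (matFun hg) hswap hrot hε hdε (hX.oddFun_extra hU hI)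
  have hsurf := variation_eq_superDeriv (p := hX.vel) (τ := fun K => ddt (hX.covVel K))
    hX.covVel_anticomm
    (fun a b => (hX.oddFun_covVel a).ddt.mul_comm (hX.oddFun_covVel b)) hGs hGJ hswap
    (dG := fun L M K => hX.eval hU ((matFun hg M K).pd hU L))
    (dJ := fun L M K => hX.eval hU ((matFun hI M K).pd hU L))
    (dC := fun L S P M => hX.eval hU ((torsionFun hC S P M).pd hU L)) hcubic hquartic
  rw [← IsSuperfield.superDeriv_surface] at hsurf
  have hY (M) : superDeriv (-Complex.I) (hX.extra hU hI M) = _ := hX.superDeriv_rot hU _ M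
  have hTY (M) : ddt (hX.extra hU hI M) = _ := hX.ddt_rot hU _ M
  simp only [hY, hTY] at hvar
  have h := hvar.trans (congrArg (constFun ε * ·) hsurf)
  rw [mul_smul_comm] at h
  exact smul_right_injective _ (by norm_num : (12 : ℂ) ≠ 0) h

/-- From `Y = I DX` and `I² = -1`. It turns vanishing of `ε Y` at an end point into vanishing of `ε
DX` there. -/
theorem IsSuperfield.covVel_eq_neg_rot_extra (hU : IsOpen U) (hX : IsSuperfield U X)
    (hI : ∀ M K, ContDiffOn ℝ (⊤ : ℕ∞) (fun x => I x M K) U) (h1 : ∀ x ∈ U, I x * I x = -1)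
    (K : Fin n) : hX.covVel K = -∑ M, hX.eval hU (matFun hI M K) • hX.extra hU hI M := by
  simp only [extra]
  rw [sum_smul_rot]
  simp only [hX.sum_matFun_mul hU hI h1, ite_smul, zero_smul, Finset.sum_ite_eq',
    Finset.mem_univ, if_true, neg_smul, one_smul, neg_neg]

theorem IsSuperfield.action_extraSusy (hU : IsOpen U) (hX : IsSuperfield U X)
    (hg : ∀ M K, ContDiffOn ℝ (⊤ : ℕ∞) (fun x => g x M K) U)
    (hI : ∀ M K, ContDiffOn ℝ (⊤ : ℕ∞) (fun x => I x M K) U)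
    (hC : ContDiffOn ℝ (⊤ : ℕ∞) C U)
    (hgsymm : ∀ x ∈ U, (g x).IsSymm) (hgdet : ∀ x ∈ U, IsUnit (g x).det)
    (h1 : ∀ x ∈ U, I x * I x = -1)
    (h3 : ∀ x ∈ U, ∀ M K, lowered g I M K x = -lowered g I K M x)
    (h4 : ∀ x ∈ U, ∀ L M K, nablaHat g C I L M K x + nablaHat g C I M L K x = 0)
    (h5 : ∀ x ∈ U, iota (endo (I x)) (extDeriv C x) =
        (2 / 3 : ℝ) • extDeriv (fun y => iota (endo (I y)) (C y)) x) (hε : IsOddParameter ε)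
    {a b : ℝ} (hab : NoSurfaceTerms I a b ε X) :
    action g C a b (extraSusy I ε X) = action g C a b X := by
  have hε' := hε.1.parity_eq
  have hvar := hX.lagrangian_extra hU hg hI hC hgsymm hgdet h3 h4 h5 hε' hε.2
  set B := hX.surface hU (matFun hg) (matFun hI) (torsionFun hC) with hB
  -- `D` passes the constant odd `ε` with a sign, so the change of the Lagrangian is a
  -- `D`-derivative and integrates to boundary values.
  have hderiv : constFun ε * superDeriv (-Complex.I) B =
      superDeriv (-Complex.I) (-(constFun ε * B)) := by
    rw [map_neg, superDeriv_odd_mul _ (oddFun_constFun hε'), superDeriv_constFun hε.2, zero_mul,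
      zero_sub, neg_neg]
  -- For fixed end points both sides are zero, as `Y` and `DX` are annihilated by `ε` at `θ = 0`; in
  -- the periodic case `B` itself takes equal values.
  have hbd : atThetaZero (ε * B.val a) = atThetaZero (ε * B.val b) := by
    rcases hab with h | h
    · have hY (t : ℝ) (ht : ∀ M, atThetaZero (extraVar I ε X M t) = 0) (M) :
          hX.extra hU hI M ∈ vanishing ε t := by
        rw [mem_vanishing, ← ht M, hX.extraVar_eq hU hI]
      have hmem (t : ℝ) (ht : ∀ M, atThetaZero (extraVar I ε X M t) = 0) :
          B ∈ vanishing ε t := by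
        refine IsSuperfield.surface_mem_vanishing (hY t ht) fun M => ?_
        rw [hX.covVel_eq_neg_rot_extra hU hI h1]
        exact Submodule.neg_mem _ (Submodule.sum_mem _ fun K _ => smul_mem_vanishing _ (hY t ht K))
      exact (mem_vanishing.1 (hmem a fun M => (h M).1)).trans
        (mem_vanishing.1 (hmem b fun M => (h M).2)).symm
    · rw [hB, IsSuperfield.surface_periodic (fun M => (h M).1) fun M => (h M).2]
  have hint := superIntegral_superDeriv a b (-Complex.I) (-(constFun ε * B))
  rw [← hderiv, ← hvar, superIntegral_sub, hX.coe_lagrangian,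
    (hX.vary hε' (hX.oddFun_extra hU hI)).coe_lagrangian, ← hX.extraSusy_eq hU hI] at hint
  have hval (t) : atThetaZero ((-(constFun ε * B)).val t) = -atThetaZero (ε * B.val t) := by
    change atThetaZero (-(ε * B.val t)) = _
    rw [atThetaZero, mul_neg, map_neg]
    rfl
  rw [hval, hval, hbd, sub_self, smul_zero, sub_eq_zero] at hint
  exact hint

end SuperSigma

end

/-- Let `g` (a metric), `I` and `C` (a 3-form) be smooth on a coordinate domain `U`. If
1. `I² = -1`, 2. `I` is integrable, 3. `I_{MK}` is skew-symmetric,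
4. `∇̂_L I_M^K + ∇̂_M I_L^K = 0`, 5. `ι dC = (2/3) d(ι C)`,
then the action is invariant under `δX^M = ε I_K^M DX^K`, and the manifest and the extra
supersymmetry satisfy (off shell) the algebra `Q₁² = Q₂² = H`, `{Q₁, Q₂} = 0`, where
`H` generates time translations. -/
theorem theorem3 {n : ℕ} (U : Set (Fin n → ℝ)) (hU : IsOpen U)
    (g : (Fin n → ℝ) → Matrix (Fin n) (Fin n) ℝ)
    (I : (Fin n → ℝ) → Matrix (Fin n) (Fin n) ℝ)
    (C : (Fin n → ℝ) → (Fin n → ℝ) [⋀^Fin 3]→L[ℝ] ℝ)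
    (hg : ∀ M K, ContDiffOn ℝ (⊤ : ℕ∞) (fun x => g x M K) U)
    (hI : ∀ M K, ContDiffOn ℝ (⊤ : ℕ∞) (fun x => I x M K) U)
    (hC : ContDiffOn ℝ (⊤ : ℕ∞) C U)
    (hgsymm : ∀ x ∈ U, (g x).IsSymm) (hgdet : ∀ x ∈ U, IsUnit (g x).det)
    (h1 : ∀ x ∈ U, I x * I x = -1)
    (h2 : SuperSigma.IsIntegrableOn I U)
    (h3 : ∀ x ∈ U, ∀ M K, SuperSigma.lowered g I M K x = -SuperSigma.lowered g I K M x)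
    (h4 : ∀ x ∈ U, ∀ L M K,
      SuperSigma.nablaHat g C I L M K x + SuperSigma.nablaHat g C I M L K x = 0)
    (h5 : ∀ x ∈ U,
      SuperSigma.iota (SuperSigma.endo (I x)) (extDeriv C x) =
        (2 / 3 : ℝ) • extDeriv (fun y => SuperSigma.iota (SuperSigma.endo (I y)) (C y)) x) :
    (∀ (N : ℕ) (X : Fin n → SuperSigma.SFun N), SuperSigma.IsSuperfield U X →
      ∀ ε : SuperSigma.Grass N, SuperSigma.IsOddParameter ε →
      ∀ a b : ℝ, a < b → SuperSigma.NoSurfaceTerms I a b ε X →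
        SuperSigma.action g C a b (SuperSigma.extraSusy I ε X) = SuperSigma.action g C a b X) ∧
    (∀ (N : ℕ) (X : Fin n → SuperSigma.SFun N), SuperSigma.IsSuperfield U X →
      ∀ ε₁ ε₂ : SuperSigma.Grass N,
      SuperSigma.IsOddParameter ε₁ → SuperSigma.IsOddParameter ε₂ → ∀ (M : Fin n) (t : ℝ),
        SuperSigma.commutator (SuperSigma.manifestSusy ε₁) (SuperSigma.manifestSusy ε₂) X M t =
          -(2 * Complex.I) • (ε₁ * ε₂ * SuperSigma.timeDeriv (X M) t) ∧
        SuperSigma.commutator (SuperSigma.extraSusy I ε₁) (SuperSigma.extraSusy I ε₂) X M t =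
          -(2 * Complex.I) • (ε₁ * ε₂ * SuperSigma.timeDeriv (X M) t) ∧
        SuperSigma.commutator (SuperSigma.manifestSusy ε₁) (SuperSigma.extraSusy I ε₂) X M t =
          0) := by
  refine ⟨fun N X hX ε hε a b _ hab => hX.action_extraSusy hU hg hI hC hgsymm hgdet h1 h3 h4 h5 hε hab,
    fun N X hX ε₁ ε₂ hε₁ hε₂ M t => ⟨?_, ?_, ?_⟩⟩
  · exact SuperSigma.commutator_manifest hX hε₁ hε₂ M t
  · exact SuperSigma.commutator_extra hU hX hI h1 h2 hε₁ hε₂ M t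
  · exact SuperSigma.commutator_manifest_extra hU hX hI hε₁ hε₂ M t
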